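/- Let $k$ be an algebraically closed field of characteristic zero, let $d\ge 0$, and let $X$ be a separated smooth $k$-scheme of dimension $d$ (i.e. smooth of relative dimension $d$ over $k$). Let $\mathrm{FSch}/k$ be the category of finite adic formal schemes over $k$, i.e. of locally topologically ringed spaces over $\operatorname{Spec} k$ that are locally of the form $\operatorname{Spc} T=(\operatorname{Spec} T/I,\ \varprojlim_n (T/I^n)^{\sim})$, where $T$ is a ring that is separated and complete for the topology defined by a finitely generated ideal $I$; it contains $\mathrm{Sch}/k$ as a full subcategory. For $Y\in \mathrm{FSch}/k$ let $Y[[t_1,\dots,t_d]]$ be the completion of $Y\times\mathbb{A}^d_k$ at $\mathcal{I}+(t_1,\dots,t_d)$, where $\mathcal{I}$ is a locally finitely generated ideal of definition of $Y$; in other words, $Y[[t_1,\dots,t_d]]$ has the underlying space of $Y$ and the structure sheaf $U\mapsto\mathcal{O}_Y(U)[[t_1,\dots,t_d]]$. Let $p_Y:Y[[t_1,\dots,t_d]]\to Y$ be the projection and $i_Y:Y\to Y[[t_1,\dots,t_d]]$ the zero section. For a $k$-scheme $Y$ and a $k$-morphism $\phi:Y[[t_1,\dots,t_d]]\to X$ put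 $\phi_0=\phi\circ i_Y:Y\to X$, let $\operatorname{Jet}_{\phi_0,\infty}$ be the completion of $X\times_k Y$ along the graph of $\phi_0$, and let $\hat\phi_0:Y[[t_1,\dots,t_d]]\to\operatorname{Jet}_{\phi_0,\infty}$ be the completion of $(\phi,p_Y):Y[[t_1,\dots,t_d]]\to X\times_k Y$, i.e. the morphism of formal schemes whose composition with $\operatorname{Jet}_{\phi_0,\infty}\to X\times_k Y$ is $(\phi,p_Y)$. One says that $\phi$ is a local coordinate system on $X$ parametrized by $Y$ if $\hat\phi_0$ is an isomorphism of formal schemes. Then the functor $$\Phi:(\mathrm{FSch}/k)^{\mathrm{op}}\to\mathrm{Set},\qquad Y\mapsto \operatorname{Hom}_k(Y[[t_1,\dots,t_d]],X)$$ is represented by a $k$-scheme $X^{\mathbf d}$ (the value at $X$ of the right adjoint of $Y\mapsto Y[[t_1,\dots,t_d]]$), and $X^{\mathbf d}$ is affine over $X$ via the morphism $\theta_0:X^{\mathbf d}\to X$ obtained from the universal morphism $\theta:X^{\mathbf d}[[t_1,\dots,t_d]]\to X$. The local coordinate systems on $X$ form a subfunctor $$\Phi^0:(\mathrm{Sch}/k)^{\mathrm{op}}\to\mathrm{Set},\qquad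 Y\mapsto\{\text{local coordinate systems on } X \text{ parametrized by } Y\}$$ of the restriction of $\Phi$ to $\mathrm{Sch}/k$. This subfunctor is representable by an open subscheme $X^{\mathrm{coord}}$ of $X^{\mathbf d}$ (compatibly with the inclusion $\Phi^0\subset\Phi$: the universal local coordinate system is the restriction of $\theta$ to $X^{\mathrm{coord}}$), and $X^{\mathrm{coord}}$ is still affine over $X$. -/

import Mathlib

open CategoryTheory AlgebraicGeometry TopologicalSpace Opposite Limits

universe u

noncomputable section

namespace FormalGeometry

/-- A locally topologically ringed space: a locally ringed space whose structure sheaf is a sheaf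
of topological rings, i.e. every ring of sections is a topological ring, and for every open cover
`U = ⋃ V i` the topology of `𝒪(U)` is the one induced by `𝒪(U) ⟶ ∏ 𝒪(V i)`. -/
structure TopLRS extends LocallyRingedSpace.{u} where
  sectionTop : ∀ U : Opens toLocallyRingedSpace.toTopCat,
    TopologicalSpace (presheaf.obj (op U))
  isTopologicalRing : ∀ U, @IsTopologicalRing (presheaf.obj (op U)) (sectionTop U) _
  sectionTop_eq : ∀ (U : Opens toLocallyRingedSpace.toTopCat) {ι : Type u}
    (V : ι → Opens toLocallyRingedSpace.toTopCat) (hV : ∀ i, V i ≤ U), U ≤ ⨆ i, V i →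
    sectionTop U = ⨅ i, (sectionTop (V i)).induced (presheaf.map (homOfLE (hV i)).op)

namespace TopLRS

/-- A morphism of locally topologically ringed spaces: a morphism of locally ringed spaces that
is continuous on sections. -/
@[ext]
structure Hom (X Y : TopLRS.{u}) where
  toLRSHom : X.toLocallyRingedSpace ⟶ Y.toLocallyRingedSpace
  continuous : ∀ U : Opens Y.toTopCat,
    @Continuous _ _ (Y.sectionTop U) (X.sectionTop ((Opens.map toLRSHom.base).obj U))
      (toLRSHom.c.app (op U))

instance : Category TopLRS.{u} where
  Hom := Hom
  id X := ⟨𝟙 _, fun U => by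
    let _ := X.sectionTop U
    exact continuous_id⟩
  comp {X Y Z} f g := ⟨f.toLRSHom ≫ g.toLRSHom, fun U => by
    let _ := Z.sectionTop U
    let _ := Y.sectionTop ((Opens.map g.toLRSHom.base).obj U)
    let _ := X.sectionTop ((Opens.map f.toLRSHom.base).obj ((Opens.map g.toLRSHom.base).obj U))
    exact (f.continuous _).comp (g.continuous U)⟩

@[ext]
lemma hom_ext {X Y : TopLRS.{u}} {f g : X ⟶ Y} (h : f.toLRSHom = g.toLRSHom) : f = g :=
  Hom.ext h

@[simp] lemma id_toLRSHom (X : TopLRS.{u}) : (𝟙 X : X ⟶ X).toLRSHom = 𝟙 _ := rfl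

@[simp] lemma comp_toLRSHom {X Y Z : TopLRS.{u}} (f : X ⟶ Y) (g : Y ⟶ Z) :
    (f ≫ g).toLRSHom = f.toLRSHom ≫ g.toLRSHom := rfl

/-- The open subspace of a locally topologically ringed space. -/
def restrict (X : TopLRS.{u}) (U : Opens X.toTopCat) : TopLRS.{u} where
  toLocallyRingedSpace := X.toLocallyRingedSpace.restrict U.isOpenEmbedding
  sectionTop V := X.sectionTop (U.isOpenEmbedding.isOpenMap.functor.obj V)
  isTopologicalRing V := X.isTopologicalRing (U.isOpenEmbedding.isOpenMap.functor.obj V)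
  sectionTop_eq V ι W hW hV := by
    refine X.sectionTop_eq _ (fun i => U.isOpenEmbedding.isOpenMap.functor.obj (W i)) 
      (fun i => (U.isOpenEmbedding.isOpenMap.functor.map (homOfLE (hW i))).le) ?_
    rintro _ ⟨x, hx, rfl⟩
    obtain ⟨i, hi⟩ := Opens.mem_iSup.1 (hV hx)
    exact Opens.mem_iSup.2 ⟨i, ⟨x, hi, rfl⟩⟩

section ofProbes

variable (L : LocallyRingedSpace.{u}) {ι : Type*} (Z : ι → Scheme.{u})
  (g : ∀ i, (Z i).toLocallyRingedSpace ⟶ L)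

/-- Sections over `U` pulled back to an open subset `V` of the `i`-th scheme. -/
def probe (i : ι) (U : Opens L.toTopCat) (V : (Z i).Opens)
    (h : V ≤ (Opens.map (g i).base).obj U) : L.presheaf.obj (op U) →+* Γ(Z i, V) :=
  ((g i).c.app (op U) ≫ (Z i).presheaf.map (homOfLE h).op).hom

/-- The coarsest topology on sections such that pullback to every quasi-compact open subset
of each of the given schemes is continuous, where the target is discrete. -/
abbrev probeTop (U : Opens L.toTopCat) : TopologicalSpace (L.presheaf.obj (op U)) :=
  ⨅ (i : ι) (V : (Z i).Opens) (_ : IsCompact (V : Set (Z i)))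
    (h : V ≤ (Opens.map (g i).base).obj U), TopologicalSpace.induced (probe L Z g i U V h) ⊥

lemma probe_res {i : ι} {U U' : Opens L.toTopCat} (hU : U' ≤ U) {V V' : (Z i).Opens}
    (h : V ≤ (Opens.map (g i).base).obj U) (h' : V' ≤ (Opens.map (g i).base).obj U')
    (hV : V' ≤ V) (s : L.presheaf.obj (op U)) :
    probe L Z g i U' V' h' (L.presheaf.map (homOfLE hU).op s) =
      (Z i).presheaf.map (homOfLE hV).op (probe L Z g i U V h s) := by
  have h1 := (g i).c.naturality (homOfLE hU).op
  have h2 := congr(($h1 ≫ (Z i).presheaf.map (homOfLE h').op).hom s)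
  refine h2.trans ?_
  have h3 : ((Z i).presheaf.map ((Opens.map (g i).base).map (homOfLE hU)).op ≫
      (Z i).presheaf.map (homOfLE h').op) = 
      (Z i).presheaf.map (homOfLE h).op ≫ (Z i).presheaf.map (homOfLE hV).op := by
    rw [← Functor.map_comp, ← Functor.map_comp]; rfl
  exact congr(($h3).hom ((g i).c.app (op U) s))

lemma isOpen_probe_fiber (i : ι) (U : Opens L.toTopCat) (V : (Z i).Opens)
    (hc : IsCompact (V : Set (Z i))) (h : V ≤ (Opens.map (g i).base).obj U)
    (A : Set Γ(Z i, V)) : @IsOpen _ (probeTop L Z g U) (probe L Z g i U V h ⁻¹' A) := by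
  have : probeTop L Z g U ≤ TopologicalSpace.induced (probe L Z g i U V h) ⊥ :=
    iInf_le_of_le i (iInf_le_of_le V (iInf_le_of_le hc (iInf_le _ h)))
  exact this _ ⟨A, trivial, rfl⟩

lemma probeTop_eq (U : Opens L.toTopCat) {κ : Type u} (V : κ → Opens L.toTopCat)
    (hV : ∀ i, V i ≤ U) (hU : U ≤ ⨆ i, V i) :
    probeTop L Z g U =
      ⨅ i, (probeTop L Z g (V i)).induced (L.presheaf.map (homOfLE (hV i)).op) := by
  apply le_antisymm
  · refine le_iInf fun k => ?_
    simp only [probeTop, induced_iInf, induced_compose]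
    refine le_iInf fun i => le_iInf fun W => le_iInf fun hc => le_iInf fun h => ?_
    have h' : W ≤ (Opens.map (g i).base).obj U := fun x hx => hV k (h hx)
    refine iInf_le_of_le i (iInf_le_of_le W (iInf_le_of_le hc (iInf_le_of_le h' (le_of_eq ?_))))
    congr 1
    funext s
    have := probe_res L Z g (hV k) h' h le_rfl s
    refine Eq.trans ?_ this.symm
    change _ = (Z i).presheaf.map (𝟙 _) _
    simp
  · refine le_iInf fun i => le_iInf fun W => le_iInf fun hc => le_iInf fun h => ?_
    rintro _ ⟨A, -, rfl⟩
    rw [@isOpen_iff_forall_mem_open]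
    intro s hs
    have key : ∀ x : W, ∃ (k : κ) (O : (Z i).Opens), x.1 ∈ O ∧ O ≤ W ∧
        IsCompact (O : Set (Z i)) ∧ O ≤ (Opens.map (g i).base).obj (V k) := by
      intro x
      obtain ⟨k, hk⟩ := Opens.mem_iSup.1 (hU (h x.2))
      obtain ⟨O, hO, hxO, hOW⟩ := Opens.isBasis_iff_nbhd.1 (Z i).isBasis_affineOpens
        (show x.1 ∈ W ⊓ (Opens.map (g i).base).obj (V k) from ⟨x.2, hk⟩)
      exact ⟨k, O, hxO, hOW.trans inf_le_left, IsAffineOpen.isCompact hO,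
        hOW.trans inf_le_right⟩
    choose k O hxO hOW hOc hOV using key
    obtain ⟨t, ht⟩ := hc.elim_finite_subcover (fun x : W => (O x : Set (Z i)))
      (fun x => (O x).isOpen) (fun x hx => Set.mem_iUnion.2 ⟨⟨x, hx⟩, hxO ⟨x, hx⟩⟩)
    have hOU : ∀ x, O x ≤ (Opens.map (g i).base).obj U := fun x => (hOW x).trans h
    refine ⟨⋂ x ∈ t, {s' | probe L Z g i U (O x) (hOU x) s' = probe L Z g i U (O x) (hOU x) s},
      ?_, ?_, ?_⟩
    · intro s' hs'
      have : probe L Z g i U W h s' = probe L Z g i U W h s := by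
        refine (Z i).sheaf.eq_of_locally_eq' (fun x : t => O x.1) W
          (fun x => homOfLE (hOW x.1)) ?_ _ _ ?_
        · intro x hx
          obtain ⟨y, hy, hxy⟩ := Set.mem_iUnion₂.1 (ht hx)
          exact Opens.mem_iSup.2 ⟨⟨y, hy⟩, hxy⟩
        · intro x
          have h1 := Set.mem_iInter₂.1 hs' x.1 x.2
          have h2 := probe_res L Z g le_rfl h (hOU x.1) (hOW x.1)
          have h3 : ∀ s, L.presheaf.map (homOfLE (le_refl U)).op s = s := fun s => by
            change L.presheaf.map (𝟙 _) s = s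
            simp
          rw [Set.mem_ofPred_eq, ← h3 s', ← h3 s, h2, h2] at h1
          exact h1
      exact Set.mem_preimage.2 (this ▸ hs)
    · refine @Set.Finite.isOpen_biInter _ _ (_) _ _ t.finite_toSet fun x _ => ?_
      have hle : (⨅ i, (probeTop L Z g (V i)).induced (L.presheaf.map (homOfLE (hV i)).op)) ≤
        (probeTop L Z g (V (k x))).induced (L.presheaf.map (homOfLE (hV (k x))).op) :=
        iInf_le _ (k x)
      refine hle _ ⟨probe L Z g i (V (k x)) (O x) (hOV x) ⁻¹' {probe L Z g i U (O x) (hOU x) s},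
        isOpen_probe_fiber L Z g i (V (k x)) (O x) (hOc x) (hOV x) _, ?_⟩
      ext s'
      have := probe_res L Z g (hV (k x)) (hOU x) (hOV x) le_rfl s'
      simp only [Set.mem_preimage, Set.mem_singleton_iff, Set.mem_ofPred_eq]
      rw [this]
      change (Z i).presheaf.map (𝟙 _) _ = _ ↔ _
      simp
    · exact Set.mem_iInter₂.2 fun x _ => rfl

lemma isTopologicalRing_iInf {R : Type*} [CommRing R] {κ : Sort*} {t : κ → TopologicalSpace R}
    (h : ∀ i, @IsTopologicalRing R (t i) _) : @IsTopologicalRing R (⨅ i, t i) _ := by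
  let _ : TopologicalSpace R := ⨅ i, t i
  have h1 : ContinuousAdd R :=
    continuousAdd_iInf fun i => (h i).toIsTopologicalSemiring.toContinuousAdd
  have h2 : ContinuousMul R :=
    continuousMul_iInf fun i => (h i).toIsTopologicalSemiring.toContinuousMul
  have h3 : ContinuousNeg R := continuousNeg_iInf fun i => (h i).toContinuousNeg
  exact {}

lemma isTopologicalRing_induced {R S : Type*} [CommRing R] [CommRing S] [t : TopologicalSpace S]
    [IsTopologicalRing S] (f : R →+* S) :
    @IsTopologicalRing R (t.induced f) _ := by
  let _ : TopologicalSpace R := t.induced f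
  have h1 : ContinuousAdd R := continuousAdd_induced f
  have h2 : ContinuousMul R := continuousMul_induced f
  have h3 : ContinuousNeg R := (topologicalAddGroup_induced f).toContinuousNeg
  exact {}

lemma isTopologicalRing_probeTop (U : Opens L.toTopCat) :
    @IsTopologicalRing _ (probeTop L Z g U) _ := by
  refine isTopologicalRing_iInf fun i => isTopologicalRing_iInf fun V =>
    isTopologicalRing_iInf fun hc => isTopologicalRing_iInf fun h => ?_
  let _ : TopologicalSpace Γ(Z i, V) := ⊥
  have : DiscreteTopology Γ(Z i, V) := ⟨rfl⟩
  exact isTopologicalRing_induced (probe L Z g i U V h)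

/-- A locally ringed space together with a family of morphisms from schemes, topologized by
`probeTop`. -/
def ofProbes : TopLRS.{u} where
  toLocallyRingedSpace := L
  sectionTop := probeTop L Z g
  isTopologicalRing := isTopologicalRing_probeTop L Z g
  sectionTop_eq U _ V hV hU := probeTop_eq L Z g U V hV hU

lemma continuous_ofProbes {R : Type*} [t : TopologicalSpace R] (U : Opens L.toTopCat)
    (f : R → L.presheaf.obj (op U))
    (h : ∀ (i : ι) (V : (Z i).Opens) (_ : IsCompact (V : Set (Z i)))
      (h : V ≤ (Opens.map (g i).base).obj U),
      @Continuous _ _ t ⊥ (fun r => probe L Z g i U V h (f r))) :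
    @Continuous _ _ t (probeTop L Z g U) f :=
  continuous_iInf_rng.2 fun i => continuous_iInf_rng.2 fun V => continuous_iInf_rng.2 fun hc =>
    continuous_iInf_rng.2 fun h' => continuous_induced_rng.2 (h i V hc h')

end ofProbes

/-- Every open set is covered by open sets on which the ring of sections is discrete. -/
def IsPseudoDiscrete (X : TopLRS.{u}) : Prop :=
  ∀ (U : Opens X.toTopCat), ∀ x ∈ U, ∃ V ≤ U, x ∈ V ∧ X.sectionTop V = ⊥

lemma continuous_res (X : TopLRS.{u}) {U V : Opens X.toTopCat} (h : V ≤ U) :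
    @Continuous _ _ (X.sectionTop U) (X.sectionTop V) (X.presheaf.map (homOfLE h).op) := by
  rw [continuous_iff_le_induced]
  rw [X.sectionTop_eq U (ι := ULift Bool) (fun b => cond b.down V U)
    (by rintro ⟨⟨⟩⟩ <;> simp [h]) (le_iSup_of_le ⟨false⟩ le_rfl)]
  exact iInf_le_of_le ⟨true⟩ le_rfl

lemma IsPseudoDiscrete.continuous {X Y : TopLRS.{u}} (hY : Y.IsPseudoDiscrete)
    (f : X.toLocallyRingedSpace ⟶ Y.toLocallyRingedSpace) (U : Opens Y.toTopCat) :
    @Continuous _ _ (Y.sectionTop U) (X.sectionTop ((Opens.map f.base).obj U))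
      (f.c.app (op U)) := by
  choose V hVU hxV hV using fun x : U => hY U x.1 x.2
  rw [X.sectionTop_eq ((Opens.map f.base).obj U) (fun x : U => (Opens.map f.base).obj (V x))
    (fun x y hy => hVU x hy) (fun y hy => Opens.mem_iSup.2 ⟨⟨f.base y, hy⟩, hxV _⟩)]
  refine continuous_iInf_rng.2 fun x => continuous_induced_rng.2 ?_
  have h1 := f.c.naturality (homOfLE (hVU x)).op
  have h2 : (X.presheaf.map (homOfLE (fun y hy => hVU x hy :
      (Opens.map f.base).obj (V x) ≤ (Opens.map f.base).obj U)).op) ∘ (f.c.app (op U)) =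
      (f.c.app (op (V x))) ∘ (Y.presheaf.map (homOfLE (hVU x)).op) := by
    funext s
    exact congr(($h1).hom s).symm
  rw [h2]
  refine @Continuous.comp _ _ _ (Y.sectionTop U) (Y.sectionTop (V x)) (X.sectionTop _) _ _ ?_
    (Y.continuous_res (hVU x))
  rw [hV x]
  exact continuous_bot

/-- A morphism of locally ringed spaces to a pseudo-discrete space is automatically continuous. -/
def homMk {X Y : TopLRS.{u}} (hY : Y.IsPseudoDiscrete)
    (f : X.toLocallyRingedSpace ⟶ Y.toLocallyRingedSpace) : X ⟶ Y :=
  ⟨f, hY.continuous f⟩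

/-- A scheme as a locally topologically ringed space: the sections over quasi-compact open
subsets are discrete. -/
def ofScheme (X : Scheme.{u}) : TopLRS.{u} :=
  ofProbes X.toLocallyRingedSpace (fun _ : PUnit.{1} => X) (fun _ => 𝟙 _)

lemma isPseudoDiscrete_ofScheme (X : Scheme.{u}) : (ofScheme X).IsPseudoDiscrete := by
  intro U x hx
  obtain ⟨O, hO, hxO, hOW⟩ := Opens.isBasis_iff_nbhd.1 X.isBasis_affineOpens hx
  refine ⟨O, hOW, hxO, eq_bot_iff.2 ?_⟩
  refine (show probeTop X.toLocallyRingedSpace (fun _ : PUnit.{1} => X) (fun _ => 𝟙 _) O ≤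
    TopologicalSpace.induced (probe X.toLocallyRingedSpace (fun _ : PUnit.{1} => X)
      (fun _ => 𝟙 _) ⟨⟩ O O le_rfl) ⊥ from iInf_le_of_le ⟨⟩ (iInf_le_of_le O
      (iInf_le_of_le (IsAffineOpen.isCompact hO) (iInf_le _ le_rfl)))).trans ?_
  intro A _
  refine ⟨A, trivial, ?_⟩
  ext s
  change X.presheaf.map (𝟙 _) s ∈ A ↔ _
  simp

/-- Schemes as locally topologically ringed spaces, functorially. -/
@[simps obj]
def schemeFunctor : Scheme.{u} ⥤ TopLRS.{u} where
  obj := ofScheme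
  map f := homMk (isPseudoDiscrete_ofScheme _) f.toLRSHom

/-- `schemeFunctor` is fully faithful. -/
def schemeFunctorFullyFaithful : schemeFunctor.{u}.FullyFaithful where
  preimage f := ⟨f.toLRSHom⟩

/-- The inductive limit of a sequence of schemes: the colimit as locally ringed space, where the
ring of sections over each open set has the inverse limit topology. If all the transition maps are
nilpotent thickenings, then all the schemes have the same underlying space, and the colimit is this
space with the structure sheaf `lim 𝒪_{Z n}`. -/
def indScheme (Z : ℕ ⥤ Scheme.{u}) : TopLRS.{u} :=
  ofProbes (colimit (Z ⋙ Scheme.forgetToLocallyRingedSpace)) Z.obj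
    (colimit.ι (Z ⋙ Scheme.forgetToLocallyRingedSpace))

section PowerSeries

open MvPowerSeries

variable (d : ℕ)

/-- The presheaf `U ↦ 𝒪(U)[[t₁, …, t_d]]`. -/
def psPresheaf (L : LocallyRingedSpace.{u}) : TopCat.Presheaf CommRingCat.{u} L.toTopCat where
  obj U := CommRingCat.of (MvPowerSeries (Fin d) (L.presheaf.obj U))
  map f := CommRingCat.ofHom (MvPowerSeries.map (L.presheaf.map f).hom)
  map_id U := by ext; simp
  map_comp f g := by ext; simp

lemma psPresheaf_isSheaf (L : LocallyRingedSpace.{u}) : (psPresheaf d L).IsSheaf := by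
  rw [TopCat.Presheaf.isSheaf_iff_isSheafUniqueGluing]
  intro ι U sf hsf
  have key : ∀ n : Fin d →₀ ℕ, ∃! s : L.presheaf.obj (op (iSup U)),
      TopCat.Presheaf.IsGluing L.presheaf U (fun i => coeff n (sf i)) s := by
    intro n
    refine L.IsSheaf.isSheafUniqueGluing U _ fun i j => ?_
    exact congr(coeff n $(hsf i j))
  choose s hs hu using key
  refine ⟨fun n => s n, fun i => ?_, fun s' hs' => ?_⟩
  · apply MvPowerSeries.ext
    intro n
    exact hs n i
  · apply MvPowerSeries.ext
    intro n
    refine hu n _ fun i => ?_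
    exact congr(coeff n $(hs' i))

/-- The constant term, as a morphism of presheaves. -/
def psConst (L : LocallyRingedSpace.{u}) : psPresheaf d L ⟶ L.presheaf where
  app U := CommRingCat.ofHom (constantCoeff (σ := Fin d) (R := L.presheaf.obj U))
  naturality U V f := by
    ext s
    exact constantCoeff_map (L.presheaf.map f).hom s

lemma isUnit_germ_psPresheaf_iff (L : LocallyRingedSpace.{u}) (U : Opens L.toTopCat) (x : L)
    (hx : x ∈ U) (s : MvPowerSeries (Fin d) (L.presheaf.obj (op U))) :
    IsUnit ((psPresheaf d L).germ U x hx s) ↔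
      IsUnit (L.presheaf.germ U x hx (constantCoeff s)) := by
  constructor
  · intro h
    have h1 : ((TopCat.Presheaf.stalkFunctor CommRingCat x).map (psConst d L)).hom
        ((psPresheaf d L).germ U x hx s) = L.presheaf.germ U x hx (constantCoeff s) :=
      TopCat.Presheaf.stalkFunctor_map_germ_apply' U x hx (psConst d L) s
    rw [← h1]
    exact h.map _
  · intro h
    obtain ⟨V, i, hxV, hV⟩ := L.toRingedSpace.isUnit_res_of_isUnit_germ U _ x hx h
    have h2 : IsUnit ((psPresheaf d L).map i.op s) := by
      refine MvPowerSeries.isUnit_iff_constantCoeff.2 ?_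
      change IsUnit (constantCoeff (MvPowerSeries.map (L.presheaf.map i.op).hom s))
      rw [constantCoeff_map]
      exact hV
    rw [← TopCat.Presheaf.germ_res_apply (psPresheaf d L) i x hxV s]
    exact h2.map ((psPresheaf d L).germ V x hxV).hom

/-- The locally ringed space with structure sheaf `U ↦ 𝒪(U)[[t₁, …, t_d]]`. -/
def psLRS (L : LocallyRingedSpace.{u}) : LocallyRingedSpace.{u} where
  carrier := L.toTopCat
  presheaf := psPresheaf d L
  IsSheaf := psPresheaf_isSheaf d L
  isLocalRing x := by
    have : IsLocalHom ((TopCat.Presheaf.stalkFunctor CommRingCat x).map (psConst d L)).hom := by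
      refine ⟨fun a ha => ?_⟩
      obtain ⟨U, hx, s, rfl⟩ := (psPresheaf d L).exists_germ_eq a
      refine (isUnit_germ_psPresheaf_iff d L U x hx s).2 ?_
      have h1 : ((TopCat.Presheaf.stalkFunctor CommRingCat x).map (psConst d L)).hom
          ((psPresheaf d L).germ U x hx s) = L.presheaf.germ U x hx
            (constantCoeff (σ := Fin d) (R := L.presheaf.obj (op U)) s) :=
        TopCat.Presheaf.stalkFunctor_map_germ_apply' U x hx (psConst d L) s
      rwa [h1] at ha
    have h2 : IsLocalRing ((TopCat.Presheaf.stalkFunctor CommRingCat x).obj L.presheaf) :=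
      L.isLocalRing x
    exact @RingHom.domain_isLocalRing _ _ _ _ h2
      ((TopCat.Presheaf.stalkFunctor CommRingCat x).map (psConst d L)).hom this

open scoped MvPowerSeries.WithPiTopology in
/-- The space `Y[[t₁, …, t_d]]`: the underlying space is that of `Y`, the structure sheaf is
`U ↦ 𝒪_Y(U)[[t₁, …, t_d]]`, with the topology of coefficientwise convergence. If `Y` is a finite
adic formal scheme with ideal of definition `I`, then this is the completion of `Y × 𝔸ᵈ` at
`I + (t₁, …, t_d)`: both are given by `Spc S[[t₁, …, t_d]]` on an affine open subset `Spc S`, and the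
coefficientwise topology on `S[[t₁, …, t_d]]` is the `I + (t₁, …, t_d)`-adic one, since `I` is
finitely generated. -/
def powerSeries (Y : TopLRS.{u}) : TopLRS.{u} where
  toLocallyRingedSpace := psLRS d Y.toLocallyRingedSpace
  sectionTop U :=
    let _ := Y.sectionTop U
    inferInstanceAs (TopologicalSpace (MvPowerSeries (Fin d) (Y.presheaf.obj (op U))))
  isTopologicalRing U :=
    let _ := Y.sectionTop U
    let _ := Y.isTopologicalRing U
    inferInstanceAs (IsTopologicalRing (MvPowerSeries (Fin d) (Y.presheaf.obj (op U))))
  sectionTop_eq U ι V hV hU := by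
    change (⨅ n : Fin d →₀ ℕ, (Y.sectionTop U).induced (fun s => s n)) =
      ⨅ i, (⨅ n : Fin d →₀ ℕ, (Y.sectionTop (V i)).induced (fun s => s n)).induced
       (MvPowerSeries.map (Y.presheaf.map (homOfLE (hV i)).op).hom)
    rw [Y.sectionTop_eq U V hV hU]
    simp only [induced_iInf]
    rw [iInf_comm (ι := ι)]
    refine iInf_congr fun n => (induced_iInf ..).trans (iInf_congr fun i => ?_)
    exact induced_compose.trans (Eq.symm induced_compose)

open scoped MvPowerSeries.WithPiTopology in
lemma continuous_psMap {R S : Type*} [CommRing R] [CommRing S] [TopologicalSpace R]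
    [TopologicalSpace S] (f : R →+* S) (hf : Continuous f) :
    Continuous (MvPowerSeries.map (σ := Fin d) f) :=
  continuous_iInf_rng.2 fun n => continuous_induced_rng.2
    (hf.comp (MvPowerSeries.WithPiTopology.continuous_coeff R n))

lemma isLocalHom_stalkMap_of_germ {X Y : PresheafedSpace CommRingCat.{u}} (F : X ⟶ Y) (x : X)
    (h : ∀ (U : Opens Y) (hx : F.base x ∈ U) (s : Y.presheaf.obj (op U)),
      IsUnit (X.presheaf.germ ((Opens.map F.base).obj U) x hx (F.c.app (op U) s)) →
      IsUnit (Y.presheaf.germ U (F.base x) hx s)) :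
    IsLocalHom (F.stalkMap x).hom := by
  refine ⟨fun a ha => ?_⟩
  obtain ⟨U, hx, s, rfl⟩ := Y.presheaf.exists_germ_eq a
  refine h U hx s ?_
  rw [← PresheafedSpace.stalkMap_germ_apply F U x hx s]
  exact ha

lemma isUnit_germ_of_isUnit_germ_app {L M : LocallyRingedSpace.{u}} (f : L ⟶ M) (x : L)
    (U : Opens M.toTopCat) (hx : f.base x ∈ U) (s : M.presheaf.obj (op U))
    (h : IsUnit (L.presheaf.germ ((Opens.map f.base).obj U) x hx (f.c.app (op U) s))) :
    IsUnit (M.presheaf.germ U (f.base x) hx s) := by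
  rw [← LocallyRingedSpace.stalkMap_germ_apply f U x hx s] at h
  exact (f.prop x).map_nonunit _ h

/-- The projection `p_Y : Y[[t₁, …, t_d]] ⟶ Y`. -/
def psProj (Y : TopLRS.{u}) : powerSeries d Y ⟶ Y where
  toLRSHom :=
    { base := 𝟙 Y.toTopCat
      c :=
        { app := fun U => CommRingCat.ofHom (C (σ := Fin d) (R := Y.presheaf.obj U))
          naturality := fun U V f => by
            ext s
            exact (MvPowerSeries.map_C (Y.presheaf.map f).hom s).symm }
      prop := fun x => isLocalHom_stalkMap_of_germ _ x fun U hx s h => by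
        have h' := (isUnit_germ_psPresheaf_iff d Y.toLocallyRingedSpace U x hx
          (C (σ := Fin d) (R := Y.presheaf.obj (op U)) s)).1 h
        rwa [constantCoeff_C] at h' }
  continuous U := by
    let _ := Y.sectionTop U
    exact MvPowerSeries.WithPiTopology.continuous_C

/-- The zero section `i_Y : Y ⟶ Y[[t₁, …, t_d]]`. -/
def psZero (Y : TopLRS.{u}) : Y ⟶ powerSeries d Y where
  toLRSHom :=
    { base := 𝟙 Y.toTopCat
      c := psConst d Y.toLocallyRingedSpace
      prop := fun x => isLocalHom_stalkMap_of_germ _ x fun U hx s h =>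
        (isUnit_germ_psPresheaf_iff d Y.toLocallyRingedSpace U x hx s).2 h }
  continuous U := by
    let _ := Y.sectionTop U
    exact MvPowerSeries.WithPiTopology.continuous_constantCoeff (Y.presheaf.obj (op U))

/-- The morphism `X[[t₁, …, t_d]] ⟶ Y[[t₁, …, t_d]]` induced by `f : X ⟶ Y`: apply `f` to the
coefficients. -/
def psMap {X Y : TopLRS.{u}} (f : X ⟶ Y) : powerSeries d X ⟶ powerSeries d Y where
  toLRSHom :=
    { base := f.toLRSHom.base
      c :=
        { app := fun U => CommRingCat.ofHom
            (MvPowerSeries.map (σ := Fin d) (f.toLRSHom.c.app U).hom)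
          naturality := fun U V g => by
            ext s
            refine MvPowerSeries.ext fun n => ?_
            exact congr(($(f.toLRSHom.c.naturality g)).hom (coeff n s)) }
      prop := fun x => isLocalHom_stalkMap_of_germ _ x fun U hx s h => by
        have h' := (isUnit_germ_psPresheaf_iff d X.toLocallyRingedSpace _ x hx
          (MvPowerSeries.map (σ := Fin d) (f.toLRSHom.c.app (op U)).hom s)).1 h
        have h' := (congrArg (fun r => IsUnit (X.presheaf.germ _ x hx r))
          (constantCoeff_map (f.toLRSHom.c.app (op U)).hom s)).mp h'
        exact (isUnit_germ_psPresheaf_iff d Y.toLocallyRingedSpace U _ hx s).2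
          (isUnit_germ_of_isUnit_germ_app f.toLRSHom x U hx _ h') }
  continuous U := by
    let _ := Y.sectionTop U
    let _ := X.sectionTop ((Opens.map f.toLRSHom.base).obj U)
    exact continuous_psMap d (R := Y.presheaf.obj (op U))
      (S := X.presheaf.obj (op ((Opens.map f.toLRSHom.base).obj U)))
      (f.toLRSHom.c.app (op U)).hom (f.continuous U)

lemma lrs_hom_ext {X Y : LocallyRingedSpace.{u}} (b : X.toTopCat ⟶ Y.toTopCat)
    {c c' : Y.presheaf ⟶ b _* X.presheaf} (h h') (hc : ∀ U s, c.app U s = c'.app U s) :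
    (⟨⟨b, c⟩, h⟩ : LocallyRingedSpace.Hom X Y) = ⟨⟨b, c'⟩, h'⟩ := by
  have : c = c' := by
    ext U s
    exact hc (op U) s
  subst this
  rfl

/-- The functor `Y ↦ Y[[t₁, …, t_d]]`. -/
@[simps]
def powerSeriesFunctor : TopLRS.{u} ⥤ TopLRS.{u} where
  obj := powerSeries d
  map := psMap d
  map_id _ := hom_ext <| lrs_hom_ext _ _ _ fun _ _ => MvPowerSeries.ext fun _ => rfl
  map_comp _ _ := hom_ext <| lrs_hom_ext _ _ _ fun _ _ => MvPowerSeries.ext fun _ => rfl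

/-- The projections `p_Y` are natural in `Y`. -/
lemma psMap_psProj {X Y : TopLRS.{u}} (f : X ⟶ Y) :
    psMap d f ≫ psProj d Y = psProj d X ≫ f :=
  hom_ext <| lrs_hom_ext _ _ _ fun U s => by
    exact MvPowerSeries.map_C (f.toLRSHom.c.app U).hom s

lemma psZero_psProj (Y : TopLRS.{u}) : psZero d Y ≫ psProj d Y = 𝟙 Y :=
  hom_ext <| lrs_hom_ext _ _ _ fun U s =>
    constantCoeff_C (σ := Fin d) (R := Y.presheaf.obj U) s

end PowerSeries


/-! ### Formal completions and finite adic formal schemes -/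

/-- The infinitesimal neighbourhoods of the closed subscheme of `X` defined by `I`: the `n`-th one
is the closed subscheme defined by `I ^ (n + 1)`. -/
@[simps]
def infinitesimalNeighbourhoods (X : Scheme.{u}) (I : X.IdealSheafData) : ℕ ⥤ Scheme.{u} where
  obj n := (I ^ (n + 1)).subscheme
  map {m n} h := Scheme.IdealSheafData.inclusion
    (show I ^ (n + 1) ≤ I ^ (m + 1) from
      fun _ => Ideal.pow_le_pow_right (Nat.succ_le_succ (leOfHom h)))
  map_id _ := Scheme.IdealSheafData.inclusion_id _
  map_comp _ _ := (Scheme.IdealSheafData.inclusion_comp _ _).symm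

/-- The completion of a scheme `X` along the closed subscheme defined by `I`: the underlying space
is that of the closed subscheme, the structure sheaf is `lim 𝒪_X / I ^ n`, with the inverse limit
topology. -/
def completion (X : Scheme.{u}) (I : X.IdealSheafData) : TopLRS.{u} :=
  indScheme (infinitesimalNeighbourhoods X I)

/-- The canonical morphism from the completion of `X` along a closed subscheme to `X`. -/
def completionι (X : Scheme.{u}) (I : X.IdealSheafData) : completion X I ⟶ ofScheme X :=
  homMk (isPseudoDiscrete_ofScheme X) <|
    colimit.desc (infinitesimalNeighbourhoods X I ⋙ Scheme.forgetToLocallyRingedSpace)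
      { pt := X.toLocallyRingedSpace
        ι :=
          { app := fun n => (I ^ (n + 1)).subschemeι.toLRSHom
            naturality := fun m n h => by
              have := congr(Scheme.Hom.toLRSHom
                $(Scheme.IdealSheafData.inclusion_subschemeι (show I ^ (n + 1) ≤ I ^ (m + 1) from
                  fun _ => Ideal.pow_le_pow_right (Nat.succ_le_succ (leOfHom h)))))
              exact this } }

/-- The schemes `Spec (T / I ^ (n + 1))`. -/
@[simps]
def specQuotients (T : Type u) [CommRing T] (I : Ideal T) : ℕ ⥤ Scheme.{u} where
  obj n := Spec (.of (T ⧸ I ^ (n + 1)))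
  map {m n} h := Spec.map (CommRingCat.ofHom
    (Ideal.Quotient.factor (Ideal.pow_le_pow_right (Nat.succ_le_succ (leOfHom h)))))
  map_id n := by
    rw [Ideal.Quotient.factor_eq]
    exact Spec.map_id _
  map_comp f g := by
    rw [← Ideal.Quotient.factor_comp (Ideal.pow_le_pow_right (I := I)
      (Nat.succ_le_succ (leOfHom g))) (Ideal.pow_le_pow_right (I := I)
      (Nat.succ_le_succ (leOfHom f))), CommRingCat.ofHom_comp, Spec.map_comp]

/-- The affine formal scheme `Spc T` of a ring `T` with the `I`-adic topology: the underlying space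
is `Spec (T / I)`, the structure sheaf is `lim (T / I ^ n)~`. -/
def Spc (T : Type u) [CommRing T] (I : Ideal T) : TopLRS.{u} :=
  indScheme (specQuotients T I)

/-- A finite adic formal scheme: locally `Spc T` for a finite adic ring `T`, i.e. a ring that is
separated and complete for the topology defined by a finitely generated ideal. -/
def IsFiniteAdic (Y : TopLRS.{u}) : Prop :=
  ∀ y : Y.toTopCat, ∃ (U : Opens Y.toTopCat) (_ : y ∈ U) (T : Type u) (_ : CommRing T)
    (I : Ideal T), I.FG ∧ IsAdicComplete I T ∧ Nonempty (Spc T I ≅ Y.restrict U)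

/-- The canonical morphisms to an inductive limit of schemes. -/
def indSchemeι (Z : ℕ ⥤ Scheme.{u}) (n : ℕ) : ofScheme (Z.obj n) ⟶ indScheme Z where
  toLRSHom := colimit.ι (Z ⋙ Scheme.forgetToLocallyRingedSpace) n
  continuous U := by
    refine continuous_ofProbes (Z.obj n).toLocallyRingedSpace (fun _ : PUnit.{1} => Z.obj n)
      (fun _ => 𝟙 _) (t := (indScheme Z).sectionTop U) _ _ fun _ V hc h => ?_
    refine continuous_iff_le_induced.2 ?_
    exact iInf_le_of_le n (iInf_le_of_le V (iInf_le_of_le hc (iInf_le_of_le h le_rfl)))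

/-- The closed immersion `Spec (T / I ^ (n + 1)) ⟶ Spec T`. -/
def specQuotientsι (T : Type u) [CommRing T] (I : Ideal T) (n : ℕ) :
    (specQuotients T I).obj n ⟶ Spec (.of T) :=
  Spec.map (CommRingCat.ofHom (Ideal.Quotient.mk (I ^ (n + 1))))

instance (T : Type u) [CommRing T] (I : Ideal T) (n : ℕ) : Mono (specQuotientsι T I n) := by
  have := IsClosedImmersion.spec_of_surjective
    (CommRingCat.ofHom (Ideal.Quotient.mk (I ^ (n + 1)))) Ideal.Quotient.mk_surjective
  exact (inferInstance :
    Mono (Spec.map (CommRingCat.ofHom (Ideal.Quotient.mk (I ^ (n + 1))))))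

lemma specQuotients_map_ι (T : Type u) [CommRing T] (I : Ideal T) {m n : ℕ} (h : m ⟶ n) :
    (specQuotients T I).map h ≫ specQuotientsι T I n = specQuotientsι T I m :=
  (Spec.map_comp _ _).symm

/-- The canonical morphism `Spc T ⟶ Spec T`. -/
def spcDesc (T : Type u) [CommRing T] (I : Ideal T) :
    colimit (specQuotients T I ⋙ Scheme.forgetToLocallyRingedSpace) ⟶
      Scheme.forgetToLocallyRingedSpace.obj (Spec (.of T)) :=
  colimit.desc (specQuotients T I ⋙ Scheme.forgetToLocallyRingedSpace)
    (Scheme.forgetToLocallyRingedSpace.mapCocone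
      { pt := Spec (.of T)
        ι :=
          { app := specQuotientsι T I
            naturality := fun _ _ h =>
              (specQuotients_map_ι T I h).trans (Category.comp_id _).symm } })

lemma ι_spcDesc (T : Type u) [CommRing T] (I : Ideal T) (n : ℕ) :
    colimit.ι (specQuotients T I ⋙ Scheme.forgetToLocallyRingedSpace) n ≫ spcDesc T I =
      Scheme.forgetToLocallyRingedSpace.map (specQuotientsι T I n) :=
  colimit.ι_desc _ _

/-- The isomorphism `Spec T ⟶ Spec (T / 0)`. -/
def specBotMap (T : Type u) [CommRing T] : Spec (.of T) ⟶ (specQuotients T ⊥).obj 0 :=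
  Spec.map (CommRingCat.ofHom
    (Ideal.Quotient.lift ((⊥ : Ideal T) ^ (0 + 1)) (RingHom.id T) (by simp)))

lemma specBotMap_comp (T : Type u) [CommRing T] :
    specBotMap T ≫ specQuotientsι T ⊥ 0 = 𝟙 _ :=
  (Spec.map_comp _ _).symm.trans (Spec.map_id _)

lemma comp_specBotMap (T : Type u) [CommRing T] (n : ℕ) :
    specQuotientsι T ⊥ n ≫ specBotMap T ≫ (specQuotients T ⊥).map (homOfLE (Nat.zero_le n)) =
      𝟙 ((specQuotients T ⊥).obj n) := by
  rw [← cancel_mono (specQuotientsι T ⊥ n), Category.assoc, Category.assoc, specQuotients_map_ι,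
    specBotMap_comp, Category.id_comp, Category.comp_id]

/-- The inverse of `spcDesc` for the zero ideal. -/
def spcInv (T : Type u) [CommRing T] :
    Scheme.forgetToLocallyRingedSpace.obj (Spec (.of T)) ⟶
      colimit (specQuotients T ⊥ ⋙ Scheme.forgetToLocallyRingedSpace) :=
  Scheme.forgetToLocallyRingedSpace.map (specBotMap T) ≫
    colimit.ι (specQuotients T ⊥ ⋙ Scheme.forgetToLocallyRingedSpace) 0

lemma spcDesc_spcInv (T : Type u) [CommRing T] : spcDesc T ⊥ ≫ spcInv T = 𝟙 _ := by
  refine colimit.hom_ext fun n => ?_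
  have h0 := colimit.w (specQuotients T ⊥ ⋙ Scheme.forgetToLocallyRingedSpace)
    (homOfLE (Nat.zero_le n))
  have h1 := congrArg (Scheme.forgetToLocallyRingedSpace.map ·) (comp_specBotMap T n)
  simp only [Functor.map_comp, CategoryTheory.Functor.map_id] at h1
  rw [← Category.assoc, ι_spcDesc, spcInv, ← h0, Functor.comp_map, Category.comp_id]
  refine Eq.trans ?_ ((congrArg
    (· ≫ colimit.ι (specQuotients T ⊥ ⋙ Scheme.forgetToLocallyRingedSpace) n) h1).trans
      (Category.id_comp _))
  simp only [Category.assoc]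

lemma spcInv_spcDesc (T : Type u) [CommRing T] : spcInv T ≫ spcDesc T ⊥ = 𝟙 _ := by
  have h1 := congrArg (Scheme.forgetToLocallyRingedSpace.map ·) (specBotMap_comp T)
  simp only [Functor.map_comp, CategoryTheory.Functor.map_id] at h1
  rw [spcInv, Category.assoc, ι_spcDesc, h1]

/-- If the ideal is zero then `Spc T` is the scheme `Spec T`. -/
def spcBotIso (T : Type u) [CommRing T] : Spc T (⊥ : Ideal T) ≅ ofScheme (Spec (.of T)) where
  hom := homMk (isPseudoDiscrete_ofScheme _) (spcDesc T ⊥)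
  inv := schemeFunctor.map (specBotMap T) ≫ indSchemeι (specQuotients T ⊥) 0
  hom_inv_id := hom_ext (spcDesc_spcInv T)
  inv_hom_id := hom_ext (spcInv_spcDesc T)

lemma isPseudoDiscrete_restrict {X : TopLRS.{u}} (hX : X.IsPseudoDiscrete)
    (U : Opens X.toTopCat) : (X.restrict U).IsPseudoDiscrete := by
  intro V x hx
  obtain ⟨W, hWV, hxW, hW⟩ := hX (U.isOpenEmbedding.isOpenMap.functor.obj V) x.1 ⟨x, hx, rfl⟩
  refine ⟨(Opens.map U.inclusion').obj W, ?_, hxW, ?_⟩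
  · intro y hy
    obtain ⟨z, hz, hzy⟩ := hWV hy
    rwa [← Subtype.ext hzy]
  · have : U.isOpenEmbedding.isOpenMap.functor.obj ((Opens.map U.inclusion').obj W) = W := by
      ext y
      refine ⟨?_, fun hy => ?_⟩
      · rintro ⟨z, hz, rfl⟩
        exact hz
      · obtain ⟨z, hz, rfl⟩ := hWV hy
        exact ⟨z, hy, rfl⟩
    change X.sectionTop _ = ⊥
    rw [this, hW]

/-- The open subscheme of `X` on `U` is the open subspace of `X` on `U`. -/
def restrictIso (X : Scheme.{u}) (U : X.Opens) :
    ofScheme U.toScheme ≅ (ofScheme X).restrict U where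
  hom := homMk (isPseudoDiscrete_restrict (isPseudoDiscrete_ofScheme X) U)
    (𝟙 (X.toLocallyRingedSpace.restrict U.isOpenEmbedding))
  inv := homMk (isPseudoDiscrete_ofScheme U.toScheme)
    (𝟙 (X.toLocallyRingedSpace.restrict U.isOpenEmbedding))
  hom_inv_id := hom_ext (Category.id_comp _)
  inv_hom_id := hom_ext (Category.id_comp _)

lemma isFiniteAdic_ofScheme (X : Scheme.{u}) : (ofScheme X).IsFiniteAdic := by
  intro x
  obtain ⟨U, hU, hxU, -⟩ := Opens.isBasis_iff_nbhd.1 X.isBasis_affineOpens (Opens.mem_top x)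
  let U' : X.Opens := U
  have : IsAffine U'.toScheme := hU
  refine ⟨U, hxU, Γ(U'.toScheme, ⊤), inferInstance, ⊥, Submodule.fg_bot, inferInstance, ⟨?_⟩⟩
  exact spcBotIso _ ≪≫ schemeFunctor.mapIso (U'.toScheme.isoSpec).symm ≪≫ restrictIso X U'

end TopLRS

/-! ### Formal schemes over a field, and local coordinate systems -/

open TopLRS

variable (k : Type u) [Field k]

/-- The category of finite adic formal schemes over `k`. -/
abbrev FSch : Type (u + 1) :=
  ObjectProperty.FullSubcategory
    (fun Y : Over (ofScheme (Spec (.of k))) => Y.left.IsFiniteAdic)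

variable {k}

/-- A `k`-scheme as a locally topologically ringed space over `k`. -/
abbrev schemeOver : Over (Spec (.of k)) ⥤ Over (ofScheme (Spec (.of k))) :=
  Over.post schemeFunctor

/-- The embedding of the category of `k`-schemes in the category of finite adic formal schemes
over `k`. -/
def schToFSch : Over (Spec (.of k)) ⥤ FSch k :=
  ObjectProperty.lift _ schemeOver fun Y => isFiniteAdic_ofScheme Y.left

/-- The functor `Y ↦ Y[[t₁, …, t_d]]` over `k`. -/
def powerSeriesOver (d : ℕ) :
    Over (ofScheme (Spec (.of k))) ⥤ Over (ofScheme (Spec (.of k))) where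
  obj Y := Over.mk (psProj d Y.left ≫ Y.hom)
  map f := Over.homMk (psMap d f.left) (by
    simp only [Over.mk_hom]
    rw [← Category.assoc, psMap_psProj, Category.assoc, Over.w])
  map_id Y := by ext : 1; exact (powerSeriesFunctor d).map_id Y.left
  map_comp f g := by ext : 1; exact (powerSeriesFunctor d).map_comp f.left g.left

/-- The functor `Y ↦ Hom_k(Y[[t₁, …, t_d]], X)` on finite adic formal schemes over `k`. The object
representing it is the value at `X` of the right adjoint of `Y ↦ Y[[t₁, …, t_d]]`. (Morphisms of
formal schemes are by definition morphisms of locally topologically ringed spaces.) -/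
def Phi (d : ℕ) (X : Over (Spec (.of k))) : (FSch k)ᵒᵖ ⥤ Type u :=
  (ObjectProperty.ι _ ⋙ powerSeriesOver d).op ⋙ yoneda.obj (schemeOver.obj X)

section
variable {d : ℕ} {X Y : Over (Spec (.of k))}
  (φ : (powerSeriesOver d).obj (schemeOver.obj Y) ⟶ schemeOver.obj X)

/-- The restriction `φ₀ : Y ⟶ X` of `φ : Y[[t₁, …, t_d]] ⟶ X` to the zero section. -/
def phiZero : Y ⟶ X :=
  Over.homMk (schemeFunctorFullyFaithful.preimage (psZero d (ofScheme Y.left) ≫ φ.left)) (by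
    apply schemeFunctorFullyFaithful.map_injective
    have h : φ.left ≫ schemeFunctor.map X.hom =
        psProj d (ofScheme Y.left) ≫ schemeFunctor.map Y.hom := Over.w φ
    rw [Functor.map_comp, Functor.FullyFaithful.map_preimage]
    exact (congrArg (psZero d (ofScheme Y.left) ≫ ·) h).trans
      (congrArg (· ≫ schemeFunctor.map Y.hom) (psZero_psProj d (ofScheme Y.left))))

/-- The graph `Y ⟶ X × Y` of `f : Y ⟶ X`. -/
def graph (f : Y ⟶ X) : Y.left ⟶ pullback X.hom Y.hom :=
  pullback.lift f.left (𝟙 Y.left) (by simp)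

/-- For `X` separated of finite type over `k`, the completion of `X × Y` along the graph of
`f : Y ⟶ X`. -/
def Jet (f : Y ⟶ X) : TopLRS.{u} :=
  completion (pullback X.hom Y.hom) (graph f).ker

/-- The canonical map from `Jet f` to the product `X × Y`. -/
def jetι (f : Y ⟶ X) : Jet f ⟶ ofScheme (pullback X.hom Y.hom) :=
  completionι _ _

/-- `φ : Y[[t₁, …, t_d]] ⟶ X` is a local coordinate system on `X` parametrized by `Y`: the
completion `φ̂₀ : Y[[t₁, …, t_d]] ⟶ Jet φ₀` of `(φ, p_Y) : Y[[t₁, …, t_d]] ⟶ X × Y`, i.e. the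
morphism whose composition with `Jet φ₀ ⟶ X × Y` has components `φ` and `p_Y`, is an isomorphism
of formal schemes. -/
def IsLocalCoordinateSystem : Prop :=
  ∃ ψ : powerSeries d (ofScheme Y.left) ⟶ Jet (phiZero φ),
    ψ ≫ jetι (phiZero φ) ≫ schemeFunctor.map (pullback.fst X.hom Y.hom) = φ.left ∧
    ψ ≫ jetι (phiZero φ) ≫ schemeFunctor.map (pullback.snd X.hom Y.hom) =
      psProj d (ofScheme Y.left) ∧
    IsIso ψ

end

end FormalGeometry

end

/-! Representability of Φ. If X = Spec A, a k-morphism Y[[t]] → X is a ring homomorphism A →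
𝒪(Y)[[t]] that is constant on k. Equivalently, it is a family of coefficient maps on A that is
additive, satisfies the higher Leibniz rule, and kills the scalars in positive degree. The universal
such family lives on the Hasse–Schmidt algebra `HS`. A power series is invertible iff its constant
term is, so `HS` commutes with localization of A (`HS.isLocalization_map`). The spectra of the
algebras `HS` over the affine opens of X therefore glue to a scheme `arc` that is affine over X. Its
universal property (`arcUniv_injective`, `exists_arcUniv_eq`) holds for every locally ringed space
in place of Y. Topologies impose no condition here, because a morphism to a scheme is automatically
continuous.

The open subfunctor. Smoothness gives, locally on X, functions a₁, …, a_d whose differentials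
generate Ω (`exists_chart`). The main point is that φ is a local coordinate system iff the Jacobian
matrix formed by the linear coefficients of the φ^*(a_l) is invertible.

If the Jacobian is invertible, a Nakayama argument shows that functions near the graph of φ₀ surject
onto truncated power series (`trunc_comp_surjective`). The kernel is exactly I^(n+1), where I is the
ideal of the graph (`ker_trunc_comp`): the truncated polynomial ring surjects onto the quotient by
I^(n+1), and a surjective endomorphism of a finite module is injective. Thus the n-th thickening of
Y is the n-th infinitesimal neighbourhood of the graph. In the colimit over n this gives the
isomorphism Y[[t]] ≅ Jet (`exists_isIso_of_isLocallyEtale`).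

Conversely, let φ̂₀ be an isomorphism. Functions on X × Y are dense in the completion, so some of
them have the linear terms t₁, …, t_d. Taking linear coefficients is a derivation, hence determined
by its values on the a_l, and this forces the Jacobian to be invertible
(`isUnit_coordDet_of_isIso`).

Consequently local coordinate systems correspond to the points of `arc` at which the universal
Jacobian determinant is invertible. Over a chart this locus is one basic open subset of an affine
scheme, so it is open in `arc` and affine over X. -/

noncomputable section

namespace FormalGeometry

/-! ### Hasse–Schmidt algebras -/

section HasseSchmidt

open MvPowerSeries

variable {K A : Type u} [CommRing K] [CommRing A] (d : ℕ) (ρ : K →+* A)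

/-- The ideal of relations making `a ↦ ∑ X (a, α) t ^ α` a ring homomorphism which is constant on
the image of `ρ`. -/
def hsIdeal : Ideal (MvPolynomial (A × (Fin d →₀ ℕ)) ℤ) :=
  Ideal.span ({p | ∃ a b α, p = .X (a + b, α) - (.X (a, α) + .X (b, α))} ∪
    {p | ∃ a b α, p = .X (a * b, α) -
      ∑ x ∈ Finset.HasAntidiagonal.antidiagonal α, .X (a, x.1) * .X (b, x.2)} ∪
    {.X (1, 0) - 1} ∪ {p | ∃ c α, α ≠ 0 ∧ p = .X (ρ c, α)})

/-- The algebra of (higher) Hasse–Schmidt derivations: it represents the functor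
`R ↦ {f : A →+* R[[t₁, …, t_d]] | f ∘ ρ is constant}`. -/
def HS : Type u := MvPolynomial (A × (Fin d →₀ ℕ)) ℤ ⧸ hsIdeal d ρ

instance : CommRing (HS d ρ) := inferInstanceAs (CommRing (_ ⧸ hsIdeal d ρ))

namespace HS

variable {d}

/-- The generator of the Hasse–Schmidt algebra that is the `α`-th coefficient of `a`. -/
def gen (a : A) (α : Fin d →₀ ℕ) : HS d ρ := Ideal.Quotient.mk (hsIdeal d ρ) (.X (a, α))

lemma gen_add (a b : A) (α : Fin d →₀ ℕ) : gen ρ (a + b) α = gen ρ a α + gen ρ b α := by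
  refine (Ideal.Quotient.eq (I := hsIdeal d ρ)).2 (Ideal.subset_span ?_)
  exact Or.inl (Or.inl (Or.inl ⟨a, b, α, rfl⟩))

lemma gen_mul (a b : A) (α : Fin d →₀ ℕ) :
    gen ρ (a * b) α = ∑ x ∈ Finset.HasAntidiagonal.antidiagonal α, gen ρ a x.1 * gen ρ b x.2 := by
  have : (∑ x ∈ Finset.HasAntidiagonal.antidiagonal α, gen ρ a x.1 * gen ρ b x.2 : HS d ρ) =
      Ideal.Quotient.mk (hsIdeal d ρ)
        (∑ x ∈ Finset.HasAntidiagonal.antidiagonal α, .X (a, x.1) * .X (b, x.2)) := by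
    rw [map_sum]; rfl
  rw [this]
  refine (Ideal.Quotient.eq (I := hsIdeal d ρ)).2 (Ideal.subset_span ?_)
  exact Or.inl (Or.inl (Or.inr ⟨a, b, α, rfl⟩))

lemma gen_const (c : K) {α : Fin d →₀ ℕ} (hα : α ≠ 0) : gen ρ (ρ c) α = 0 :=
  Ideal.Quotient.eq_zero_iff_mem.2 (Ideal.subset_span (Or.inr ⟨c, α, hα, rfl⟩))

lemma gen_one : gen ρ 1 (0 : Fin d →₀ ℕ) = 1 :=
  (Ideal.Quotient.eq (I := hsIdeal d ρ)).2 (Ideal.subset_span (Or.inl (Or.inr rfl)))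

variable (d) in
/-- The universal homomorphism `A →+* (HS d ρ)[[t₁, …, t_d]]`. -/
def univ : A →+* MvPowerSeries (Fin d) (HS d ρ) :=
  RingHom.mk'
    { toFun := fun a α => gen ρ a α
      map_one' := by
        refine MvPowerSeries.ext fun α => ?_
        change gen ρ 1 α = _
        rw [coeff_one]
        split_ifs with h
        · rw [h, gen_one]
        -- No relation is imposed on the higher coefficients of `1`; they vanish because `1 = ρ 1`
        -- is a scalar.
        · rw [← map_one ρ, gen_const ρ _ h]
      map_mul' := fun a b => by
        refine MvPowerSeries.ext fun α => ?_
        exact (gen_mul ρ a b α).trans (coeff_mul α (fun β => gen ρ a β) (fun β => gen ρ b β)).symm }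
    fun a b => MvPowerSeries.ext fun α => gen_add ρ a b α

lemma coeff_univ (a : A) (α : Fin d →₀ ℕ) : coeff α (univ d ρ a) = gen ρ a α := rfl

variable {R : Type*} [CommRing R]

variable (d) in
/-- A homomorphism to a power series ring is constant on the image of `ρ`. -/
def IsConst (f : A →+* MvPowerSeries (Fin d) R) : Prop :=
  ∀ c, f (ρ c) = C (constantCoeff (f (ρ c)))

lemma isConst_univ : IsConst d ρ (univ d ρ) := by
  refine fun c => MvPowerSeries.ext fun α => ?_
  rw [coeff_C, coeff_univ]
  split_ifs with h
  · rw [h]; rfl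
  · exact gen_const ρ c h

variable {ρ}

/-- The universal property of the Hasse–Schmidt algebra. -/
def lift (f : A →+* MvPowerSeries (Fin d) R) (hf : IsConst d ρ f) : HS d ρ →+* R :=
  Ideal.Quotient.lift (hsIdeal d ρ)
    (MvPolynomial.eval₂Hom (Int.castRingHom R) fun x => coeff x.2 (f x.1)) <| by
    suffices h : hsIdeal d ρ ≤ RingHom.ker
      (MvPolynomial.eval₂Hom (Int.castRingHom R) fun x => coeff x.2 (f x.1)) from fun a ha => h ha
    refine Ideal.span_le.2 ?_
    rintro _ (((⟨a, b, α, rfl⟩ | ⟨a, b, α, rfl⟩) | rfl) | ⟨c, α, hα, rfl⟩)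
    · simp [RingHom.mem_ker]
    · simp [RingHom.mem_ker, coeff_mul]
    · simp [RingHom.mem_ker]
    · have := congr(coeff α $(hf c))
      rw [coeff_C, if_neg hα] at this
      simpa [RingHom.mem_ker] using this

lemma lift_gen (f : A →+* MvPowerSeries (Fin d) R) (hf : IsConst d ρ f) (a : A)
    (α : Fin d →₀ ℕ) : lift f hf (gen ρ a α) = coeff α (f a) := by
  refine (Ideal.Quotient.lift_mk (hsIdeal d ρ) _ _).trans ?_
  simp

lemma map_lift_univ (f : A →+* MvPowerSeries (Fin d) R) (hf : IsConst d ρ f) :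
    (MvPowerSeries.map (lift f hf)).comp (univ d ρ) = f :=
  RingHom.ext fun a => MvPowerSeries.ext fun α => lift_gen f hf a α

lemma hom_ext {g g' : HS d ρ →+* R}
    (h : (MvPowerSeries.map g).comp (univ d ρ) = (MvPowerSeries.map g').comp (univ d ρ)) :
    g = g' := by
  refine Ideal.Quotient.ringHom_ext (MvPolynomial.ringHom_ext (fun n => by simp) fun x => ?_)
  exact congr(coeff x.2 ($h x.1))

lemma isConst_map_comp {S : Type*} [CommRing S] {f : A →+* MvPowerSeries (Fin d) R}
    (hf : IsConst d ρ f) (g : R →+* S) : IsConst d ρ ((MvPowerSeries.map g).comp f) := by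
  intro c
  rw [RingHom.comp_apply, hf c]
  simp

variable (ρ) in
/-- The constant term of the universal homomorphism. -/
abbrev const : A →+* HS d ρ := (constantCoeff (σ := Fin d)).comp (univ d ρ)

section map

variable {A' : Type u} [CommRing A'] {ρ' : K →+* A'} (f : A →+* A') (hf : f.comp ρ = ρ')

/-- Functoriality of the Hasse–Schmidt algebra. -/
def map : HS d ρ →+* HS d ρ' :=
  lift ((univ d ρ').comp f) (fun c => by
    have := isConst_univ (d := d) ρ' c
    rwa [← hf] at this ⊢)

lemma map_univ : (MvPowerSeries.map (map (d := d) f hf)).comp (univ d ρ) = (univ d ρ').comp f :=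
  map_lift_univ _ _

lemma map_const (a : A) : map (d := d) f hf (const ρ a) = const ρ' (f a) := by
  have := congr(constantCoeff ($(map_univ (d := d) f hf) a))
  simpa using this

/-- The equality `e = id` is a hypothesis because the restriction of a presheaf along `le_refl` is
the identity only through the functor axioms. -/
lemma map_eq_id {e : A →+* A} (he : e.comp ρ = ρ) (h : e = RingHom.id A) :
    map (d := d) e he = RingHom.id _ :=
  hom_ext (by rw [map_univ, h]; simp)

lemma map_eq_comp {A'' : Type u} [CommRing A''] {ρ'' : K →+* A''} (g : A' →+* A'')
    (hg : g.comp ρ' = ρ'') {e : A →+* A''} (he : e.comp ρ = ρ'') (h : e = g.comp f) :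
    map (d := d) e he = (map g hg).comp (map f hf) :=
  hom_ext (by
    rw [map_univ, MvPowerSeries.map_comp, RingHom.comp_assoc, map_univ, ← RingHom.comp_assoc,
      map_univ, h, RingHom.comp_assoc])

/-- The formation of the Hasse–Schmidt algebra commutes with localization. -/
lemma isLocalization_map (r : A) (hr : @IsLocalization.Away A _ r A' _ f.toAlgebra) :
    @IsLocalization.Away (HS d ρ) _ (const ρ r) (HS d ρ') _ (map f hf).toAlgebra := by
  let := f.toAlgebra
  let := (map (d := d) f hf).toAlgebra
  let S := Localization.Away (const (d := d) ρ r)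
  let ℓ : HS d ρ →+* S := algebraMap _ _
  let e₀ : A →+* MvPowerSeries (Fin d) S := (MvPowerSeries.map ℓ).comp (univ d ρ)
  -- A power series is a unit as soon as its constant term is. Inverting the constant term of `r`
  -- therefore inverts the whole series of `r`, and `e₀` extends to `A'`.
  have he₀ : IsUnit (e₀ r) := by
    rw [MvPowerSeries.isUnit_iff_constantCoeff]
    have : constantCoeff (e₀ r) = ℓ (const ρ r) := by simp [e₀]
    rw [this]
    exact IsLocalization.Away.algebraMap_isUnit _
  let e₁ : A' →+* MvPowerSeries (Fin d) S := IsLocalization.Away.lift r he₀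
  have he₁ : e₁.comp f = e₀ := IsLocalization.Away.lift_comp r he₀
  have hc : IsConst d ρ' e₁ := fun c => by
    have h1 : e₁ (ρ' c) = e₀ (ρ c) := by rw [← hf, ← he₁]; rfl
    rw [h1]
    exact isConst_map_comp (isConst_univ ρ) ℓ c
  let φ : HS d ρ' →+* S := lift e₁ hc
  have hu : IsUnit (map (d := d) f hf (const ρ r)) := by
    rw [map_const]
    exact (IsLocalization.Away.algebraMap_isUnit (S := A') r).map (const (d := d) ρ')
  let ψ : S →+* HS d ρ' := IsLocalization.Away.lift (const (d := d) ρ r) hu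
  have hψ : ψ.comp ℓ = map f hf := IsLocalization.Away.lift_comp _ hu
  have hφ : φ.comp (map f hf) = ℓ := hom_ext (by
    rw [MvPowerSeries.map_comp, RingHom.comp_assoc, map_univ, ← RingHom.comp_assoc,
      map_lift_univ, he₁])
  have h1 : φ.comp ψ = RingHom.id S := by
    refine IsLocalization.ringHom_ext (Submonoid.powers (const (d := d) ρ r)) ?_
    change (φ.comp ψ).comp ℓ = (RingHom.id S).comp ℓ
    rw [RingHom.comp_assoc, hψ, hφ, RingHom.id_comp]
  have h2 : ψ.comp φ = RingHom.id (HS d ρ') := by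
    refine hom_ext ?_
    rw [MvPowerSeries.map_comp, RingHom.comp_assoc, map_lift_univ]
    refine IsLocalization.ringHom_ext (Submonoid.powers r) ?_
    change ((MvPowerSeries.map ψ).comp e₁).comp f =
      ((MvPowerSeries.map (RingHom.id (HS d ρ'))).comp (univ d ρ')).comp f
    rw [RingHom.comp_assoc, he₁, ← RingHom.comp_assoc, ← MvPowerSeries.map_comp, hψ, map_univ,
      MvPowerSeries.map_id, RingHom.id_comp]
  let e : S ≃ₐ[HS d ρ] HS d ρ' :=
    { RingEquiv.ofRingHom ψ φ h2 h1 with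
      commutes' := fun x => congr($hψ x) }
  exact IsLocalization.isLocalization_of_algEquiv (Submonoid.powers (const (d := d) ρ r)) e

end map

end HS

end HasseSchmidt


/-! ### Locally ringed spaces: sections and gluing of morphisms -/

namespace LRS

open TopLRS

variable {L M N : LocallyRingedSpace.{u}}

/-- Pullback of sections over `U` to sections over an open subset `V` of the preimage. -/
def appLE (f : L ⟶ M) (U : Opens M.toTopCat) (V : Opens L.toTopCat)
    (e : V ≤ (Opens.map f.base).obj U) : M.presheaf.obj (op U) ⟶ L.presheaf.obj (op V) :=
  f.c.app (op U) ≫ L.presheaf.map (homOfLE e).op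

lemma appLE_self (f : L ⟶ M) (U : Opens M.toTopCat) :
    appLE f U ((Opens.map f.base).obj U) le_rfl = f.c.app (op U) := by
  refine (congrArg (f.c.app (op U) ≫ ·) (L.presheaf.map_id _)).trans (Category.comp_id _)

lemma appLE_map (f : L ⟶ M) {U : Opens M.toTopCat} {V V' : Opens L.toTopCat}
    (e : V ≤ (Opens.map f.base).obj U) (h : V' ≤ V) :
    appLE f U V e ≫ L.presheaf.map (homOfLE h).op = appLE f U V' (h.trans e) := by
  rw [appLE, Category.assoc, ← L.presheaf.map_comp]; rfl

lemma map_appLE (f : L ⟶ M) {U U' : Opens M.toTopCat} {V : Opens L.toTopCat}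
    (e : V ≤ (Opens.map f.base).obj U) (h : U ≤ U') :
    M.presheaf.map (homOfLE h).op ≫ appLE f U V e =
      appLE f U' V (e.trans ((Opens.map f.base).map (homOfLE h)).le) := by
  rw [appLE, ← Category.assoc, f.c.naturality, Category.assoc]
  exact congrArg (f.c.app (op U') ≫ ·) (L.presheaf.map_comp _ _).symm

lemma comp_appLE (f : L ⟶ M) (g : M ⟶ N) {U : Opens N.toTopCat} {V : Opens M.toTopCat}
    {W : Opens L.toTopCat} (e : V ≤ (Opens.map g.base).obj U) (e' : W ≤ (Opens.map f.base).obj V) :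
    appLE g U V e ≫ appLE f V W e' =
      appLE (f ≫ g) U W (e'.trans ((Opens.map f.base).map (homOfLE e)).le) := by
  rw [appLE, Category.assoc, map_appLE, appLE, appLE, LocallyRingedSpace.comp_c, ← Category.assoc]
  rfl

lemma appLE_congr {f g : L ⟶ M} (h : f = g) {U : Opens M.toTopCat} {V : Opens L.toTopCat}
    (e : V ≤ (Opens.map f.base).obj U) : appLE f U V e = appLE g U V (h ▸ e) := by
  subst h; rfl

/-- Comparing pullbacks for all pairs `U`, `V` avoids transporting sections along an equality
between the two preimages of `U`. -/
lemma hom_ext_appLE {f g : L ⟶ M} (hb : ∀ x, f.base x = g.base x)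
    (h : ∀ U V e e', appLE f U V e = appLE g U V e') : f = g := by
  have hb' : f.base = g.base := TopCat.hom_ext (ContinuousMap.ext hb)
  obtain ⟨⟨b, c⟩, p⟩ := f
  obtain ⟨⟨b', c'⟩, p'⟩ := g
  obtain rfl : b = b' := hb'
  refine lrs_hom_ext b p p' fun U s => ?_
  have := h U.unop ((Opens.map b).obj U.unop) le_rfl le_rfl
  rw [appLE_self, appLE_self] at this
  exact congr(($this).hom s)

lemma appLE_bijective (f : L ⟶ M) [H : LocallyRingedSpace.IsOpenImmersion f]
    (V : Opens M.toTopCat) (hV : ∀ x ∈ V, ∃ y, f.base y = x)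
    (W : Opens L.toTopCat) (hW : W = (Opens.map f.base).obj V) :
    Function.Bijective (appLE f V W hW.le) := by
  subst hW
  rw [appLE_self]
  have hV' : V = (PresheafedSpace.IsOpenImmersion.opensFunctor f.toHom).obj
      ((Opens.map f.base).obj V) := by
    ext x
    constructor
    · intro hx
      obtain ⟨y, rfl⟩ := hV x hx
      exact ⟨y, hx, rfl⟩
    · rintro ⟨y, hy, rfl⟩
      exact hy
  have : IsIso (f.c.app (op V)) := PresheafedSpace.IsOpenImmersion.c_iso' f.toHom _ hV'
  exact (ConcreteCategory.isIso_iff_bijective _).1 this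

lemma isUnit_germ_congr {p q : M} (h : p = q) {U : Opens M.toTopCat} (hp : p ∈ U) (hq : q ∈ U)
    (s : M.presheaf.obj (op U)) (hs : IsUnit (M.presheaf.germ U p hp s)) :
    IsUnit (M.presheaf.germ U q hq s) := by
  subst h; exact hs

lemma isUnit_germ_appLE {f : L ⟶ M} {U V e} {x : L} (hx : x ∈ V)
    {s : M.presheaf.obj (op U)} (hs : IsUnit (M.presheaf.germ U (f.base x) (e hx) s)) :
    IsUnit (L.presheaf.germ V x hx (appLE f U V e s)) := by
  have h1 := LocallyRingedSpace.stalkMap_germ_apply f U x (e hx) s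
  have h2 : L.presheaf.germ V x hx (appLE f U V e s) =
      L.presheaf.germ _ x (e hx) (f.c.app (op U) s) :=
    TopCat.Presheaf.germ_res_apply L.presheaf (homOfLE e) x hx _
  rw [h2, ← h1]
  exact hs.map _

/-- This is the locality of the stalk maps, phrased for `appLE`. -/
lemma isUnit_germ_of_appLE {f : L ⟶ M} {U V e} {x : L} (hx : x ∈ V)
    {s : M.presheaf.obj (op U)} (hs : IsUnit (L.presheaf.germ V x hx (appLE f U V e s))) :
    IsUnit (M.presheaf.germ U (f.base x) (e hx) s) := by
  refine isUnit_germ_of_isUnit_germ_app f x U (e hx) s ?_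
  have h2 : L.presheaf.germ V x hx (appLE f U V e s) =
      L.presheaf.germ _ x (e hx) (f.c.app (op U) s) :=
    TopCat.Presheaf.germ_res_apply L.presheaf (homOfLE e) x hx _
  rwa [← h2]

/-! ### Morphisms defined through a jointly surjective family, not necessarily of open immersions -/

section sections

variable {ι : Type*} {Li : ι → LocallyRingedSpace.{u}} (j : ∀ i, Li i ⟶ L)

/-- Locality of the stalk maps is inherited from the `fi i`: a unit germ at `(j i).base y` pulls
back to a unit germ on `Li i`, where it is the pullback of `s` by a morphism already known to be
local. -/
lemma exists_hom_of_presheafHom (hj : ∀ x : L, ∃ i y, (j i).base y = x)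
    (b : L.toTopCat ⟶ M.toTopCat) (c : M.presheaf ⟶ b _* L.presheaf)
    (fi : ∀ i, Li i ⟶ M) (hF : ∀ i y, b ((j i).base y) = (fi i).base y)
    (ht : ∀ U s i W e e', appLE (j i) ((Opens.map b).obj U) W e (c.app (op U) s) =
      appLE (fi i) U W e' s) :
    ∃ g : L ⟶ M, ∀ i, j i ≫ g = fi i := by
  let g : L ⟶ M := ⟨⟨b, c⟩, fun x => isLocalHom_stalkMap_of_germ _ x fun U hx s h => by
    obtain ⟨i, y, rfl⟩ := hj x
    have hb : (Opens.map (j i).base).obj ((Opens.map b).obj U) ≤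
      (Opens.map (fi i).base).obj U := fun y hy => by
      change (fi i).base y ∈ U
      rw [← hF]
      exact hy
    have h1 := isUnit_germ_appLE (f := j i) (V := (Opens.map (j i).base).obj ((Opens.map b).obj U))
      (e := le_rfl) (x := y) hx h
    have h3 := isUnit_germ_of_appLE (f := fi i) (e := hb) hx ((ht U s i _ le_rfl hb) ▸ h1)
    exact isUnit_germ_congr (hF i y).symm _ _ _ h3⟩
  refine ⟨g, fun i => hom_ext_appLE (hF i) fun U V e e' => ?_⟩
  have h1 := comp_appLE (j i) g (le_refl ((Opens.map b).obj U)) e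
  ext s
  refine (congr(($h1).hom s)).symm.trans (Eq.trans ?_ (ht U s i V e e'))
  exact congrArg (appLE (j i) ((Opens.map b).obj U) V e) (congr(($(appLE_self g U)).hom s))

/-- Construct a morphism from a map and a local description of its effect on sections. -/
lemma exists_hom_of_local (hj : ∀ x : L, ∃ i y, (j i).base y = x)
    (hinj : ∀ (U : Opens L.toTopCat) (s t : L.presheaf.obj (op U)),
      (∀ i, appLE (j i) U _ le_rfl s = appLE (j i) U _ le_rfl t) → s = t)
    (F : L → M) (hcont : Continuous F) (fi : ∀ i, Li i ⟶ M) (hF : ∀ i y, F ((j i).base y) = (fi i).base y)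
    (hs : ∀ (U : Opens M.toTopCat) (V : Opens L.toTopCat) (_ : ∀ x, x ∈ V ↔ F x ∈ U)
      (s : M.presheaf.obj (op U)), ∃ t : L.presheaf.obj (op V), ∀ i W e e',
      appLE (j i) V W e t = appLE (fi i) U W e' s) :
    ∃ g : L ⟶ M, ∀ i, j i ≫ g = fi i := by
  let b : L.toTopCat ⟶ M.toTopCat := TopCat.ofHom ⟨F, hcont⟩
  have hb : ∀ (i) (U : Opens M.toTopCat), (Opens.map (j i).base).obj ((Opens.map b).obj U) ≤
      (Opens.map (fi i).base).obj U := fun i U y hy => by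
    change (fi i).base y ∈ U
    rw [← hF]
    exact hy
  choose t ht using fun U => hs U ((Opens.map b).obj U) (fun x => Iff.rfl)
  -- A section is pinned down by its pullbacks to the `Li i`, so the chosen `t` is automatically
  -- additive, multiplicative and natural.
  have huniq : ∀ (U : Opens M.toTopCat) (s : M.presheaf.obj (op U))
      (t' : L.presheaf.obj (op ((Opens.map b).obj U))),
      (∀ i, appLE (j i) _ _ le_rfl t' = appLE (fi i) U _ (hb i U) s) → t U s = t' := by
    intro U s t' ht'
    exact hinj _ _ _ fun i => (ht U s i _ le_rfl (hb i U)).trans (ht' i).symm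
  let φ : ∀ U : Opens M.toTopCat,
      M.presheaf.obj (op U) →+* L.presheaf.obj (op ((Opens.map b).obj U)) := fun U =>
    { toFun := t U
      map_one' := huniq U _ _ fun i => by rw [map_one, map_one]
      map_zero' := huniq U _ _ fun i => by rw [map_zero, map_zero]
      map_mul' := fun s s' => huniq U _ _ fun i => by
        rw [map_mul, map_mul, ht U s i _ le_rfl (hb i U), ht U s' i _ le_rfl (hb i U)]
      map_add' := fun s s' => huniq U _ _ fun i => by
        rw [map_add, map_add, ht U s i _ le_rfl (hb i U), ht U s' i _ le_rfl (hb i U)] }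
  have hnat : ∀ (U V : Opens M.toTopCat) (k : V ≤ U) (s : M.presheaf.obj (op U)),
      t V (M.presheaf.map (homOfLE k).op s) =
        L.presheaf.map ((Opens.map b).map (homOfLE k)).op (t U s) := by
    intro U V k s
    refine huniq _ _ _ fun i => ?_
    have h1 := map_appLE (j i) (le_refl ((Opens.map (j i).base).obj
      ((Opens.map b).obj V))) ((Opens.map b).map (homOfLE k)).le
    have h2 := map_appLE (fi i) (hb i V) k
    refine (congr(($h1).hom (t U s))).trans (Eq.trans ?_ (congr(($h2).hom s)).symm)
    exact ht U s i _ _ _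
  let c : M.presheaf ⟶ b _* L.presheaf :=
    { app := fun U => CommRingCat.ofHom (φ U.unop)
      naturality := fun U V k => CommRingCat.hom_ext (RingHom.ext fun s =>
        hnat U.unop V.unop k.unop.le s) }
  exact exists_hom_of_presheafHom j hj b c fi hF ht

end sections

/-! ### Gluing along open immersions -/

section cover

variable {ι : Type*} {Li : ι → LocallyRingedSpace.{u}} (j : ∀ i, Li i ⟶ L)
  [∀ i, LocallyRingedSpace.IsOpenImmersion (j i)]

lemma eq_of_appLE_eq (hj : ∀ x : L, ∃ i y, (j i).base y = x)
    {U : Opens L.toTopCat} (s t : L.presheaf.obj (op U))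
    (h : ∀ i, ∀ y : Li i, (j i).base y ∈ U → ∃ W, y ∈ W ∧ ∃ e : W ≤ (Opens.map (j i).base).obj U,
      appLE (j i) U W e s = appLE (j i) U W e t) : s = t := by
  refine L.IsSheaf.section_ext ?_
  intro x hx
  obtain ⟨i, y, rfl⟩ := hj x
  obtain ⟨W, hy, e, hst⟩ := h i y hx
  let V : Opens L.toTopCat := (PresheafedSpace.IsOpenImmersion.opensFunctor (j i).toHom).obj W
  have hVU : V ≤ U := by
    rintro _ ⟨y, hy, rfl⟩
    exact e hy
  have hWV : W = (Opens.map (j i).base).obj V := by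
    ext y
    refine ⟨fun hy => ⟨y, hy, rfl⟩, ?_⟩
    rintro ⟨y', hy', h⟩
    rwa [← (PresheafedSpace.IsOpenImmersion.base_open (f := (j i).toHom)).injective h]
  refine ⟨V, hVU, ⟨y, hy, rfl⟩, ?_⟩
  refine (appLE_bijective (j i) V (fun x ⟨y, _, h⟩ => ⟨y, h⟩) W hWV).1 ?_
  have h1 := map_appLE (j i) hWV.le hVU
  exact (congr(($h1).hom s)).trans (hst.trans (congr(($h1).hom t)).symm)

lemma hom_ext_cover (hj : ∀ x : L, ∃ i y, (j i).base y = x)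
    {g g' : L ⟶ M} (h : ∀ i, j i ≫ g = j i ≫ g') : g = g' := by
  refine hom_ext_appLE (fun x => ?_) fun U V e e' => ?_
  · obtain ⟨i, y, rfl⟩ := hj x
    exact congr(($(h i)).base y)
  · ext s
    refine eq_of_appLE_eq j hj _ _ fun i y hy =>
      ⟨(Opens.map (j i).base).obj V, hy, le_rfl, ?_⟩
    have h1 := (comp_appLE (j i) g e le_rfl).trans
      ((appLE_congr (h i) _).trans (comp_appLE (j i) g' e' le_rfl).symm)
    exact congr(($h1).hom s)

/-- Gluing of morphisms of locally ringed spaces along an open covering. -/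
lemma exists_glue (hj : ∀ x : L, ∃ i y, (j i).base y = x)
    (fi : ∀ i, Li i ⟶ M)
    (hf : ∀ i i' (x : Li i) (y : Li i'), (j i).base x = (j i').base y →
      ∃ (T : LocallyRingedSpace.{u}) (a : T ⟶ Li i) (b : T ⟶ Li i') (z : T),
        LocallyRingedSpace.IsOpenImmersion (a ≫ j i) ∧ a.base z = x ∧ b.base z = y ∧
        a ≫ j i = b ≫ j i' ∧ a ≫ fi i = b ≫ fi i') :
    ∃ g : L ⟶ M, ∀ i, j i ≫ g = fi i := by
  -- Each point of `L` gets an arbitrary preimage; `hf`, which replaces fibre products by a chart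
  -- `T` around each pair of points with the same image, shows that the value of `fi` does not
  -- depend on the choice.
  choose i y hiy using hj
  have hF : ∀ i₀ y₀, (fi (i ((j i₀).base y₀))).base (y ((j i₀).base y₀)) = (fi i₀).base y₀ := by
    intro i₀ y₀
    obtain ⟨T, a, b, z, -, rfl, hb, h1, h2⟩ := hf i₀ _ y₀ _ (hiy ((j i₀).base y₀)).symm
    rw [← hb]
    exact congr(($h2).base z).symm
  have hj : ∀ x : L, ∃ i y, (j i).base y = x := fun x => ⟨i x, y x, hiy x⟩
  have hcont : Continuous fun x => (fi (i x)).base (y x) := by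
    refine continuous_iff_continuousAt.2 fun x => ?_
    obtain ⟨i', y', rfl⟩ := hj x
    refine ((PresheafedSpace.IsOpenImmersion.base_open
      (f := (j i').toHom)).continuousAt_iff (g := fun x => (fi (i x)).base (y x))).1 ?_
    have : (fun x => (fi (i x)).base (y x)) ∘ (j i').base = (fi i').base := funext (hF i')
    change ContinuousAt ((fun x => (fi (i x)).base (y x)) ∘ (j i').base) y'
    rw [this]
    exact (fi i').base.hom.continuous.continuousAt
  refine exists_hom_of_local j hj (fun U s t h => eq_of_appLE_eq j hj _ _ fun i y hy =>
    ⟨_, hy, le_rfl, h i⟩) (fun x => (fi (i x)).base (y x)) hcont fi hF ?_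
  intro U V hV s
  -- The pullback of `s` to `W i` is carried to the open image `V' i` of `W i` in `L`; these
  -- sections are then glued over `V`.
  let W : ∀ i, Opens (Li i).toTopCat := fun i => (Opens.map (fi i).base).obj U
  let V' : ∀ i, Opens L.toTopCat := fun i =>
    (PresheafedSpace.IsOpenImmersion.opensFunctor (j i).toHom).obj (W i)
  have hWV : ∀ i, W i = (Opens.map (j i).base).obj (V' i) := by
    intro i
    ext y
    refine ⟨fun hy => ⟨y, hy, rfl⟩, ?_⟩
    rintro ⟨y', hy', h⟩
    rwa [← (PresheafedSpace.IsOpenImmersion.base_open (f := (j i).toHom)).injective h]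
  have hV'V : ∀ i, V' i ≤ V := by
    rintro i _ ⟨y, hy, rfl⟩
    refine (hV _).2 ?_
    have := hF i y
    change _ ∈ U
    erw [this]
    exact hy
  choose t ht using fun i => (appLE_bijective (j i) (V' i) (fun x ⟨y, _, h⟩ => ⟨y, h⟩) (W i)
    (hWV i)).2 (appLE (fi i) U (W i) le_rfl s)
  obtain ⟨τ, hτ, -⟩ := L.sheaf.existsUnique_gluing' V' V (fun i => homOfLE (hV'V i)) (by
      intro x hx
      refine Opens.mem_iSup.2 ⟨i x, y x, ?_, hiy x⟩
      exact (hV x).1 hx) t (by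
    intro i i'
    refine L.IsSheaf.section_ext ?_
    rintro p ⟨⟨x, hx, hxp⟩, ⟨y, hy, hyp⟩⟩
    obtain ⟨T, a, b, z, ha, rfl, rfl, h1, h2⟩ := hf i i' x y (hxp.trans hyp.symm)
    -- Agreement on `V' i ⊓ V' i'` is checked near each point on the image `N` of the chart `T`,
    -- after pulling back along the open immersion `a ≫ j i`.
    let N : Opens L.toTopCat := (PresheafedSpace.IsOpenImmersion.opensFunctor (a ≫ j i).toHom).obj
      ((Opens.map (a ≫ fi i).base).obj U)
    have hN : (Opens.map (a ≫ fi i).base).obj U = (Opens.map (a ≫ j i).base).obj N := by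
      ext y
      refine ⟨fun hy => ⟨y, hy, rfl⟩, ?_⟩
      rintro ⟨y', hy', h⟩
      rwa [← (PresheafedSpace.IsOpenImmersion.base_open (f := (a ≫ j i).toHom)).injective h]
    have hN1 : N ≤ V' i := by
      rintro _ ⟨q, hq, rfl⟩
      exact ⟨a.base q, hq, rfl⟩
    have hN2 : N ≤ V' i' := by
      rintro _ ⟨q, hq, rfl⟩
      refine ⟨b.base q, ?_, congr(($h1).base q).symm⟩
      have : (fi i').base (b.base q) = (fi i).base (a.base q) := congr(($h2).base q).symm
      change (fi i').base (b.base q) ∈ U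
      rw [this]
      exact hq
    refine ⟨N, fun q hq => ⟨hN1 hq, hN2 hq⟩, ⟨z, hx, hxp⟩, ?_⟩
    refine (appLE_bijective (a ≫ j i) N (fun x ⟨y, _, h⟩ => ⟨y, h⟩) _ hN).1 ?_
    have hi : ∀ e, (appLE (a ≫ j i) (V' i) ((Opens.map (a ≫ fi i).base).obj U) e) (t i) =
        appLE (a ≫ fi i) U _ le_rfl s := fun e => by
      have e1 := comp_appLE a (j i) (hWV i).le
        (show (Opens.map (a ≫ fi i).base).obj U ≤ (Opens.map a.base).obj (W i) from fun _ h => h)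
      have e2 := comp_appLE a (fi i) (le_refl (W i))
        (show (Opens.map (a ≫ fi i).base).obj U ≤ (Opens.map a.base).obj (W i) from fun _ h => h)
      refine (congr(($e1).hom (t i))).symm.trans (Eq.trans ?_ congr(($e2).hom s))
      exact congrArg (appLE a (W i) _ _) (ht i)
    have hi' : ∀ e, (appLE (a ≫ j i) (V' i') ((Opens.map (a ≫ fi i).base).obj U) e) (t i') =
        appLE (a ≫ fi i) U _ le_rfl s := fun e => by
      have hle : (Opens.map (a ≫ fi i).base).obj U ≤ (Opens.map b.base).obj (W i') := by
        rw [h2]; exact fun _ h => h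
      have e1 := comp_appLE b (j i') (hWV i').le hle
      have e2 := comp_appLE b (fi i') (le_refl (W i')) hle
      have e3 := appLE_congr h1 e
      have e4 := appLE_congr h2 (le_refl ((Opens.map (a ≫ fi i).base).obj U))
      refine (congr(($(e3.trans e1.symm)).hom (t i'))).trans
        (Eq.trans ?_ congr(($(e2.trans e4.symm)).hom s))
      exact congrArg (appLE b (W i') _ _) (ht i')
    have r1 := map_appLE (a ≫ j i) hN.le hN1
    have r2 := map_appLE (a ≫ j i) hN.le hN2
    have r3 : ∀ (U' : Opens L.toTopCat) (h1 : N ≤ U') (h2 : U' ≤ V' i),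
      L.presheaf.map (homOfLE h1).op (L.presheaf.map (homOfLE h2).op (t i)) =
        L.presheaf.map (homOfLE (h1.trans h2)).op (t i) := fun U' h1 h2 =>
      congr(($(L.presheaf.map_comp (homOfLE h2).op (homOfLE h1).op)).hom (t i)).symm
    have r4 : ∀ (U' : Opens L.toTopCat) (h1 : N ≤ U') (h2 : U' ≤ V' i'),
      L.presheaf.map (homOfLE h1).op (L.presheaf.map (homOfLE h2).op (t i')) =
        L.presheaf.map (homOfLE (h1.trans h2)).op (t i') := fun U' h1 h2 =>
      congr(($(L.presheaf.map_comp (homOfLE h2).op (homOfLE h1).op)).hom (t i')).symm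
    refine (congrArg _ (r3 (V' i ⊓ V' i') (fun q hq => ⟨hN1 hq, hN2 hq⟩) inf_le_left)).trans
      (Eq.trans ?_ (congrArg _ (r4 (V' i ⊓ V' i') (fun q hq => ⟨hN1 hq, hN2 hq⟩) inf_le_right)).symm)
    exact (congr(($r1).hom (t i))).trans ((hi _).trans
      ((hi' _).symm.trans (congr(($r2).hom (t i'))).symm)))
  refine ⟨τ, fun i T e e' => ?_⟩
  have hTW : T ≤ W i := e'
  have r1 := map_appLE (j i) (hTW.trans (hWV i).le) (hV'V i)
  have r2 := appLE_map (j i) (hWV i).le hTW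
  have r3 := appLE_map (fi i) (le_refl (W i)) hTW
  refine congr(($r1).hom τ).symm.trans ?_
  refine (congrArg (appLE (j i) (V' i) T _) (hτ i)).trans ?_
  refine congr(($r2).hom (t i)).symm.trans ?_
  refine Eq.trans ?_ congr(($r3).hom s)
  exact congrArg ((Li i).presheaf.map (homOfLE hTW).op) (ht i)

end cover

end LRS


/-! ### Morphisms to affine schemes, and power series over locally ringed spaces -/

namespace LRS

open TopLRS

variable {L M N : LocallyRingedSpace.{u}} {A B : CommRingCat.{u}}

/-- The ring homomorphism corresponding to a morphism to an affine scheme. -/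
def specRing (g : L ⟶ (Spec A).toLocallyRingedSpace) : A ⟶ L.presheaf.obj (op ⊤) :=
  (Scheme.ΓSpecIso A).inv ≫ g.c.app (op ⊤)

/-- The morphism to an affine scheme corresponding to a ring homomorphism. -/
def toSpec (f : A ⟶ L.presheaf.obj (op ⊤)) : L ⟶ (Spec A).toLocallyRingedSpace :=
  ΓSpec.locallyRingedSpaceAdjunction.homEquiv L (op A) f.op

lemma specRing_eq (g : L ⟶ (Spec A).toLocallyRingedSpace) :
    specRing g = ((ΓSpec.locallyRingedSpaceAdjunction.homEquiv L (op A)).symm g).unop := by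
  exact congrArg Quiver.Hom.unop (ΓSpec.locallyRingedSpaceAdjunction.homEquiv_counit
    (X := L) (Y := op A) (g := g)).symm

lemma specRing_toSpec (f : A ⟶ L.presheaf.obj (op ⊤)) : specRing (toSpec f) = f := by
  rw [specRing_eq]
  exact congrArg Quiver.Hom.unop
    ((ΓSpec.locallyRingedSpaceAdjunction.homEquiv L (op A)).symm_apply_apply f.op)

lemma specRing_injective : Function.Injective
    (specRing : (L ⟶ (Spec A).toLocallyRingedSpace) → (A ⟶ L.presheaf.obj (op ⊤))) := by
  intro g g' h
  rw [specRing_eq, specRing_eq] at h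
  exact (ΓSpec.locallyRingedSpaceAdjunction.homEquiv L (op A)).symm.injective
    (Quiver.Hom.unop_inj h)

lemma specRing_comp (h : L ⟶ M) (g : M ⟶ (Spec A).toLocallyRingedSpace) :
    specRing (h ≫ g) = specRing g ≫ h.c.app (op ⊤) :=
  (Category.assoc _ _ _).symm

lemma specRing_specMap (g : L ⟶ (Spec A).toLocallyRingedSpace) (f : B ⟶ A) :
    specRing (g ≫ (Spec.map f).toLRSHom) = f ≫ specRing g := by
  have h := Scheme.ΓSpecIso_inv_naturality f
  refine (specRing_comp _ _).trans ?_
  exact (congrArg (· ≫ g.c.app (op ⊤)) h.symm).trans (Category.assoc _ _ _)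

/-- A locally ringed space with indiscrete topologies on the rings of sections. -/
def indiscrete (L : LocallyRingedSpace.{u}) : TopLRS.{u} where
  toLocallyRingedSpace := L
  sectionTop _ := ⊤
  isTopologicalRing _ :=
    @IsTopologicalRing.mk _ ⊤ _ (@IsTopologicalSemiring.mk _ ⊤ _
      (@ContinuousAdd.mk _ ⊤ _ continuous_top) (@ContinuousMul.mk _ ⊤ _ continuous_top))
      (@ContinuousNeg.mk _ ⊤ _ continuous_top)
  sectionTop_eq _ _ _ _ _ := by simp [induced_top]

variable (d : ℕ)

/-- The functoriality of `L ↦ L[[t₁, …, t_d]]` on locally ringed spaces. -/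
def psLRSMap (f : L ⟶ M) : psLRS d L ⟶ psLRS d M :=
  (psMap d (X := indiscrete L) (Y := indiscrete M) ⟨f, fun _ => continuous_top⟩).toLRSHom

/-- The projection `L[[t₁, …, t_d]] ⟶ L`. -/
def psLRSProj (L : LocallyRingedSpace.{u}) : psLRS d L ⟶ L := (psProj d (indiscrete L)).toLRSHom

/-- The zero section `L ⟶ L[[t₁, …, t_d]]`. -/
def psLRSZero (L : LocallyRingedSpace.{u}) : L ⟶ psLRS d L := (psZero d (indiscrete L)).toLRSHom

lemma psLRSMap_comp (f : L ⟶ M) (g : M ⟶ N) :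
    psLRSMap d (f ≫ g) = psLRSMap d f ≫ psLRSMap d g :=
  lrs_hom_ext _ _ _ fun _ _ => MvPowerSeries.ext fun _ => rfl

lemma psLRSMap_proj (f : L ⟶ M) : psLRSMap d f ≫ psLRSProj d M = psLRSProj d L ≫ f :=
  lrs_hom_ext _ _ _ fun U s => MvPowerSeries.map_C (f.c.app U).hom s

lemma psLRSZero_map (f : L ⟶ M) : psLRSZero d L ≫ psLRSMap d f = f ≫ psLRSZero d M :=
  lrs_hom_ext _ _ _ fun U s =>
    MvPowerSeries.constantCoeff_map (σ := Fin d) (f.c.app U).hom s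

lemma psLRSZero_proj : psLRSZero d L ≫ psLRSProj d L = 𝟙 L :=
  lrs_hom_ext _ _ _ fun U s =>
    MvPowerSeries.constantCoeff_C (σ := Fin d) (R := L.presheaf.obj U) s

instance (f : L ⟶ M) [H : LocallyRingedSpace.IsOpenImmersion f] :
    LocallyRingedSpace.IsOpenImmersion (psLRSMap d f) where
  base_open := PresheafedSpace.IsOpenImmersion.base_open (f := f.toHom)
  c_iso U := by
    have h1 : IsIso (f.c.app (op ((PresheafedSpace.IsOpenImmersion.opensFunctor f.toHom).obj U))) :=
      PresheafedSpace.IsOpenImmersion.c_iso (f := f.toHom) U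
    have h2 := (ConcreteCategory.isIso_iff_bijective _).1 h1
    refine (ConcreteCategory.isIso_iff_bijective _).2 ⟨fun s t hst => ?_, fun t => ?_⟩
    · exact MvPowerSeries.ext fun n => h2.1 congr(MvPowerSeries.coeff n $hst)
    · choose s hs using fun n => h2.2 (MvPowerSeries.coeff n t)
      exact ⟨fun n => s n, MvPowerSeries.ext hs⟩

lemma specRing_map (f : L ⟶ M) (g : psLRS d M ⟶ (Spec A).toLocallyRingedSpace) :
    specRing (psLRSMap d f ≫ g) =
      specRing g ≫ CommRingCat.ofHom (MvPowerSeries.map (f.c.app (op ⊤)).hom) :=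
  specRing_comp _ _

lemma specRing_proj (g : L ⟶ (Spec A).toLocallyRingedSpace) :
    specRing (psLRSProj d L ≫ g) =
      specRing g ≫ CommRingCat.ofHom (MvPowerSeries.C (σ := Fin d)
        (R := L.presheaf.obj (op ⊤))) :=
  specRing_comp _ _

lemma specRing_zero (g : psLRS d L ⟶ (Spec A).toLocallyRingedSpace) :
    specRing (psLRSZero d L ≫ g) =
      specRing g ≫ CommRingCat.ofHom (MvPowerSeries.constantCoeff (σ := Fin d)
        (R := L.presheaf.obj (op ⊤))) :=
  specRing_comp _ _

/-- `φ : L[[t₁, …, t_d]] ⟶ X` is a morphism over the base for the structure on `L` given by its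
restriction to the zero section. -/
def IsConstHom {d : ℕ} {X S : LocallyRingedSpace.{u}} (σ : X ⟶ S) (φ : psLRS d L ⟶ X) : Prop :=
  φ ≫ σ = psLRSProj d L ≫ psLRSZero d L ≫ φ ≫ σ

variable {d} in
lemma IsConstHom.map {X S : LocallyRingedSpace.{u}} {σ : X ⟶ S} {φ : psLRS d M ⟶ X}
    (h : IsConstHom σ φ) (f : L ⟶ M) : IsConstHom σ (psLRSMap d f ≫ φ) := by
  have h' : φ ≫ σ = psLRSProj d M ≫ psLRSZero d M ≫ φ ≫ σ := h
  rw [IsConstHom, Category.assoc, reassoc_of% psLRSZero_map, reassoc_of% (psLRSMap_proj d f).symm,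
    ← h']

/-- A morphism to an affine scheme is constant over the base iff the homomorphism is. -/
lemma isConstHom_iff {K : CommRingCat.{u}} (ρ : K ⟶ A)
    (φ : psLRS d L ⟶ (Spec A).toLocallyRingedSpace) :
    IsConstHom (Spec.map ρ).toLRSHom φ ↔
      HS.IsConst (R := L.presheaf.obj (op ⊤)) d ρ.hom (specRing φ).hom := by
  rw [IsConstHom, ← specRing_injective.eq_iff, specRing_proj, ← Category.assoc (psLRSZero d L),
    specRing_specMap, specRing_specMap, specRing_zero]
  exact ⟨fun h c => congr(($h).hom c), fun h => CommRingCat.hom_ext (RingHom.ext h)⟩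

/-! ### The universal morphism in the affine case -/

section universal

variable {K : CommRingCat.{u}} (ρ : K ⟶ A)

/-- The universal morphism to an affine scheme. -/
def affineUniv : psLRS d (Spec (.of (HS d ρ.hom))).toLocallyRingedSpace ⟶
    (Spec A).toLocallyRingedSpace :=
  toSpec (L := psLRS d (Spec (.of (HS d ρ.hom))).toLocallyRingedSpace)
    (CommRingCat.ofHom (HS.univ d ρ.hom) ≫
      CommRingCat.ofHom (MvPowerSeries.map (Scheme.ΓSpecIso (.of (HS d ρ.hom))).inv.hom))

/-- Under the adjunction between global sections and Spec, precomposing with `psLRSMap d g` amounts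
to applying `g` to the coefficients of `HS.univ`. The universal property of `HS` thus becomes one
for morphisms of locally ringed spaces. -/
lemma specRing_map_affineUniv (g : L ⟶ (Spec (.of (HS d ρ.hom))).toLocallyRingedSpace) :
    specRing (psLRSMap d g ≫ affineUniv d ρ) = CommRingCat.ofHom
      ((MvPowerSeries.map (specRing g).hom).comp (HS.univ d ρ.hom)) := by
  rw [specRing_map, affineUniv, specRing_toSpec]
  ext a : 2
  exact congr($((MvPowerSeries.map_comp (Scheme.ΓSpecIso (.of (HS d ρ.hom))).inv.hom
    (g.c.app (op ⊤)).hom)) (HS.univ d ρ.hom a)).symm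

lemma isConstHom_affineUniv : IsConstHom (Spec.map ρ).toLRSHom (affineUniv d ρ) := by
  rw [isConstHom_iff, affineUniv, specRing_toSpec]
  exact HS.isConst_map_comp (HS.isConst_univ _) _

lemma affineUniv_injective {g g' : L ⟶ (Spec (.of (HS d ρ.hom))).toLocallyRingedSpace}
    (h : psLRSMap d g ≫ affineUniv d ρ = psLRSMap d g' ≫ affineUniv d ρ) : g = g' := by
  have h' := congr(specRing $h)
  rw [specRing_map_affineUniv, specRing_map_affineUniv] at h'
  exact specRing_injective (CommRingCat.hom_ext (HS.hom_ext congr(($h').hom)))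

lemma exists_affineUniv {φ : psLRS d L ⟶ (Spec A).toLocallyRingedSpace}
    (hφ : IsConstHom (Spec.map ρ).toLRSHom φ) :
    ∃ g : L ⟶ (Spec (.of (HS d ρ.hom))).toLocallyRingedSpace,
      psLRSMap d g ≫ affineUniv d ρ = φ := by
  rw [isConstHom_iff] at hφ
  refine ⟨toSpec (CommRingCat.ofHom (HS.lift _ hφ)), specRing_injective ?_⟩
  rw [specRing_map_affineUniv, specRing_toSpec]
  exact CommRingCat.hom_ext (HS.map_lift_univ _ hφ)

variable {A' : CommRingCat.{u}} (ρ' : K ⟶ A') (f : A ⟶ A') (hf : ρ ≫ f = ρ')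

/-- This is the compatibility that lets the universal morphisms over different affine opens of a
scheme be glued. -/
lemma map_affineUniv :
    psLRSMap d (Spec.map (CommRingCat.ofHom (HS.map (d := d) (ρ := ρ.hom) (ρ' := ρ'.hom) f.hom
      congr(($hf).hom)))).toLRSHom ≫ affineUniv d ρ = affineUniv d ρ' ≫ (Spec.map f).toLRSHom := by
  refine specRing_injective ?_
  rw [specRing_map_affineUniv, specRing_specMap, affineUniv, specRing_toSpec]
  refine CommRingCat.hom_ext ?_
  have h1 := HS.map_univ (d := d) (ρ := ρ.hom) (ρ' := ρ'.hom) f.hom congr(($hf).hom)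
  have h2 : specRing (Spec.map (CommRingCat.ofHom (HS.map (d := d) (ρ := ρ.hom) (ρ' := ρ'.hom) f.hom
      congr(($hf).hom)))).toLRSHom = CommRingCat.ofHom (HS.map (d := d) (ρ := ρ.hom)
      (ρ' := ρ'.hom) f.hom congr(($hf).hom)) ≫ (Scheme.ΓSpecIso (.of (HS d ρ'.hom))).inv :=
    (Scheme.ΓSpecIso_inv_naturality _).symm
  rw [h2, CommRingCat.hom_comp, MvPowerSeries.map_comp, RingHom.comp_assoc]
  exact congrArg (RingHom.comp (MvPowerSeries.map
    (Scheme.ΓSpecIso (CommRingCat.of (HS d ρ'.hom))).inv.hom)) h1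

end universal

end LRS


/-! ### The scheme `X ^ d` -/

section Arc

open LRS TopLRS Scheme.AffineZariskiSite

variable (d : ℕ) {X : Scheme.{u}} {K : CommRingCat.{u}} (σ : X ⟶ Spec K)

/-- The structure homomorphism on sections of a scheme over an affine scheme. -/
def baseHom (V : X.Opens) : K ⟶ Γ(X, V) :=
  (Scheme.ΓSpecIso K).inv ≫ σ.appTop ≫ X.presheaf.map (homOfLE le_top).op

lemma baseHom_map {V V' : X.Opens} (h : op V ⟶ op V') :
    baseHom σ V ≫ X.presheaf.map h = baseHom σ V' := by
  simp only [baseHom, Category.assoc, ← Functor.map_comp]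
  rfl

lemma fromSpec_comp {V : X.Opens} (hV : IsAffineOpen V) :
    hV.fromSpec ≫ σ = Spec.map (baseHom σ V) := by
  rw [baseHom, Spec.map_comp, Spec.map_comp, Category.assoc, ← hV.fromSpec_toSpecΓ_assoc,
    ← Scheme.toSpecΓ_naturality_assoc, toSpecΓ_SpecMap_ΓSpecIso_inv, Category.comp_id]

lemma baseHom_res {V V' : X.Opens} (h : V' ≤ V) :
    (X.presheaf.map (homOfLE h).op).hom.comp (baseHom σ V).hom = (baseHom σ V').hom :=
  congrArg CommRingCat.Hom.hom (baseHom_map σ (homOfLE h).op)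

/-- Restriction of Hasse–Schmidt algebras to smaller open subsets. -/
def hsRes {V V' : X.Opens} (h : V' ≤ V) :
    HS d (baseHom σ V).hom →+* HS d (baseHom σ V').hom :=
  HS.map (X.presheaf.map (homOfLE h).op).hom (baseHom_res σ h)

lemma hsRes_self (V : X.Opens) : hsRes d σ (le_refl V) = RingHom.id _ :=
  HS.map_eq_id _ (congrArg CommRingCat.Hom.hom (X.presheaf.map_id (op V)))

lemma hsRes_comp {V V' V'' : X.Opens} (h : V' ≤ V) (h' : V'' ≤ V') :
    hsRes d σ (h'.trans h) = (hsRes d σ h').comp (hsRes d σ h) :=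
  HS.map_eq_comp _ (baseHom_res σ h) _ (baseHom_res σ h') (baseHom_res σ (h'.trans h))
    (congrArg CommRingCat.Hom.hom (X.presheaf.map_comp (homOfLE h).op (homOfLE h').op))

/-- The Hasse–Schmidt algebras on affine open subsets. -/
def hsFunctor : X.AffineZariskiSiteᵒᵖ ⥤ CommRingCat.{u} where
  obj V := .of (HS d (baseHom σ V.unop.1).hom)
  map h := CommRingCat.ofHom (hsRes d σ (toOpens_mono h.unop.le))
  map_id V := CommRingCat.hom_ext (hsRes_self d σ V.unop.1)
  map_comp h h' := CommRingCat.hom_ext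
    (hsRes_comp d σ (toOpens_mono h.unop.le) (toOpens_mono h'.unop.le))

/-- The structure of the Hasse–Schmidt algebras as algebras over the structure sheaf. -/
def hsNat : (toOpensFunctor X).op ⋙ X.presheaf ⟶ hsFunctor d σ where
  app V := CommRingCat.ofHom (HS.const (d := d) (baseHom σ V.unop.1).hom)
  naturality _ _ h := CommRingCat.hom_ext (RingHom.ext fun a =>
    (HS.map_const (d := d) _ (baseHom_res σ (toOpens_mono h.unop.le)) a).symm)

/-- This is exactly what turns the localization property of `HS` into a relative gluing datum over
the affine opens of `X`. -/
lemma hsNat_coequifibered : (hsNat d σ).Coequifibered := by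
  refine coequifibered_iff_forall_isLocalizationAway.2 fun V r => ?_
  exact HS.isLocalization_map (d := d) _ (baseHom_res σ (X.basicOpen_le r)) r
    (V.2.isLocalization_basicOpen r)

/-- The gluing data for `X ^ d`. -/
def arcData : (directedCover X).RelativeGluingData :=
  relativeGluingData (hsNat_coequifibered d σ)

instance : ((arcData d σ).functor ⋙ Scheme.forget).IsLocallyDirected :=
  Scheme.Cover.RelativeGluingData.instIsLocallyDirectedI₀CompFunctorForgetOfIsThin ..

/-- The scheme `X ^ d`, glued from the spectra of the Hasse–Schmidt algebras. -/
def arc : Scheme.{u} := (arcData d σ).glued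

/-- The projection `X ^ d ⟶ X`. -/
def arcπ : arc d σ ⟶ X := (arcData d σ).toBase

/-- The canonical affine open subschemes of `X ^ d`. -/
def arcι (V : X.AffineZariskiSite) : Spec (.of (HS d (baseHom σ V.1).hom)) ⟶ arc d σ :=
  colimit.ι (arcData d σ).functor V

instance (V : X.AffineZariskiSite) : IsOpenImmersion (arcι d σ V) :=
  (arcData d σ).cover.map_prop V

lemma arcι_π (V : X.AffineZariskiSite) : arcι d σ V ≫ arcπ d σ =
    Spec.map (CommRingCat.ofHom (HS.const (d := d) (baseHom σ V.1).hom)) ≫ V.2.fromSpec := by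
  refine ((arcData d σ).ι_toBase V).trans ?_
  exact Category.assoc _ _ _

/-- The transition maps of the affine open subschemes of `X ^ d`. -/
abbrev arcMap {V V' : X.AffineZariskiSite} (h : V' ≤ V) :
    Spec (.of (HS d (baseHom σ V'.1).hom)) ⟶ Spec (.of (HS d (baseHom σ V.1).hom)) :=
  Spec.map (CommRingCat.ofHom (hsRes d σ (toOpens_mono h)))

lemma arcMap_ι {V V' : X.AffineZariskiSite} (h : V' ≤ V) :
    arcMap d σ h ≫ arcι d σ V = arcι d σ V' :=
  colimit.w (arcData d σ).functor (homOfLE h)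

instance {V V' : X.AffineZariskiSite} (h : V' ≤ V) : IsOpenImmersion (arcMap d σ h) :=
  inferInstanceAs (IsOpenImmersion
    ((arcData d σ).functor.map (homOfLE h)))

lemma arcι_jointly_surjective (x : arc d σ) : ∃ V y, arcι d σ V y = x :=
  (arcData d σ).cover.exists_eq x

lemma range_arcι (V : X.AffineZariskiSite) : (arcι d σ V).opensRange = arcπ d σ ⁻¹ᵁ V.1 := by
  have h1 : arcπ d σ ⁻¹ᵁ V.1.ι.opensRange = (arcι d σ V).opensRange :=
    (arcData d σ).toBase_preimage_eq_opensRange_ι V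
  rw [← h1]
  congr 1
  exact V.1.opensRange_ι

lemma arcι_compat {V V' : X.AffineZariskiSite} {x y} (h : arcι d σ V x = arcι d σ V' y) :
    ∃ (W : X.AffineZariskiSite) (h : W ≤ V) (h' : W ≤ V') (z : _), arcMap d σ h z = x ∧
      arcMap d σ h' z = y := by
  obtain ⟨W, f, g, z, hz⟩ := (arcData d σ).cover.exists_of_f_eq_f
    (i := V) (j := V') x y h
  have hle : ∀ {W V : X.AffineZariskiSite} (_ : W ⟶ V), W ≤ V := fun f => f.le
  exact ⟨W, hle (W := W) f, hle (W := W) g, z, hz⟩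

lemma arcι_lrs_compat {V V' : X.AffineZariskiSite} {x y} (h : arcι d σ V x = arcι d σ V' y) :
    ∃ (W : X.AffineZariskiSite) (h : W ≤ V) (h' : W ≤ V') (z : _), arcMap d σ h z = x ∧
      arcMap d σ h' z = y ∧ arcMap d σ h ≫ arcι d σ V = arcMap d σ h' ≫ arcι d σ V' := by
  obtain ⟨W, h, h', z, hz, hz'⟩ := arcι_compat d σ h
  exact ⟨W, h, h', z, hz, hz', (arcMap_ι d σ h).trans (arcMap_ι d σ h').symm⟩

/-- The universal morphism over the preimage of an affine open subset. -/
def arcLocalUniv (V : X.AffineZariskiSite) :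
    psLRS d (Spec (.of (HS d (baseHom σ V.1).hom))).toLocallyRingedSpace ⟶
      X.toLocallyRingedSpace :=
  affineUniv d (baseHom σ V.1) ≫ V.2.fromSpec.toLRSHom

lemma map_arcLocalUniv {V V' : X.AffineZariskiSite} (h : V' ≤ V) :
    psLRSMap d (arcMap d σ h).toLRSHom ≫ arcLocalUniv d σ V = arcLocalUniv d σ V' := by
  have h1 := map_affineUniv d (baseHom σ V.1) (baseHom σ V'.1)
    (X.presheaf.map (homOfLE (toOpens_mono h)).op) (baseHom_map σ _)
  have h2 := congr(Scheme.Hom.toLRSHom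
    $(V.2.map_fromSpec V'.2 (homOfLE (toOpens_mono h)).op))
  refine (Category.assoc _ _ _).symm.trans ?_
  refine (congrArg (· ≫ V.2.fromSpec.toLRSHom) h1).trans ((Category.assoc _ _ _).trans ?_)
  exact congrArg (affineUniv d (baseHom σ V'.1) ≫ ·) h2

lemma isConstHom_comp_iff {L Z : LocallyRingedSpace.{u}} {S T : LocallyRingedSpace.{u}}
    (σ : Z ⟶ S) (f : T ⟶ Z) (φ : psLRS d L ⟶ T) :
    IsConstHom σ (φ ≫ f) ↔ IsConstHom (f ≫ σ) φ := by
  rw [IsConstHom, IsConstHom, Category.assoc]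

lemma fromSpec_comp_toLRSHom (V : X.AffineZariskiSite) :
    V.2.fromSpec.toLRSHom ≫ σ.toLRSHom = (Spec.map (baseHom σ V.1)).toLRSHom :=
  congrArg Scheme.Hom.toLRSHom (fromSpec_comp σ V.2)

lemma isConstHom_arcLocalUniv (V : X.AffineZariskiSite) :
    IsConstHom σ.toLRSHom (arcLocalUniv d σ V) := by
  rw [arcLocalUniv, isConstHom_comp_iff, fromSpec_comp_toLRSHom]
  exact isConstHom_affineUniv d _

lemma zero_arcLocalUniv (V : X.AffineZariskiSite) : psLRSZero d _ ≫ arcLocalUniv d σ V =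
    (arcι d σ V ≫ arcπ d σ).toLRSHom := by
  have h1 : psLRSZero d _ ≫ affineUniv d (baseHom σ V.1) =
      (Spec.map (CommRingCat.ofHom (HS.const (d := d) (baseHom σ V.1).hom))).toLRSHom := by
    refine specRing_injective ?_
    rw [specRing_zero, affineUniv, specRing_toSpec]
    have h2 := Scheme.ΓSpecIso_inv_naturality
      (CommRingCat.ofHom (HS.const (d := d) (baseHom σ V.1).hom))
    refine Eq.trans ?_ h2
    ext a
    exact MvPowerSeries.constantCoeff_map (σ := Fin d) (Scheme.ΓSpecIso
      (.of (HS d (baseHom σ V.1).hom))).inv.hom (HS.univ d (baseHom σ V.1).hom a)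
  rw [arcι_π, arcLocalUniv, ← Category.assoc, h1]
  rfl

variable {L : LocallyRingedSpace.{u}}

lemma arcLocalUniv_injective (V : X.AffineZariskiSite)
    {g g' : L ⟶ (Spec (.of (HS d (baseHom σ V.1).hom))).toLocallyRingedSpace}
    (h : psLRSMap d g ≫ arcLocalUniv d σ V = psLRSMap d g' ≫ arcLocalUniv d σ V) : g = g' := by
  refine affineUniv_injective d (baseHom σ V.1) ((cancel_mono V.2.fromSpec.toLRSHom).1 ?_)
  rw [Category.assoc, Category.assoc]
  exact h

/-- Since `V` is open, it is enough that `φ` lands in `V` on points: it then factors through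
`V.2.fromSpec`, and the affine case applies. -/
lemma exists_arcLocalUniv (V : X.AffineZariskiSite) {φ : psLRS d L ⟶ X.toLocallyRingedSpace}
    (hφ : IsConstHom σ.toLRSHom φ) (hV : ∀ x, φ.base x ∈ V.1) :
    ∃ g : L ⟶ (Spec (.of (HS d (baseHom σ V.1).hom))).toLocallyRingedSpace,
      psLRSMap d g ≫ arcLocalUniv d σ V = φ := by
  have hr : Set.range φ.base ⊆ Set.range V.2.fromSpec.toLRSHom.base := by
    rintro _ ⟨x, rfl⟩
    have : Set.range V.2.fromSpec.toLRSHom.base = V.1 := V.2.range_fromSpec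
    rw [this]
    exact hV x
  let φ' := LocallyRingedSpace.IsOpenImmersion.lift V.2.fromSpec.toLRSHom φ hr
  have hφ' : φ' ≫ V.2.fromSpec.toLRSHom = φ := LocallyRingedSpace.IsOpenImmersion.lift_fac _ _ _
  have hc : IsConstHom (Spec.map (baseHom σ V.1)).toLRSHom φ' := by
    rw [← fromSpec_comp_toLRSHom, ← isConstHom_comp_iff, hφ']
    exact hφ
  obtain ⟨g, hg⟩ := exists_affineUniv d (baseHom σ V.1) hc
  refine ⟨g, ?_⟩
  rw [arcLocalUniv, ← hφ', ← hg, Category.assoc]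

lemma exists_arcUniv : ∃ θ : psLRS d (arc d σ).toLocallyRingedSpace ⟶ X.toLocallyRingedSpace,
    ∀ V, psLRSMap d (arcι d σ V).toLRSHom ≫ θ = arcLocalUniv d σ V := by
  refine exists_glue (fun V => psLRSMap d (arcι d σ V).toLRSHom)
    (arcι_jointly_surjective d σ) (arcLocalUniv d σ) ?_
  intro V V' x y hxy
  obtain ⟨W, h, h', z, hz, hz', hW⟩ := arcι_lrs_compat d σ hxy
  refine ⟨psLRS d (Spec (.of (HS d (baseHom σ W.1).hom))).toLocallyRingedSpace,
    psLRSMap d (arcMap d σ h).toLRSHom,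
    psLRSMap d (arcMap d σ h').toLRSHom, z, inferInstance, hz, hz', ?_, ?_⟩
  · rw [← psLRSMap_comp, ← psLRSMap_comp]
    exact congrArg (psLRSMap d) congr(Scheme.Hom.toLRSHom $hW)
  · rw [map_arcLocalUniv, map_arcLocalUniv]

/-- The universal morphism `θ : X ^ d [[t₁, …, t_d]] ⟶ X`. -/
def arcUniv : psLRS d (arc d σ).toLocallyRingedSpace ⟶ X.toLocallyRingedSpace :=
  (exists_arcUniv d σ).choose

lemma arcι_arcUniv (V : X.AffineZariskiSite) :
    psLRSMap d (arcι d σ V).toLRSHom ≫ arcUniv d σ = arcLocalUniv d σ V :=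
  (exists_arcUniv d σ).choose_spec V

lemma arc_hom_ext {M : LocallyRingedSpace.{u}} {f g : (arc d σ).toLocallyRingedSpace ⟶ M}
    (h : ∀ V, (arcι d σ V).toLRSHom ≫ f = (arcι d σ V).toLRSHom ≫ g) : f = g :=
  hom_ext_cover (fun V => (arcι d σ V).toLRSHom) (arcι_jointly_surjective d σ) h

/-- Setting t = 0 leaves the constant term `HS.const`, which is the map used for gluing. Hence the
θ₀ of the theorem is the projection `arcπ`, which is affine by construction. -/
lemma zero_arcUniv : psLRSZero d _ ≫ arcUniv d σ = (arcπ d σ).toLRSHom := by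
  refine arc_hom_ext d σ fun V => ?_
  rw [← Category.assoc, ← psLRSZero_map, Category.assoc, arcι_arcUniv, zero_arcLocalUniv]
  rfl

lemma isConstHom_arcUniv : IsConstHom σ.toLRSHom (arcUniv d σ) := by
  refine hom_ext_cover (fun V => psLRSMap d (arcι d σ V).toLRSHom)
    (arcι_jointly_surjective d σ) fun V => ?_
  have h := isConstHom_arcLocalUniv d σ V
  rw [IsConstHom, ← arcι_arcUniv] at h
  rw [reassoc_of% psLRSMap_proj, ← reassoc_of% psLRSZero_map, ← Category.assoc, h]
  simp only [Category.assoc, reassoc_of% psLRSZero_proj]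

/-- The preimage of an affine open subset under a morphism of locally ringed spaces. -/
def affinePreimage (f : L ⟶ X.toLocallyRingedSpace) (V : X.AffineZariskiSite) :
    LocallyRingedSpace.{u} :=
  L.restrict ((Opens.map f.base).obj V.1).isOpenEmbedding

/-- The inclusion of the preimage of an affine open subset. -/
def affinePreimageι (f : L ⟶ X.toLocallyRingedSpace) (V : X.AffineZariskiSite) :
    affinePreimage f V ⟶ L :=
  L.ofRestrict _

instance (f : L ⟶ X.toLocallyRingedSpace) (V : X.AffineZariskiSite) :
    LocallyRingedSpace.IsOpenImmersion (affinePreimageι f V) :=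
  inferInstanceAs (LocallyRingedSpace.IsOpenImmersion (L.ofRestrict _))

lemma affinePreimageι_mem (f : L ⟶ X.toLocallyRingedSpace) (V : X.AffineZariskiSite)
    (x : affinePreimage f V) : f.base ((affinePreimageι f V).base x) ∈ V.1 := x.2

lemma exists_affinePreimageι (f : L ⟶ X.toLocallyRingedSpace) (V : X.AffineZariskiSite)
    (x : L) (hx : f.base x ∈ V.1) : ∃ y, (affinePreimageι f V).base y = x := ⟨⟨x, hx⟩, rfl⟩

lemma affinePreimage_cover (f : L ⟶ X.toLocallyRingedSpace) (x : L) :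
    ∃ V y, (affinePreimageι f V).base y = x := by
  obtain ⟨V, hV, hxV, -⟩ := Opens.isBasis_iff_nbhd.1 X.isBasis_affineOpens (Opens.mem_top (f.base x))
  exact ⟨⟨V, hV⟩, exists_affinePreimageι f ⟨V, hV⟩ x hxV⟩

/-- Restricting the hypothesis to t = 0 shows that `g` and `g'` induce the same morphism to `X`.
Over the preimage of an affine open `V` both then factor through the chart `arcι d σ V`, where
uniqueness is the affine case. -/
lemma arcUniv_injective {g g' : L ⟶ (arc d σ).toLocallyRingedSpace}
    (h : psLRSMap d g ≫ arcUniv d σ = psLRSMap d g' ≫ arcUniv d σ) : g = g' := by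
  have h0 : g ≫ (arcπ d σ).toLRSHom = g' ≫ (arcπ d σ).toLRSHom := by
    rw [← zero_arcUniv, ← Category.assoc, ← psLRSZero_map, Category.assoc, h, ← Category.assoc,
      psLRSZero_map, Category.assoc]
  refine hom_ext_cover (affinePreimageι (g ≫ (arcπ d σ).toLRSHom))
    (affinePreimage_cover _) fun V => ?_
  have key : ∀ k : L ⟶ (arc d σ).toLocallyRingedSpace, k ≫ (arcπ d σ).toLRSHom =
      g ≫ (arcπ d σ).toLRSHom → ∃ l, l ≫ (arcι d σ V).toLRSHom =
        affinePreimageι (g ≫ (arcπ d σ).toLRSHom) V ≫ k := by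
    intro k hk
    refine ⟨LocallyRingedSpace.IsOpenImmersion.lift (arcι d σ V).toLRSHom _ ?_,
      LocallyRingedSpace.IsOpenImmersion.lift_fac _ _ _⟩
    rintro _ ⟨x, rfl⟩
    have h1 : Set.range (arcι d σ V).toLRSHom.base = (arcπ d σ ⁻¹ᵁ V.1 : Set _) :=
      congrArg SetLike.coe (range_arcι d σ V)
    rw [h1]
    have h2 := affinePreimageι_mem (g ≫ (arcπ d σ).toLRSHom) V x
    have h3 := congr(($hk).base ((affinePreimageι (g ≫ (arcπ d σ).toLRSHom) V).base x))
    rw [← h3] at h2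
    exact h2
  obtain ⟨l, hl⟩ := key g rfl
  obtain ⟨l', hl'⟩ := key g' h0.symm
  rw [← hl, ← hl']
  congr 1
  refine arcLocalUniv_injective d σ V ?_
  rw [← arcι_arcUniv, ← Category.assoc, ← Category.assoc, ← psLRSMap_comp, ← psLRSMap_comp, hl, hl',
    psLRSMap_comp, psLRSMap_comp, Category.assoc, Category.assoc, h]

/-- The affine case gives morphisms to the charts locally on `L`, and uniqueness in the affine case
makes them agree on overlaps. -/
lemma exists_arcUniv_eq {φ : psLRS d L ⟶ X.toLocallyRingedSpace}
    (hφ : IsConstHom σ.toLRSHom φ) :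
    ∃ g : L ⟶ (arc d σ).toLocallyRingedSpace, psLRSMap d g ≫ arcUniv d σ = φ := by
  let f := psLRSZero d L ≫ φ
  choose g hg using fun V => exists_arcLocalUniv d σ V
    (φ := psLRSMap d (affinePreimageι f V) ≫ φ) (hφ.map _) (affinePreimageι_mem f V)
  obtain ⟨G, hG⟩ := exists_glue (affinePreimageι f) (affinePreimage_cover f)
    (fun V => g V ≫ (arcι d σ V).toLRSHom) (by
      intro V V' x y hxy
      obtain ⟨a, b, hab, hfa⟩ := exists_basicOpen_le_affine_inter V.2 V'.2
        (f.base ((affinePreimageι f V).base x)) ⟨affinePreimageι_mem f V x, by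
          rw [hxy]; exact affinePreimageι_mem f V' y⟩
      -- The order of `AffineZariskiSite` is inclusion as a basic open subset, so `W` has to be
      -- basic open in `V` and in `V'` at once.
      let W := V.basicOpen a
      have hWV : W ≤ V := V.basicOpen_le a
      have hWV' : W ≤ V' := ⟨b, hab.symm⟩
      obtain ⟨z, hz⟩ := exists_affinePreimageι f W _ hfa
      have key : ∀ V' : X.AffineZariskiSite, W ≤ V' → ∃ l, l ≫ affinePreimageι f V' =
          affinePreimageι f W := by
        intro V' hV'
        refine ⟨LocallyRingedSpace.IsOpenImmersion.lift (affinePreimageι f V') _ ?_,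
          LocallyRingedSpace.IsOpenImmersion.lift_fac _ _ _⟩
        rintro _ ⟨x, rfl⟩
        exact exists_affinePreimageι f V' _ (toOpens_mono hV' (affinePreimageι_mem f W x))
      have key2 : ∀ (V' : X.AffineZariskiSite) (h : W ≤ V') (l : _), l ≫ affinePreimageι f V' =
          affinePreimageι f W → l ≫ g V' = g W ≫ (arcMap d σ h).toLRSHom := by
        intro V' h l hl
        refine arcLocalUniv_injective d σ V' ?_
        rw [psLRSMap_comp, psLRSMap_comp, Category.assoc, Category.assoc, map_arcLocalUniv, hg, hg,
          ← Category.assoc, ← psLRSMap_comp, hl]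
      obtain ⟨l, hl⟩ := key V hWV
      obtain ⟨l', hl'⟩ := key V' hWV'
      have hinj : ∀ V' : X.AffineZariskiSite, Function.Injective (affinePreimageι f V').base :=
        fun V' => (PresheafedSpace.IsOpenImmersion.base_open
          (f := (affinePreimageι f V').toHom)).injective
      have hlo : LocallyRingedSpace.IsOpenImmersion (l ≫ affinePreimageι f V) :=
        hl ▸ inferInstance
      refine ⟨_, l, l', z, hlo, hinj V ?_, hinj V' ?_, hl.trans hl'.symm, ?_⟩
      · exact (congr(($hl).base z)).trans hz
      · exact (congr(($hl').base z)).trans (hz.trans hxy)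
      · rw [← Category.assoc, ← Category.assoc, key2 V hWV l hl, key2 V' hWV' l' hl',
          Category.assoc, Category.assoc]
        exact congrArg (g W ≫ ·) (congrArg Scheme.Hom.toLRSHom
          ((arcMap_ι d σ hWV).trans (arcMap_ι d σ hWV').symm)))
  refine ⟨G, hom_ext_cover (fun V => psLRSMap d (affinePreimageι f V)) (affinePreimage_cover f)
    fun V => ?_⟩
  rw [← Category.assoc, ← psLRSMap_comp, hG, psLRSMap_comp, Category.assoc, arcι_arcUniv, hg]

instance : IsAffineHom (arcπ d σ) := by
  refine isAffineHom_of_forall_exists_isAffineOpen _ fun x => ?_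
  obtain ⟨V, hV, hxV, -⟩ := Opens.isBasis_iff_nbhd.1 X.isBasis_affineOpens (Opens.mem_top x)
  refine ⟨V, hxV, hV, ?_⟩
  let V' : X.AffineZariskiSite := ⟨V, hV⟩
  have h := isAffineOpen_opensRange (arcι d σ V')
  rwa [range_arcι] at h

end Arc


/-! ### The functor represented by `X ^ d` -/

section Representability

open LRS TopLRS

/-- A structure morphism `τ` on `L` is recovered from `φ ≫ σ` by restriction to the zero section, so
being a morphism over the base reduces to constancy. This is why `HS` makes no reference to `τ`. -/
lemma isConstHom_of_comp {d : ℕ} {L M S : LocallyRingedSpace.{u}} {σ : M ⟶ S}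
    {φ : psLRS d L ⟶ M} {τ : L ⟶ S} (h : φ ≫ σ = psLRSProj d L ≫ τ) : IsConstHom σ φ := by
  rw [IsConstHom, h, reassoc_of% psLRSZero_proj]

lemma map_arcUniv_comp (d : ℕ) {X : Scheme.{u}} {K : CommRingCat.{u}} (σ : X ⟶ Spec K)
    {L : LocallyRingedSpace.{u}} {f : L ⟶ (arc d σ).toLocallyRingedSpace}
    {τ : L ⟶ (Spec K).toLocallyRingedSpace}
    (h : f ≫ (arcπ d σ).toLRSHom ≫ σ.toLRSHom = τ) :
    (psLRSMap d f ≫ arcUniv d σ) ≫ σ.toLRSHom = psLRSProj d L ≫ τ := by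
  have h2 := isConstHom_arcUniv d σ
  rw [IsConstHom, ← Category.assoc (psLRSZero d _), zero_arcUniv] at h2
  rw [Category.assoc, h2, reassoc_of% psLRSMap_proj, ← h]

lemma exists_arcUniv_eq_of_comp (d : ℕ) {X : Scheme.{u}} {K : CommRingCat.{u}} (σ : X ⟶ Spec K)
    {L : LocallyRingedSpace.{u}} {φ : psLRS d L ⟶ X.toLocallyRingedSpace}
    {τ : L ⟶ (Spec K).toLocallyRingedSpace} (h : φ ≫ σ.toLRSHom = psLRSProj d L ≫ τ) :
    ∃ g : L ⟶ (arc d σ).toLocallyRingedSpace, psLRSMap d g ≫ arcUniv d σ = φ ∧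
      g ≫ (arcπ d σ).toLRSHom ≫ σ.toLRSHom = τ := by
  obtain ⟨g, hg⟩ := exists_arcUniv_eq d σ (isConstHom_of_comp h)
  refine ⟨g, hg, ?_⟩
  rw [← zero_arcUniv, Category.assoc, ← reassoc_of% psLRSZero_map, reassoc_of% hg, h,
    reassoc_of% psLRSZero_proj]

lemma zero_map_arcUniv (d : ℕ) {X : Scheme.{u}} {K : CommRingCat.{u}} (σ : X ⟶ Spec K)
    {L : LocallyRingedSpace.{u}} (f : L ⟶ (arc d σ).toLocallyRingedSpace) :
    psLRSZero d L ≫ psLRSMap d f ≫ arcUniv d σ = f ≫ (arcπ d σ).toLRSHom := by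
  rw [reassoc_of% psLRSZero_map, zero_arcUniv]

variable {k : Type u} [Field k] (d : ℕ) (X : Over (Spec (.of k)))

/-- `X ^ d` as a scheme over `k`. -/
def arcOver : Over (Spec (.of k)) := Over.mk (arcπ d X.hom ≫ X.hom)

/-- The morphism `T[[t₁, …, t_d]] ⟶ X` corresponding to a morphism from `T` to `X ^ d`. -/
def arcPoint {T : Over (ofScheme (Spec (.of k)))} (f : T ⟶ schemeOver.obj (arcOver d X)) :
    (powerSeriesOver d).obj T ⟶ schemeOver.obj X :=
  Over.homMk (homMk (isPseudoDiscrete_ofScheme X.left)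
    (psLRSMap d f.left.toLRSHom ≫ arcUniv d X.hom)) <| by
    refine hom_ext ?_
    exact map_arcUniv_comp d X.hom (congrArg TopLRS.Hom.toLRSHom (Over.w f))

lemma arcPoint_comp {T T' : Over (ofScheme (Spec (.of k)))} (g : T' ⟶ T)
    (f : T ⟶ schemeOver.obj (arcOver d X)) :
    arcPoint d X (g ≫ f) = (powerSeriesOver d).map g ≫ arcPoint d X f := by
  refine Over.OverMorphism.ext (hom_ext ?_)
  refine (congrArg (· ≫ arcUniv d X.hom)
    (psLRSMap_comp d g.left.toLRSHom f.left.toLRSHom)).trans ?_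
  exact Category.assoc _ _ _

/-- Both targets are schemes, hence pseudo-discrete, so continuity adds no condition and the
statement is the universal property for locally ringed spaces. It holds for all `T`, in particular
for finite adic formal schemes. -/
lemma arcPoint_bijective (T : Over (ofScheme (Spec (.of k)))) :
    Function.Bijective (arcPoint d X (T := T)) := by
  refine ⟨fun f g h => ?_, fun φ => ?_⟩
  · refine Over.OverMorphism.ext (hom_ext (arcUniv_injective d X.hom ?_))
    exact congr(($h).left.toLRSHom)
  · obtain ⟨g, hg, hg'⟩ := exists_arcUniv_eq_of_comp d X.hom
      (congrArg TopLRS.Hom.toLRSHom (Over.w φ))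
    exact ⟨Over.homMk (homMk (isPseudoDiscrete_ofScheme _) g) (hom_ext hg'),
      Over.OverMorphism.ext (hom_ext hg)⟩

/-- `X ^ d` represents the functor `Y ↦ Hom_k(Y[[t₁, …, t_d]], X)`. -/
def arcRepresentableBy : (Phi d X).RepresentableBy (schToFSch.obj (arcOver d X)) where
  homEquiv {T} := (ObjectProperty.fullyFaithfulι _).homEquiv.trans
    (Equiv.ofBijective _ (arcPoint_bijective d X T.obj))
  homEquiv_comp f g := arcPoint_comp d X f.hom g.hom

lemma phiZero_arcPoint {Y : Over (Spec (.of k))} (f : Y ⟶ arcOver d X) :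
    (phiZero (arcPoint d X (schemeOver.map f))).left = f.left ≫ arcπ d X.hom := by
  exact schemeFunctorFullyFaithful.map_injective
    (hom_ext (zero_map_arcUniv d X.hom f.left.toLRSHom))

end Representability

/-! ### Colimits of sequences of locally ringed spaces with the same underlying space -/

section Recognition

open LRS TopLRS

/-- A cocone on a sequence of locally ringed spaces is a colimit if all the maps are
homeomorphisms and the sections are the inverse limits. -/
lemma isColimit_of_sections {Z : ℕ ⥤ LocallyRingedSpace.{u}} (c : Cocone Z)
    (hc : ∀ n, IsHomeomorph (c.ι.app n).base)
    (hinj : ∀ (U : Opens c.pt.toTopCat) (s t : c.pt.presheaf.obj (op U)),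
      (∀ n, appLE (c.ι.app n) U _ le_rfl s = appLE (c.ι.app n) U _ le_rfl t) → s = t)
    (hsurj : ∀ (U : Opens c.pt.toTopCat)
      (z : ∀ n, (Z.obj n).presheaf.obj (op ((Opens.map (c.ι.app n).base).obj U))),
      (∀ (m n : ℕ) (h : m ⟶ n) e, appLE (Z.map h) _ _ e (z n) = z m) →
      ∃ s : c.pt.presheaf.obj (op U), ∀ n, appLE (c.ι.app n) U _ le_rfl s = z n) : Nonempty (IsColimit c) := by
  have hj : ∀ x : c.pt, ∃ n y, (c.ι.app n).base y = x := fun x =>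
    ⟨0, (hc 0).surjective x⟩
  have key : ∀ s : Cocone Z, ∃ g : c.pt ⟶ s.pt, ∀ n, c.ι.app n ≫ g = s.ι.app n := by
    intro s
    -- On points the whole cocone is governed by its term `0`, so the underlying map to `s.pt` is
    -- that of `s.ι.app 0` transported along `e`.
    let e := (hc 0).homeomorph
    have hF : ∀ n y, (s.ι.app 0).base (e.symm ((c.ι.app n).base y)) = (s.ι.app n).base y := by
      intro n y
      have hw : ∀ x, (c.ι.app n).base ((Z.map (homOfLE (Nat.zero_le n))).base x) = e x :=
        fun x => congr(($(c.w (homOfLE (Nat.zero_le n)))).base x)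
      obtain ⟨x, hx⟩ := e.surjective ((c.ι.app n).base y)
      have hy : y = (Z.map (homOfLE (Nat.zero_le n))).base x :=
        (hc n).injective (hx.symm.trans (hw x).symm)
      rw [hy, hw, e.symm_apply_apply]
      exact (congr(($(s.w (homOfLE (Nat.zero_le n)))).base x)).symm
    refine exists_hom_of_local (fun n => c.ι.app n) hj hinj
      (fun x => (s.ι.app 0).base (e.symm x))
      ((s.ι.app 0).base.hom.continuous.comp e.symm.continuous) (fun n => s.ι.app n) hF ?_
    intro U V hV t
    have hVU : ∀ n, (Opens.map (c.ι.app n).base).obj V ≤ (Opens.map (s.ι.app n).base).obj U := by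
      intro n y hy
      change (s.ι.app n).base y ∈ U
      rw [← hF]
      exact (hV _).1 hy
    obtain ⟨τ, hτ⟩ := hsurj V (fun n => appLE (s.ι.app n) U _ (hVU n) t) (by
      intro m n h e
      have h1 := comp_appLE (Z.map h) (s.ι.app n) (hVU n) e
      refine (congr(($h1).hom t)).trans ?_
      exact congr(($(appLE_congr (s.w h) _)).hom t))
    refine ⟨τ, fun n W e e' => ?_⟩
    have h1 := appLE_map (c.ι.app n) le_rfl e
    have h2 := appLE_map (s.ι.app n) (hVU n) e
    refine (congr(($h1).hom τ)).symm.trans (Eq.trans ?_ congr(($h2).hom t))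
    exact congrArg ((Z.obj n).presheaf.map (homOfLE e).op) (hτ n)
  choose g hg using key
  refine ⟨{ desc := g, fac := hg, uniq := fun s m hm => ?_ }⟩
  refine hom_ext_appLE (fun x => ?_) fun U V e e' => ?_
  · obtain ⟨n, y, rfl⟩ := hj x
    exact (congr(($(hm n)).base y)).trans (congr(($(hg s n)).base y)).symm
  · ext t
    refine hinj _ _ _ fun n => ?_
    have h1 := (comp_appLE (c.ι.app n) m e le_rfl).trans
      ((appLE_congr ((hm n).trans (hg s n).symm) _).trans
        (comp_appLE (c.ι.app n) (g s) e' le_rfl).symm)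
    exact congr(($h1).hom t)

end Recognition

/-! ### Power series over a scheme as an inductive limit of schemes -/

section PowerSeriesColimit

open LRS TopLRS

variable {d : ℕ} {Y : Scheme.{u}} {Z : ℕ ⥤ Scheme.{u}}
  (ε : ∀ n, (Z.obj n).toLocallyRingedSpace ⟶ psLRS d Y.toLocallyRingedSpace)

/-- The morphisms `ε n` identify `Z n` with the subspace of `Y[[t₁, …, t_d]]` defined by the
series of order `> n`. -/
structure IsTruncation : Prop where
  w : ∀ {m n : ℕ} (h : m ⟶ n), (Z.map h).toLRSHom ≫ ε n = ε m
  isHomeomorph : ∀ n, IsHomeomorph (ε n).base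
  surjective : ∀ n (W : Y.Opens), IsAffineOpen W →
    Function.Surjective (appLE (ε n) W _ le_rfl)
  eq_zero_iff : ∀ n (W : Y.Opens), IsAffineOpen W → ∀ s : MvPowerSeries (Fin d) Γ(Y, W),
    appLE (ε n) W _ le_rfl s = 0 ↔ ∀ α : Fin d →₀ ℕ, α.degree ≤ n → s α = 0

namespace IsTruncation

variable {ε}

lemma eq_iff (hε : IsTruncation ε) (n : ℕ) {W : Y.Opens} (hW : IsAffineOpen W)
    (s t : MvPowerSeries (Fin d) Γ(Y, W)) :
    appLE (ε n) W _ le_rfl s = appLE (ε n) W _ le_rfl t ↔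
      ∀ α : Fin d →₀ ℕ, α.degree ≤ n → s α = t α := by
  have h := hε.eq_zero_iff n W hW (s - t)
  have h1 : appLE (ε n) W _ le_rfl (s - t) = appLE (ε n) W _ le_rfl s -
    appLE (ε n) W _ le_rfl t := map_sub (appLE (ε n) W _ le_rfl).hom s t
  rw [h1, sub_eq_zero] at h
  rw [h]
  exact forall₂_congr fun α _ => sub_eq_zero


/-- The coefficient at `α` can be read off from the truncation of order `α.degree`, locally on
affine opens. -/
lemma eq_of_forall (hε : IsTruncation ε) (U : Y.Opens) (s t : MvPowerSeries (Fin d) Γ(Y, U))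
    (h : ∀ n, appLE (ε n) U _ le_rfl s = appLE (ε n) U _ le_rfl t) : s = t := by
  refine MvPowerSeries.ext fun α => Y.IsSheaf.section_ext fun x hx => ?_
  obtain ⟨W, hW, hxW, hWU⟩ := Opens.isBasis_iff_nbhd.1 Y.isBasis_affineOpens hx
  refine ⟨W, hWU, hxW, ?_⟩
  have h1 := (hε.eq_iff α.degree hW (MvPowerSeries.map (Y.presheaf.map (homOfLE hWU).op).hom s)
    (MvPowerSeries.map (Y.presheaf.map (homOfLE hWU).op).hom t)).1 (by
      have h2 := map_appLE (ε α.degree) (le_refl ((Opens.map (ε α.degree).base).obj W)) hWU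
      have h3 := appLE_map (ε α.degree) (le_refl ((Opens.map (ε α.degree).base).obj U))
        ((Opens.map (ε α.degree).base).map (homOfLE hWU)).le
      have h4 := h2.trans h3.symm
      refine (congr(($h4).hom s)).trans (Eq.trans ?_ congr(($h4).hom t).symm)
      exact congrArg ((Z.obj α.degree).presheaf.map _) (h α.degree)) α le_rfl
  exact h1

lemma exists_of_isAffineOpen (hε : IsTruncation ε) {W : Y.Opens} (hW : IsAffineOpen W)
    (z : ∀ n, (Z.obj n).presheaf.obj (op ((Opens.map (ε n).base).obj W)))
    (hz : ∀ (m n : ℕ) (h : m ⟶ n) e, appLE (Z.map h).toLRSHom _ _ e (z n) = z m) :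
    ∃ s : MvPowerSeries (Fin d) Γ(Y, W), ∀ n, appLE (ε n) W _ le_rfl s = z n := by
  choose s hs using fun n => hε.surjective n W hW (z n)
  have key : ∀ (m n : ℕ) (h : m ⟶ n), appLE (ε m) W _ le_rfl (s n) = z m := by
    intro m n h
    have e : (Opens.map (ε m).base).obj W ≤
        (Opens.map (Z.map h).toLRSHom.base).obj ((Opens.map (ε n).base).obj W) := by
      rw [← hε.w h]; exact le_rfl
    have h1 := comp_appLE (Z.map h).toLRSHom (ε n) (le_refl ((Opens.map (ε n).base).obj W)) e
    have h2 := h1.trans (appLE_congr (hε.w h) _)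
    refine (congr(($h2).hom (s n))).symm.trans ?_
    rw [← hz m n h e, ← hs n]
    rfl
  -- Diagonal choice: the coefficient at `α` is taken from the lift of the truncation of order
  -- `α.degree`, the first one that sees it.
  refine ⟨fun α => s α.degree α, fun n => ((hε.eq_iff n hW _ _).2 fun α hα => ?_).trans (hs n)⟩
  exact (hε.eq_iff α.degree hW _ _).1 ((hs _).trans (key _ n (homOfLE hα)).symm) α le_rfl

/-- The series found on affine opens are glued; their agreement on intersections, which need not be
affine, comes from `eq_of_forall`. -/
lemma exists_of_compatible (hε : IsTruncation ε) (U : Y.Opens)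
    (z : ∀ n, (Z.obj n).presheaf.obj (op ((Opens.map (ε n).base).obj U)))
    (hz : ∀ (m n : ℕ) (h : m ⟶ n) e, appLE (Z.map h).toLRSHom _ _ e (z n) = z m) :
    ∃ s : MvPowerSeries (Fin d) Γ(Y, U), ∀ n, appLE (ε n) U _ le_rfl s = z n := by
  let ι := {W : Y.Opens // IsAffineOpen W ∧ W ≤ U}
  let ρ : ∀ (n : ℕ) (W : Y.Opens) (h : W ≤ U), (Opens.map (ε n).base).obj W ≤
    (Opens.map (ε n).base).obj U := fun n W h => ((Opens.map (ε n).base).map (homOfLE h)).le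
  have hloc : ∀ W : ι, ∃ s : MvPowerSeries (Fin d) Γ(Y, W.1),
      ∀ n, appLE (ε n) W.1 _ le_rfl s = (Z.obj n).presheaf.map (homOfLE (ρ n W.1 W.2.2)).op (z n) := by
    intro W
    refine hε.exists_of_isAffineOpen W.2.1 _ fun m n h e => ?_
    have e' : (Opens.map (ε m).base).obj U ≤
        (Opens.map (Z.map h).toLRSHom.base).obj ((Opens.map (ε n).base).obj U) := by
      rw [← hε.w h]; exact le_rfl
    have h1 := map_appLE (Z.map h).toLRSHom e (ρ n W.1 W.2.2)
    have h2 := appLE_map (Z.map h).toLRSHom e' (ρ m W.1 W.2.2)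
    refine (congr(($(h1.trans h2.symm)).hom (z n))).trans ?_
    exact congrArg ((Z.obj m).presheaf.map (homOfLE (ρ m W.1 W.2.2)).op) (hz m n h e')
  choose s hs using hloc
  let L := psLRS d Y.toLocallyRingedSpace
  have hres : ∀ (n : ℕ) (W : ι) (V : Y.Opens) (h : V ≤ W.1),
      appLE (ε n) V _ le_rfl (L.presheaf.map (homOfLE h).op (s W)) =
        (Z.obj n).presheaf.map (homOfLE (ρ n V (h.trans W.2.2))).op (z n) := by
    intro n W V h
    have h1 := map_appLE (ε n) (le_refl ((Opens.map (ε n).base).obj V)) h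
    have h2 := appLE_map (ε n) (le_refl ((Opens.map (ε n).base).obj W.1))
      ((Opens.map (ε n).base).map (homOfLE h)).le
    refine (congr(($(h1.trans h2.symm)).hom (s W))).trans ?_
    refine (congrArg ((Z.obj n).presheaf.map
      (homOfLE ((Opens.map (ε n).base).map (homOfLE h)).le).op) (hs W n)).trans ?_
    have h3 := (Z.obj n).presheaf.map_comp (homOfLE (ρ n W.1 W.2.2)).op
      (homOfLE ((Opens.map (ε n).base).map (homOfLE h)).le).op
    exact (congr(($h3).hom (z n))).symm
  obtain ⟨τ, hτ, -⟩ := L.sheaf.existsUnique_gluing' (fun W : ι => W.1) U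
    (fun W => homOfLE W.2.2) (by
      intro x hx
      obtain ⟨W, hW, hxW, hWU⟩ := Opens.isBasis_iff_nbhd.1 Y.isBasis_affineOpens hx
      exact Opens.mem_iSup.2 ⟨⟨W, hW, hWU⟩, hxW⟩) s (by
    intro W W'
    refine hε.eq_of_forall (W.1 ⊓ W'.1) _ _ fun n => ?_
    exact (hres n W _ inf_le_left).trans (hres n W' _ inf_le_right).symm)
  refine ⟨τ, fun n => (Z.obj n).IsSheaf.section_ext fun y hy => ?_⟩
  obtain ⟨W, hW, hxW, hWU⟩ := Opens.isBasis_iff_nbhd.1 Y.isBasis_affineOpens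
    (show (ε n).base y ∈ U from hy)
  refine ⟨(Opens.map (ε n).base).obj W, ρ n W hWU, hxW, ?_⟩
  refine Eq.trans ?_ (hs ⟨W, hW, hWU⟩ n)
  rw [← hτ ⟨W, hW, hWU⟩]
  have h1 := map_appLE (ε n) (le_refl ((Opens.map (ε n).base).obj W)) hWU
  have h2 := appLE_map (ε n) (le_refl ((Opens.map (ε n).base).obj U)) (ρ n W hWU)
  exact congr(($(h2.trans h1.symm)).hom τ)

/-- The cocone given by a system of truncations. -/
def cocone (hε : IsTruncation ε) : Cocone (Z ⋙ Scheme.forgetToLocallyRingedSpace) where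
  pt := psLRS d Y.toLocallyRingedSpace
  ι :=
    { app := ε
      naturality := fun _ _ h => (hε.w h).trans (Category.comp_id _).symm }

lemma isColimit (hε : IsTruncation ε) : Nonempty (IsColimit hε.cocone) :=
  isColimit_of_sections hε.cocone hε.isHomeomorph hε.eq_of_forall hε.exists_of_compatible

lemma sectionTop_of_isAffineOpen {W : Y.Opens} (hW : IsAffineOpen W) :
    (ofScheme Y).sectionTop W = ⊥ := by
  refine eq_bot_iff.2 ?_
  refine (show probeTop Y.toLocallyRingedSpace (fun _ : PUnit.{1} => Y) (fun _ => 𝟙 _) W ≤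
    TopologicalSpace.induced (probe Y.toLocallyRingedSpace (fun _ : PUnit.{1} => Y)
      (fun _ => 𝟙 _) ⟨⟩ W W le_rfl) ⊥ from iInf_le_of_le ⟨⟩ (iInf_le_of_le W
      (iInf_le_of_le (IsAffineOpen.isCompact hW) (iInf_le _ le_rfl)))).trans ?_
  intro A _
  refine ⟨A, trivial, ?_⟩
  ext s
  change Y.presheaf.map (𝟙 _) s ∈ A ↔ _
  simp

lemma powerSeries_sectionTop (W : Y.Opens) (hW : IsAffineOpen W) :
    (powerSeries d (ofScheme Y)).sectionTop W =
      ⨅ α : Fin d →₀ ℕ, (⊥ : TopologicalSpace Γ(Y, W)).induced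
        (fun s : MvPowerSeries (Fin d) Γ(Y, W) => s α) :=
  congrArg (fun t : TopologicalSpace Γ(Y, W) => ⨅ α : Fin d →₀ ℕ, t.induced
    (fun s : MvPowerSeries (Fin d) Γ(Y, W) => s α)) (sectionTop_of_isAffineOpen hW)

/-- Over an affine open the coefficients are discrete, and convergence of each coefficient is the
same as convergence of each truncation. -/
lemma sectionTop_affine (hε : IsTruncation ε) (W : Y.Opens) (hW : IsAffineOpen W) :
    (powerSeries d (ofScheme Y)).sectionTop W =
      probeTop (psLRS d Y.toLocallyRingedSpace) Z.obj ε W := by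
  rw [powerSeries_sectionTop W hW]
  apply le_antisymm
  · refine le_iInf fun n => le_iInf fun V => le_iInf fun hc => le_iInf fun h => ?_
    rintro _ ⟨A, -, rfl⟩
    refine (@isOpen_iff_forall_mem_open _ (⨅ α : Fin d →₀ ℕ,
      (⊥ : TopologicalSpace Γ(Y, W)).induced
        (fun s : MvPowerSeries (Fin d) Γ(Y, W) => s α)) _).2 fun s hs => ?_
    -- Only finitely many `α` have degree at most `n`, and their coefficients determine the `n`-th
    -- truncation, so this open set lies in a fibre of the probe.
    refine ⟨⋂ α ∈ {α : Fin d →₀ ℕ | α.degree ≤ n},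
      {s' : MvPowerSeries (Fin d) Γ(Y, W) | s' α = s α}, ?_, ?_, ?_⟩
    · intro s' hs'
      have h1 := (hε.eq_iff n hW s' s).2 fun α hα => Set.mem_iInter₂.1 hs' α hα
      have h2 := appLE_map (ε n) (le_refl ((Opens.map (ε n).base).obj W)) h
      have h3 : probe (psLRS d Y.toLocallyRingedSpace) Z.obj ε n W V h s' =
          probe (psLRS d Y.toLocallyRingedSpace) Z.obj ε n W V h s :=
        (congr(($h2).hom s')).symm.trans ((congrArg ((Z.obj n).presheaf.map (homOfLE h).op) h1).trans
          congr(($h2).hom s))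
      exact Set.mem_preimage.2 (h3 ▸ hs)
    · refine @Set.Finite.isOpen_biInter _ _ (_) _ _ (Finsupp.finite_of_degree_le n) fun α _ => ?_
      exact iInf_le (fun α : Fin d →₀ ℕ => (⊥ : TopologicalSpace Γ(Y, W)).induced
        (fun s : MvPowerSeries (Fin d) Γ(Y, W) => s α)) α _ ⟨{s α}, trivial, rfl⟩
    · exact Set.mem_iInter₂.2 fun _ _ => rfl
  · refine le_iInf fun α => ?_
    rintro _ ⟨A, -, rfl⟩
    let p := probe (psLRS d Y.toLocallyRingedSpace) Z.obj ε α.degree W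
      ((Opens.map (ε α.degree).base).obj W) le_rfl
    -- The coefficient at `α` factors through the truncation of order `α.degree`, so the set is a
    -- union of fibres of `p`, hence open.
    have hset : (fun s : MvPowerSeries (Fin d) Γ(Y, W) => s α) ⁻¹' A =
        p ⁻¹' (p '' ((fun s : MvPowerSeries (Fin d) Γ(Y, W) => s α) ⁻¹' A)) := by
      refine le_antisymm (Set.subset_preimage_image _ _) ?_
      rintro s ⟨s', hs', h⟩
      have := (hε.eq_iff α.degree hW s' s).1 h α le_rfl
      change s α ∈ A
      rw [← this]
      exact hs'
    rw [hset]
    refine isOpen_probe_fiber _ Z.obj ε α.degree W _ ?_ le_rfl _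
    exact (hε.isHomeomorph α.degree).homeomorph.isCompact_preimage.2 hW.isCompact

/-- Both topologies are determined by an open cover, so the affine case suffices. -/
lemma sectionTop_eq (hε : IsTruncation ε) (U : Y.Opens) :
    (powerSeries d (ofScheme Y)).sectionTop U =
      probeTop (psLRS d Y.toLocallyRingedSpace) Z.obj ε U := by
  let ι := {W : Y.Opens // IsAffineOpen W ∧ W ≤ U}
  have hU : U ≤ ⨆ W : ι, W.1 := by
    intro x hx
    obtain ⟨W, hW, hxW, hWU⟩ := Opens.isBasis_iff_nbhd.1 Y.isBasis_affineOpens hx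
    exact Opens.mem_iSup.2 ⟨⟨W, hW, hWU⟩, hxW⟩
  rw [(powerSeries d (ofScheme Y)).sectionTop_eq U (fun W : ι => W.1) (fun W => W.2.2) hU,
    probeTop_eq (psLRS d Y.toLocallyRingedSpace) Z.obj ε U (fun W : ι => W.1)
      (fun W => W.2.2) hU]
  exact iInf_congr fun W => by rw [hε.sectionTop_affine W.1 W.2.1]; rfl

end IsTruncation

lemma continuous_probeTop {L M : LocallyRingedSpace.{u}} {ι : Type*} {Z : ι → Scheme.{u}}
    (g : ∀ i, (Z i).toLocallyRingedSpace ⟶ L) (g' : ∀ i, (Z i).toLocallyRingedSpace ⟶ M)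
    (f : L ⟶ M) (hf : ∀ i, g i ≫ f = g' i) (U : Opens M.toTopCat) :
    @Continuous _ _ (probeTop M Z g' U) (probeTop L Z g ((Opens.map f.base).obj U))
      (f.c.app (op U)) := by
  refine @continuous_ofProbes L _ Z g _ (probeTop M Z g' U) _ _ fun i V hc h => ?_
  obtain rfl : (fun i => g i ≫ f) = g' := funext hf
  refine continuous_iff_le_induced.2 ?_
  refine iInf_le_of_le i (iInf_le_of_le V (iInf_le_of_le hc (iInf_le_of_le h (le_of_eq ?_))))
  congr 1

/-- Uniqueness of colimits gives the isomorphism of locally ringed spaces; the comparison of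
topologies makes it continuous in both directions. -/
lemma IsTruncation.exists_isIso {ε} (hε : IsTruncation (d := d) (Y := Y) (Z := Z) ε) :
    ∃ ψ : powerSeries d (ofScheme Y) ⟶ indScheme Z, IsIso ψ ∧
      ∀ n, ε n ≫ ψ.toLRSHom = colimit.ι (Z ⋙ Scheme.forgetToLocallyRingedSpace) n := by
  obtain ⟨hc⟩ := hε.isColimit
  let e := hc.coconePointUniqueUpToIso
    (colimit.isColimit (Z ⋙ Scheme.forgetToLocallyRingedSpace))
  have he : ∀ n, ε n ≫ e.hom = colimit.ι (Z ⋙ Scheme.forgetToLocallyRingedSpace) n :=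
    fun n => hc.comp_coconePointUniqueUpToIso_hom _ n
  have he' : ∀ n, colimit.ι (Z ⋙ Scheme.forgetToLocallyRingedSpace) n ≫ e.inv = ε n :=
    fun n => hc.comp_coconePointUniqueUpToIso_inv _ n
  let f : powerSeries d (ofScheme Y) ⟶ indScheme Z := ⟨e.hom, fun U => by
    have h1 := continuous_probeTop ε
      (colimit.ι (Z ⋙ Scheme.forgetToLocallyRingedSpace)) e.hom he U
    exact (congrArg (fun t => @Continuous _ _ (probeTop _ Z.obj _ U) t (e.hom.c.app (op U)))
      (hε.sectionTop_eq ((Opens.map e.hom.base).obj U))).mpr h1⟩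
  let g : indScheme Z ⟶ powerSeries d (ofScheme Y) := ⟨e.inv, fun U => by
    have h1 := continuous_probeTop (colimit.ι (Z ⋙ Scheme.forgetToLocallyRingedSpace)) ε
      e.inv he' U
    exact (congrArg (fun t => @Continuous _ _ t (probeTop _ Z.obj _ _) (e.inv.c.app (op U)))
      (hε.sectionTop_eq U)).mpr h1⟩
  exact ⟨f, ⟨g, hom_ext e.hom_inv_id, hom_ext e.inv_hom_id⟩, he⟩

end PowerSeriesColimit

/-! ### Truncated polynomial rings -/

section TruncPoly

open MvPowerSeries

/-- The ring of polynomials in `d` variables modulo those of order `> n`. -/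
abbrev TruncPoly (d n : ℕ) (B : Type u) [CommRing B] : Type u :=
  MvPolynomial (Fin d) B ⧸ (MvPolynomial.idealOfVars (Fin d) B) ^ (n + 1)

namespace TruncPoly

variable {d n : ℕ} {B B' S : Type u} [CommRing B] [CommRing B'] [CommRing S]

variable (d n B) in
/-- The ideal generated by the variables. -/
def vars : Ideal (TruncPoly d n B) :=
  (MvPolynomial.idealOfVars (Fin d) B).map (Ideal.Quotient.mk _)

variable (d n) in
/-- The constants. -/
def C : B →+* TruncPoly d n B := (Ideal.Quotient.mk _).comp MvPolynomial.C

variable (n B) in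
/-- The variables. -/
def X (i : Fin d) : TruncPoly d n B := Ideal.Quotient.mk _ (MvPolynomial.X i)

lemma vars_eq : vars d n B = Ideal.span (Set.range (X n B)) := by
  rw [vars, Ideal.map_span, ← Set.range_comp]
  rfl

lemma vars_pow : vars d n B ^ (n + 1) = ⊥ := by
  rw [vars, ← Ideal.map_pow, Ideal.map_quotient_self]

@[ext high]
lemma hom_ext {f g : TruncPoly d n B →+* S} (h : f.comp (C d n) = g.comp (C d n))
    (h' : ∀ i, f (X n B i) = g (X n B i)) : f = g :=
  Ideal.Quotient.ringHom_ext (MvPolynomial.ringHom_ext (fun b => congr($h b)) h')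

/-- The universal property of the ring of truncated polynomials. -/
def lift (f : B →+* S) (τ : Fin d → S) (hτ : Ideal.span (Set.range τ) ^ (n + 1) = ⊥) :
    TruncPoly d n B →+* S :=
  Ideal.Quotient.lift _ (MvPolynomial.eval₂Hom f τ) fun p hp => by
    have h := Ideal.mem_map_of_mem (MvPolynomial.eval₂Hom f τ) hp
    rw [Ideal.map_pow, Ideal.map_span, ← Set.range_comp] at h
    have h1 : (MvPolynomial.eval₂Hom f τ) ∘ MvPolynomial.X = τ :=
      funext fun i => MvPolynomial.eval₂Hom_X' f τ i
    rw [h1, hτ] at h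
    exact h

section
variable (f : B →+* S) (τ : Fin d → S) (hτ : Ideal.span (Set.range τ) ^ (n + 1) = ⊥)

@[simp] lemma lift_C (b : B) : lift f τ hτ (C d n b) = f b := MvPolynomial.eval₂Hom_C f τ b

@[simp] lemma lift_X (i : Fin d) : lift f τ hτ (X n B i) = τ i := MvPolynomial.eval₂Hom_X' f τ i

end

variable (d n) in
/-- Functoriality of the ring of truncated polynomials. -/
def map (f : B →+* B') : TruncPoly d n B →+* TruncPoly d n B' :=
  lift ((C d n).comp f) (X n B') (by rw [← vars_eq, vars_pow])

variable (n) in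
/-- Truncation of power series. -/
def trunc : MvPowerSeries (Fin d) B →+* TruncPoly d n B :=
  (truncTotalAlgHom (Fin d) B (n + 1)).toRingHom

lemma trunc_apply (s : MvPowerSeries (Fin d) B) :
    trunc n s = Ideal.Quotient.mk _ (truncTotal (n + 1) s) := rfl

lemma trunc_coe (p : MvPolynomial (Fin d) B) :
    trunc n (p : MvPowerSeries (Fin d) B) = Ideal.Quotient.mk _ p :=
  (truncTotalAlgHom (Fin d) B (n + 1)).commutes p

lemma trunc_surjective : Function.Surjective (trunc (d := d) (B := B) n) := fun q => by
  obtain ⟨p, rfl⟩ := Ideal.Quotient.mk_surjective q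
  exact ⟨p, trunc_coe p⟩

lemma trunc_C (b : B) : trunc n (MvPowerSeries.C (σ := Fin d) b) = C d n b := by
  rw [← MvPolynomial.coe_C, trunc_coe]; rfl

lemma trunc_X (i : Fin d) : trunc n (MvPowerSeries.X (R := B) i) = X n B i := by
  rw [← MvPolynomial.coe_X, trunc_coe]; rfl

/-- The bound on `k` is needed because truncation forgets the coefficients of degree greater than
`n`. -/
lemma trunc_mem_vars_pow {k : ℕ} (hk : k ≤ n + 1) {s : MvPowerSeries (Fin d) B} :
    trunc n s ∈ vars d n B ^ k ↔ ∀ α : Fin d →₀ ℕ, α.degree < k → coeff α s = 0 := by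
  rw [trunc_apply, vars, ← Ideal.map_pow, Ideal.mem_quotient_iff_mem (Ideal.pow_le_pow_right hk),
    MvPolynomial.mem_pow_idealOfVars_iff']
  exact forall₂_congr fun α hα => by rw [coeff_truncTotal _ (hα.trans_le hk)]

lemma trunc_eq_zero_iff {s : MvPowerSeries (Fin d) B} :
    trunc n s = 0 ↔ ∀ α : Fin d →₀ ℕ, α.degree ≤ n → coeff α s = 0 := by
  have h := trunc_mem_vars_pow (n := n) le_rfl (s := s)
  rw [vars_pow, Ideal.mem_bot] at h
  simpa only [Nat.lt_succ_iff] using h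

/-- Up to degree `n` the series may be replaced by a polynomial, on which both sides are ring
homomorphisms determined by constants and variables. -/
lemma trunc_map (f : B →+* B') (s : MvPowerSeries (Fin d) B) :
    trunc n (MvPowerSeries.map f s) = map d n f (trunc n s) := by
  obtain ⟨p, hp⟩ := Ideal.Quotient.mk_surjective (trunc n s)
  rw [← trunc_coe, ← sub_eq_zero, ← map_sub, trunc_eq_zero_iff] at hp
  have h1 : map d n f (trunc n s) = trunc n (MvPolynomial.map f p : MvPolynomial (Fin d) B') := by
    have h2 : trunc n s = Ideal.Quotient.mk _ p := by
      rw [← trunc_coe, ← sub_eq_zero, ← map_sub, ← neg_sub, map_neg, trunc_eq_zero_iff.2 hp,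
        neg_zero]
    rw [h2, trunc_coe]
    have h3 : ((map d n f).comp (Ideal.Quotient.mk _)) =
        (Ideal.Quotient.mk _).comp (MvPolynomial.map f) :=
      MvPolynomial.ringHom_ext (fun b => by simp [map, lift, C]) fun i => by
        simpa using! lift_X ((C d n).comp f) (X n B') _ i
    exact congr($h3 p)
  rw [h1, ← sub_eq_zero, ← map_sub, trunc_eq_zero_iff]
  intro α hα
  have h4 := hp α hα
  rw [map_sub, MvPolynomial.coeff_coe, sub_eq_zero] at h4
  rw [map_sub, MvPowerSeries.coeff_map, MvPolynomial.coeff_coe, MvPolynomial.coeff_map, h4, sub_self]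

lemma exists_sub_C_mem (q : TruncPoly d n B) : ∃ b, q - C d n b ∈ vars d n B := by
  obtain ⟨s, rfl⟩ := trunc_surjective q
  refine ⟨constantCoeff s, ?_⟩
  rw [← trunc_C, ← map_sub, ← pow_one (vars d n B), trunc_mem_vars_pow (by simp)]
  intro α hα
  obtain rfl : α = 0 := by
    rwa [Nat.lt_one_iff, Finsupp.degree_eq_zero_iff] at hα
  simp

/-- Finiteness is what makes a surjective `B`-linear endomorphism injective in `ker_trunc_comp`. The
monomials of degree at most `n` generate. -/
instance : Module.Finite B (TruncPoly d n B) := by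
  classical
  refine ⟨⟨((Finsupp.finite_of_degree_le (σ := Fin d) n).toFinset).image
    (fun α => (Ideal.Quotient.mk _ (MvPolynomial.monomial α (1 : B)) : TruncPoly d n B)), ?_⟩⟩
  refine eq_top_iff.2 fun q _ => ?_
  obtain ⟨p, rfl⟩ := Ideal.Quotient.mk_surjective q
  rw [p.as_sum, map_sum]
  refine Submodule.sum_mem _ fun α _ => ?_
  by_cases hα : α.degree ≤ n
  · have h1 : (Ideal.Quotient.mk _ (MvPolynomial.monomial α (p.coeff α)) : TruncPoly d n B) =
        p.coeff α • Ideal.Quotient.mk _ (MvPolynomial.monomial α (1 : B)) := by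
      have h2 : MvPolynomial.monomial α (p.coeff α) =
          p.coeff α • MvPolynomial.monomial α (1 : B) := by
        rw [MvPolynomial.smul_monomial, smul_eq_mul, mul_one]
      rw [h2]
      rfl
    rw [h1]
    refine Submodule.smul_mem _ _ (Submodule.subset_span ?_)
    simp only [Finset.coe_image, Set.Finite.coe_toFinset]
    exact ⟨α, hα, rfl⟩
  · have h1 : (Ideal.Quotient.mk _ (MvPolynomial.monomial α (p.coeff α)) : TruncPoly d n B) = 0 := by
      rw [Ideal.Quotient.eq_zero_iff_mem, MvPolynomial.mem_pow_idealOfVars_iff']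
      intro β hβ
      rw [MvPolynomial.coeff_monomial, if_neg]
      rintro rfl
      omega
    rw [h1]
    exact zero_mem _

end TruncPoly

/-- Nakayama's lemma for a nilpotent ideal: the `f (x i)` generate `m` modulo `m ^ 2`, hence
generate `m`. An element of `Q` is then approximated from the image of `f` modulo higher and higher
powers of `m`. -/
lemma surjective_of_nilpotent {R Q : Type*} [CommRing R] [CommRing Q] {ι : Type*} [Finite ι]
    (f : R →+* Q) (m : Ideal Q) {N : ℕ} (hN : m ^ N = ⊥) (x : ι → R)
    (hx : ∀ i, f (x i) ∈ m) (hm : m ≤ Ideal.span (Set.range fun i => f (x i)) ⊔ m ^ 2)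
    (hf : ∀ q, ∃ r, q - f r ∈ m) : Function.Surjective f := by
  have := Fintype.ofFinite ι
  set S := Ideal.span (Set.range fun i => f (x i))
  have h1 : ∀ k, m ≤ S ⊔ m ^ (k + 1) := by
    intro k
    induction k with
    | zero => simp
    | succ k ih =>
      refine hm.trans (sup_le le_sup_left ?_)
      rw [sq]
      refine (Ideal.mul_mono_right ih).trans ?_
      rw [Ideal.mul_sup, ← pow_succ']
      exact sup_le_sup_right Ideal.mul_le_right _
  have h2 : m ≤ S := by
    refine (h1 N).trans (sup_le le_rfl ?_)
    rw [pow_succ, hN, Ideal.bot_mul]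
    exact bot_le
  have h3 : ∀ k q, ∃ r, q - f r ∈ m ^ k := by
    intro k
    induction k with
    | zero => exact fun q => ⟨0, by simp⟩
    | succ k ih =>
      intro q
      obtain ⟨r, hr⟩ := hf q
      obtain ⟨c, hc⟩ := Ideal.mem_span_range_iff_exists_fun.1 (h2 hr)
      choose r' hr' using fun i => ih (c i)
      -- The error is `∑ c i * f (x i)`. Approximating the `c i` to order `k` gains one factor of
      -- `m`, since the `f (x i)` lie in `m`.
      refine ⟨r + ∑ i, r' i * x i, ?_⟩
      have : q - f (r + ∑ i, r' i * x i) = ∑ i, (c i - f (r' i)) * f (x i) := by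
        rw [map_add, ← sub_sub, ← hc, map_sum, ← Finset.sum_sub_distrib]
        exact Finset.sum_congr rfl fun i _ => by rw [map_mul, sub_mul]
      rw [this, pow_succ]
      exact Ideal.sum_mem _ fun i _ => Ideal.mul_mem_mul (hr' i) (hx i)
  intro q
  obtain ⟨r, hr⟩ := h3 N q
  rw [hN, Ideal.mem_bot, sub_eq_zero] at hr
  exact ⟨r, hr.symm⟩

/-! ### Homomorphisms to power series with invertible Jacobian -/

section

variable {d : ℕ} {B P : Type u} [CommRing B] [CommRing P] (β : B →+* P)
  (G : P →+* MvPowerSeries (Fin d) B) (x : Fin d → P)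

lemma trunc_mem_vars {n : ℕ} {s : MvPowerSeries (Fin d) B} (hs : constantCoeff s = 0) :
    TruncPoly.trunc n s ∈ TruncPoly.vars d n B := by
  rw [← pow_one (TruncPoly.vars d n B), TruncPoly.trunc_mem_vars_pow (by simp)]
  intro α hα
  obtain rfl : α = 0 := by
    rwa [Nat.lt_one_iff, Finsupp.degree_eq_zero_iff] at hα
  exact hs

lemma trunc_sub_linear_mem {n : ℕ} {s : MvPowerSeries (Fin d) B} (hs : constantCoeff s = 0) :
    TruncPoly.trunc n s - ∑ j, TruncPoly.C d n (coeff (Finsupp.single j 1) s) * TruncPoly.X n B j ∈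
      TruncPoly.vars d n B ^ 2 := by
  classical
  have h1 : TruncPoly.trunc n s -
      ∑ j, TruncPoly.C d n (coeff (Finsupp.single j 1) s) * TruncPoly.X n B j =
      TruncPoly.trunc n (s - ∑ j, MvPowerSeries.C (coeff (Finsupp.single j 1) s) * X j) := by
    rw [map_sub, map_sum]
    congr 1
    exact Finset.sum_congr rfl fun j _ => by
      rw [map_mul, TruncPoly.trunc_C, TruncPoly.trunc_X]
  rw [h1]
  have h2 : ∀ α : Fin d →₀ ℕ, α.degree < 2 →
      coeff α (s - ∑ j, MvPowerSeries.C (coeff (Finsupp.single j 1) s) * X j) = 0 := by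
    intro α hα
    rw [map_sub, map_sum]
    simp only [coeff_C_mul, coeff_X]
    obtain h0 | h0 : α.degree = 0 ∨ α.degree = 1 := by omega
    · obtain rfl : α = 0 := by rwa [Finsupp.degree_eq_zero_iff] at h0
      rw [coeff_zero_eq_constantCoeff_apply, hs, zero_sub, neg_eq_zero]
      refine Finset.sum_eq_zero fun j _ => ?_
      rw [if_neg, mul_zero]
      exact fun h => by simpa using congr($h j)
    · obtain ⟨j, rfl⟩ : ∃ j, α = Finsupp.single j 1 := by
        obtain ⟨j, hj⟩ : ∃ j, α j ≠ 0 := by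
          by_contra! h
          obtain rfl : α = 0 := Finsupp.ext h
          simp at h0
        have h3 : Finsupp.single j 1 + (α - Finsupp.single j 1) = α :=
          add_tsub_cancel_of_le (Finsupp.single_le_iff.2 (Nat.one_le_iff_ne_zero.2 hj))
        have h4 := congrArg Finsupp.degree h3
        rw [map_add, Finsupp.degree_single, h0, Nat.add_eq_left, Finsupp.degree_eq_zero_iff] at h4
        rw [h4, add_zero] at h3
        exact ⟨j, h3.symm⟩
      rw [Finset.sum_eq_single j]
      · simp
      · intro i _ hij
        rw [if_neg, mul_zero]
        exact fun h => hij ((Finsupp.single_left_injective one_ne_zero) h).symm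
      · simp
  -- For `n = 0` the exponent `2` exceeds `n + 1` and `trunc_mem_vars_pow` does not apply, but the
  -- truncation is then zero.
  rcases n with _ | n
  · have h3 : TruncPoly.vars d 0 B = ⊥ := by simpa using TruncPoly.vars_pow (d := d) (n := 0) (B := B)
    rw [TruncPoly.trunc_eq_zero_iff.2 fun α hα => h2 α (by omega)]
    exact zero_mem _
  · exact (TruncPoly.trunc_mem_vars_pow (by omega)).2 h2

/-- The inverse function theorem to first order: the inverse Jacobian matrix expresses each variable
through the series `G (x i)`, up to terms of order two. -/
lemma vars_le_span_trunc (hx : ∀ i, constantCoeff (G (x i)) = 0)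
    (hdet : IsUnit (Matrix.of fun i j : Fin d => coeff (Finsupp.single j 1) (G (x i))).det)
    (n : ℕ) : TruncPoly.vars d n B ≤
    Ideal.span (Set.range fun i => TruncPoly.trunc n (G (x i))) ⊔ TruncPoly.vars d n B ^ 2 := by
  set M := Matrix.of fun i j : Fin d => coeff (Finsupp.single j 1) (G (x i))
  have hNM : M⁻¹ * M = 1 := Matrix.nonsing_inv_mul _ hdet
  nth_rw 1 [TruncPoly.vars_eq]
  rw [Ideal.span_le]
  rintro _ ⟨j, rfl⟩
  have key : TruncPoly.X n B j = ∑ i, TruncPoly.C d n (M⁻¹ j i) * TruncPoly.trunc n (G (x i)) -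
      ∑ i, TruncPoly.C d n (M⁻¹ j i) * (TruncPoly.trunc n (G (x i)) -
        ∑ l, TruncPoly.C d n (M i l) * TruncPoly.X n B l) := by
    rw [← Finset.sum_sub_distrib]
    have h1 : ∀ l, ∑ i, TruncPoly.C d n (M⁻¹ j i) * TruncPoly.C d n (M i l) =
        if j = l then 1 else 0 := by
      intro l
      have := congr(TruncPoly.C d n ($hNM j l))
      rw [Matrix.mul_apply, map_sum, Matrix.one_apply] at this
      simpa [apply_ite] using this
    calc TruncPoly.X n B j = ∑ l, (∑ i, TruncPoly.C d n (M⁻¹ j i) * TruncPoly.C d n (M i l)) *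
          TruncPoly.X n B l := by simp [h1]
      _ = _ := by
        simp_rw [Finset.sum_mul]
        rw [Finset.sum_comm]
        refine Finset.sum_congr rfl fun i _ => ?_
        rw [mul_sub, sub_sub_cancel, Finset.mul_sum]
        exact Finset.sum_congr rfl fun l _ => mul_assoc _ _ _
  rw [key]
  refine sub_mem (Ideal.mem_sup_left ?_) (Ideal.mem_sup_right ?_)
  · exact Ideal.sum_mem _ fun i _ => Ideal.mul_mem_left _ _ (Ideal.subset_span ⟨i, rfl⟩)
  · exact Ideal.sum_mem _ fun i _ => Ideal.mul_mem_left _ _ (trunc_sub_linear_mem (hx i))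

lemma trunc_comp_surjective (hG : ∀ b, G (β b) = MvPowerSeries.C b)
    (hx : ∀ i, constantCoeff (G (x i)) = 0)
    (hdet : IsUnit (Matrix.of fun i j : Fin d => coeff (Finsupp.single j 1) (G (x i))).det)
    (n : ℕ) : Function.Surjective ((TruncPoly.trunc n).comp G) := by
  refine surjective_of_nilpotent _ (TruncPoly.vars d n B) TruncPoly.vars_pow x
    (fun i => trunc_mem_vars (hx i)) (vars_le_span_trunc G x hx hdet n) fun q => ?_
  obtain ⟨b, hb⟩ := TruncPoly.exists_sub_C_mem q
  refine ⟨β b, ?_⟩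
  rwa [RingHom.comp_apply, hG, TruncPoly.trunc_C]

/-- The `x i` generate the ideal `I` modulo `I ^ 2`, so sending the variables to them gives a
surjection `χ` from truncated polynomials onto `P ⧸ I ^ (n + 1)`. Followed by the surjection back it
becomes a surjective endomorphism of a finite `B`-module, which is injective. Hence the surjection
back has no kernel. -/
lemma ker_trunc_comp (hG : ∀ b, G (β b) = MvPowerSeries.C b)
    (hx : ∀ i, constantCoeff (G (x i)) = 0)
    (hdet : IsUnit (Matrix.of fun i j : Fin d => coeff (Finsupp.single j 1) (G (x i))).det)
    (n : ℕ) (hI : RingHom.ker (constantCoeff.comp G) ≤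
      Ideal.span (Set.range x) ⊔ RingHom.ker (constantCoeff.comp G) ^ 2) :
    RingHom.ker ((TruncPoly.trunc n).comp G) = RingHom.ker (constantCoeff.comp G) ^ (n + 1) := by
  set I := RingHom.ker (constantCoeff.comp G)
  set π := (TruncPoly.trunc n).comp G
  have hIπ : I ^ (n + 1) ≤ RingHom.ker π := by
    have h1 : I ≤ (TruncPoly.vars d n B).comap π := fun p hp => trunc_mem_vars hp
    refine (Ideal.pow_right_mono h1 _).trans ((Ideal.le_comap_pow _ _).trans ?_)
    rw [TruncPoly.vars_pow]
    exact le_rfl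
  refine le_antisymm (fun p hp => ?_) hIπ
  let q : P →+* P ⧸ I ^ (n + 1) := Ideal.Quotient.mk _
  have hq : I.map q ^ (n + 1) = ⊥ := by rw [← Ideal.map_pow, Ideal.map_quotient_self]
  have hxI : ∀ i, x i ∈ I := hx
  let χ : TruncPoly d n B →+* P ⧸ I ^ (n + 1) := TruncPoly.lift (q.comp β) (fun i => q (x i)) (by
    rw [eq_bot_iff, ← hq]
    refine Ideal.pow_right_mono (Ideal.span_le.2 ?_) _
    rintro _ ⟨i, rfl⟩
    exact Ideal.mem_map_of_mem q (hxI i))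
  have hχX : ∀ i, χ (TruncPoly.X n B i) = q (x i) := fun i => TruncPoly.lift_X ..
  have hχC : ∀ b, χ (TruncPoly.C d n b) = q (β b) := fun i => TruncPoly.lift_C ..
  have hχ : Function.Surjective χ := by
    refine surjective_of_nilpotent χ (I.map q) hq (TruncPoly.X n B) (fun i => ?_) ?_ fun r => ?_
    · rw [hχX]
      exact Ideal.mem_map_of_mem q (hxI i)
    · have h1 := Ideal.map_mono (f := q) hI
      rw [Ideal.map_sup, Ideal.map_span, Ideal.map_pow, ← Set.range_comp] at h1
      simp only [hχX]
      exact h1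
    · obtain ⟨p, rfl⟩ := Ideal.Quotient.mk_surjective r
      refine ⟨TruncPoly.C d n (constantCoeff (G p)), ?_⟩
      rw [hχC]
      change q p - _ ∈ _
      rw [← map_sub]
      refine Ideal.mem_map_of_mem q ?_
      change constantCoeff (G _) = 0
      rw [map_sub, map_sub, hG, constantCoeff_C, sub_self]
  let π' : P ⧸ I ^ (n + 1) →+* TruncPoly d n B := Ideal.Quotient.lift _ π hIπ
  have hπ' : ∀ p, π' (q p) = π p := fun p => Ideal.Quotient.lift_mk _ _ _
  -- The composite is `B`-linear because `G` sends `β b` to the constant series `b`.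
  let e : TruncPoly d n B →ₗ[B] TruncPoly d n B :=
    { toFun := π'.comp χ
      map_add' := map_add _
      map_smul' := fun b t => by
        have h1 : ∀ t : TruncPoly d n B, b • t = TruncPoly.C d n b * t := fun t =>
          Algebra.smul_def b t
        rw [h1, map_mul, RingHom.id_apply, h1, RingHom.comp_apply, hχC, hπ', RingHom.comp_apply, hG,
          TruncPoly.trunc_C] }
  have he : Function.Surjective e := by
    refine Function.Surjective.comp (g := π') (fun t => ?_) hχ
    obtain ⟨p, hp⟩ := trunc_comp_surjective β G x hG hx hdet n t
    exact ⟨q p, (hπ' p).trans hp⟩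
  have he' := OrzechProperty.injective_of_surjective_endomorphism e he
  obtain ⟨t, ht⟩ := hχ (q p)
  have h1 : e t = 0 := by
    change π' (χ t) = 0
    rw [ht, hπ']
    exact hp
  rw [map_eq_zero_iff e he'] at h1
  rw [h1, map_zero] at ht
  exact Ideal.Quotient.eq_zero_iff_mem.1 ht.symm

end
end TruncPoly

/-! ### Products over an affine base -/

section Products

variable {X T S : Scheme.{u}} {K : CommRingCat.{u}} {f : X ⟶ Spec K} {g : T ⟶ Spec K}
  {p : S ⟶ X} {q : S ⟶ T}

lemma appLE_top_eq (f : X ⟶ Spec K) (V : X.Opens) (e : V ≤ f ⁻¹ᵁ ⊤) :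
    f.appLE ⊤ V e = (Scheme.ΓSpecIso K).hom ≫ baseHom f V := by
  rw [baseHom, Iso.hom_inv_id_assoc]
  rfl

lemma baseHom_comp_appLE (f : X ⟶ Spec K) (p : S ⟶ X) (V : X.Opens) (O : S.Opens)
    (e : O ≤ p ⁻¹ᵁ V) : baseHom f V ≫ p.appLE V O e = baseHom (p ≫ f) O := by
  have h1 := appLE_top_eq f V le_top
  have h2 := appLE_top_eq (p ≫ f) O le_top
  rw [← Iso.inv_comp_eq] at h1 h2
  rw [← h1, ← h2, Category.assoc]
  exact congrArg ((Scheme.ΓSpecIso K).inv ≫ ·) (Scheme.Hom.appLE_comp_appLE ..)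

lemma isAffineOpen_inf_of_isPullback (H : IsPullback p q f g) {V : X.Opens} {W : T.Opens}
    (hV : IsAffineOpen V) (hW : IsAffineOpen W) {O : S.Opens} (hO : O = p ⁻¹ᵁ V ⊓ q ⁻¹ᵁ W) :
    IsAffineOpen O := by
  have : IsAffine _ := isAffineOpen_top (Spec K)
  have : IsAffine _ := hV
  have : IsAffine _ := hW
  exact .of_isIso (Scheme.Hom.isPullback_resLE H (US := ⊤) (UT := W) (UX := V) le_top le_top
    hO).isoPullback.hom

/-- Sections over a product of affine opens form a tensor product. Using `baseHom` makes the base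
ring `K` itself and not the global sections of its spectrum. -/
lemma isPushout_appLE (H : IsPullback p q f g) {V : X.Opens} {W : T.Opens}
    (hV : IsAffineOpen V) (hW : IsAffineOpen W) {O : S.Opens} (hO : O = p ⁻¹ᵁ V ⊓ q ⁻¹ᵁ W) :
    IsPushout (baseHom f V) (baseHom g W) (p.appLE V O (hO ▸ inf_le_left))
      (q.appLE W O (hO ▸ inf_le_right)) := by
  have h := (isIso_pushoutSection_iff H (US := ⊤) (UT := W) (UX := V) le_top le_top hO).1
    (isIso_pushoutSection_of_isAffineOpen H _ _ hO (isAffineOpen_top _) hW hV)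
  exact h.of_iso (Scheme.ΓSpecIso K) (Iso.refl _) (Iso.refl _) (Iso.refl _)
    ((Category.comp_id _).trans (appLE_top_eq f V le_top))
    ((Category.comp_id _).trans (appLE_top_eq g W le_top)) (by simp) (by simp)

/-- The universal property gives a map from `P` to the subring generated by the two images, and its
composite with the inclusion is the identity. -/
lemma mem_closure_of_isPushout {A B C P : CommRingCat.{u}} {f : A ⟶ B} {g : A ⟶ C} {i : B ⟶ P}
    {j : C ⟶ P} (H : IsPushout f g i j) (x : P) :
    x ∈ Subring.closure (Set.range i ∪ Set.range j) := by
  let S := Subring.closure (Set.range i ∪ Set.range j)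
  let i' : B ⟶ .of S := CommRingCat.ofHom (i.hom.codRestrict S fun b =>
    Subring.subset_closure (Or.inl ⟨b, rfl⟩))
  let j' : C ⟶ .of S := CommRingCat.ofHom (j.hom.codRestrict S fun b =>
    Subring.subset_closure (Or.inr ⟨b, rfl⟩))
  have hw : f ≫ i' = g ≫ j' := by
    exact CommRingCat.hom_ext (RingHom.ext fun a => Subtype.ext congr(($(H.w)).hom a))
  let c := H.desc i' j' hw
  have hc : c ≫ CommRingCat.ofHom S.subtype = 𝟙 _ := by
    refine H.hom_ext ?_ ?_
    · rw [← Category.assoc, H.inl_desc]; rfl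
    · rw [← Category.assoc, H.inr_desc]; rfl
  have := congr(($hc).hom x)
  rw [← show _ = x from this]
  exact (c x).2

end Products

/-! ### Infinitesimal thickenings of a scheme -/

section Thickening

open LRS TopLRS

variable (d n : ℕ) {Y : Scheme.{u}} {K : CommRingCat.{u}} (σ : Y ⟶ Spec K)

/-- The spectrum of the ring of truncated polynomials. -/
def specTrunc (K : CommRingCat.{u}) : Scheme.{u} := Spec (.of (TruncPoly d n K))

instance : IsAffine (specTrunc d n K) := inferInstanceAs (IsAffine (Spec _))

/-- The structure morphism. -/
def specTruncπ (K : CommRingCat.{u}) : specTrunc d n K ⟶ Spec K :=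
  Spec.map (CommRingCat.ofHom (TruncPoly.C d n))

/-- The product of `Y` and the spectrum of the ring of truncated polynomials. -/
def thick : Scheme.{u} := pullback σ (specTruncπ d n K)

/-- The projection to `Y`. -/
def thickFst : thick d n σ ⟶ Y := pullback.fst _ _

/-- The projection to the spectrum of the ring of truncated polynomials. -/
def thickSnd : thick d n σ ⟶ specTrunc d n K := pullback.snd _ _

lemma isPullback_thick :
    IsPullback (thickFst d n σ) (thickSnd d n σ) σ (specTruncπ d n K) := .of_hasPullback _ _

/-- The constant term. -/
def TruncPoly.const (B : Type u) [CommRing B] : TruncPoly d n B →+* B :=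
  TruncPoly.lift (RingHom.id B) 0 (by
    have h : Ideal.span (Set.range (0 : Fin d → B)) = ⊥ := by
      rw [Ideal.span_eq_bot]
      rintro _ ⟨i, rfl⟩
      rfl
    rw [h, ← Ideal.zero_eq_bot, zero_pow n.succ_ne_zero])

lemma TruncPoly.const_C (B : Type u) [CommRing B] (b : B) : const d n B (C d n b) = b :=
  TruncPoly.lift_C _ _ _ b

lemma TruncPoly.const_surjective (B : Type u) [CommRing B] : Function.Surjective (const d n B) :=
  fun b => ⟨_, const_C d n B b⟩

lemma TruncPoly.vars_le_ker_const (B : Type u) [CommRing B] :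
    vars d n B ≤ RingHom.ker (const d n B) := by
  rw [vars_eq, Ideal.span_le]
  rintro _ ⟨i, rfl⟩
  exact TruncPoly.lift_X _ _ _ i

lemma TruncPoly.const_trunc {B : Type u} [CommRing B] (s : MvPowerSeries (Fin d) B) :
    const d n B (trunc n s) = MvPowerSeries.constantCoeff s := by
  have h1 : trunc n (s - MvPowerSeries.C (MvPowerSeries.constantCoeff s)) ∈ vars d n B :=
    trunc_mem_vars (by simp)
  have h2 := vars_le_ker_const d n B h1
  rwa [map_sub, trunc_C, RingHom.mem_ker, map_sub, const_C, sub_eq_zero] at h2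

lemma TruncPoly.ker_const (B : Type u) [CommRing B] :
    RingHom.ker (const d n B) = vars d n B := by
  refine le_antisymm (fun q hq => ?_) (vars_le_ker_const d n B)
  obtain ⟨s, rfl⟩ := trunc_surjective q
  rw [RingHom.mem_ker, const_trunc] at hq
  exact trunc_mem_vars hq

/-- The section of the structure morphism. -/
def specTruncZero (K : CommRingCat.{u}) : Spec K ⟶ specTrunc d n K :=
  Spec.map (CommRingCat.ofHom (TruncPoly.const d n K))

lemma specTruncZero_π : specTruncZero d n K ≫ specTruncπ d n K = 𝟙 _ := by
  refine (Spec.map_comp _ _).symm.trans (Eq.trans (congrArg Spec.map ?_) (Spec.map_id _))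
  ext b
  exact TruncPoly.const_C d n K b

instance : IsClosedImmersion (specTruncZero d n K) :=
  IsClosedImmersion.spec_of_surjective _ (TruncPoly.const_surjective d n K)

instance : Surjective (specTruncZero d n K) := by
  refine ⟨fun x => ?_⟩
  have h := range_comap_of_surjective K (TruncPoly.const d n K) (TruncPoly.const_surjective d n K)
  have h2 : x ∈ Set.range (PrimeSpectrum.comap (TruncPoly.const d n K)) := by
    rw [h, TruncPoly.ker_const]
    -- The kernel of the constant term is nilpotent, so every prime ideal contains it.
    refine (PrimeSpectrum.mem_zeroLocus _ _).2 fun y hy => ?_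
    refine PrimeSpectrum.isPrime x |>.mem_of_pow_mem (n + 1) ?_
    have h3 := Ideal.pow_mem_pow hy (n + 1)
    rw [TruncPoly.vars_pow, Ideal.mem_bot] at h3
    rw [h3]
    exact zero_mem _
  exact h2

/-- The zero section. -/
def thickZero : Y ⟶ thick d n σ :=
  pullback.lift (𝟙 Y) (σ ≫ specTruncZero d n K) (by
    rw [Category.id_comp, Category.assoc, specTruncZero_π, Category.comp_id])

lemma thickZero_fst : thickZero d n σ ≫ thickFst d n σ = 𝟙 Y := pullback.lift_fst _ _ _

lemma thickZero_snd : thickZero d n σ ≫ thickSnd d n σ = σ ≫ specTruncZero d n K :=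
  pullback.lift_snd _ _ _

/-- The zero section is thus a base change of `specTruncZero`, from which it inherits being a closed
immersion and surjective. -/
lemma isPullback_thickZero :
    IsPullback (thickZero d n σ) σ (thickSnd d n σ) (specTruncZero d n K) := by
  refine .of_right (t := isPullback_thick d n σ) ?_ (thickZero_snd d n σ)
  rw [thickZero_fst, specTruncZero_π]
  exact IsPullback.of_horiz_isIso ⟨by simp⟩

/-- The zero section is a surjective closed immersion, hence a homeomorphism, and `thickFst` is its
inverse on points. -/
lemma isHomeomorph_thickFst : IsHomeomorph (thickFst d n σ) := by
  have h1 : IsClosedImmersion (thickZero d n σ) :=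
    MorphismProperty.of_isPullback (isPullback_thickZero d n σ).flip inferInstance
  have h2 : Surjective (thickZero d n σ) :=
    MorphismProperty.of_isPullback (isPullback_thickZero d n σ).flip inferInstance
  let e := (thickZero d n σ).isClosedEmbedding.isEmbedding.toHomeomorphOfSurjective h2.1
  have h3 : (thickFst d n σ : thick d n σ → Y) = e.symm := by
    funext x
    obtain ⟨y, rfl⟩ := e.surjective x
    rw [e.symm_apply_apply]
    exact congr($(thickZero_fst d n σ) y)
  rw [h3]
  exact e.symm.isHomeomorph

end Thickening

/-! ### Power series and infinitesimal thickenings -/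

section ThickeningToPowerSeries

open LRS TopLRS

variable (d n : ℕ) {Y : Scheme.{u}} {K : CommRingCat.{u}} (σ : Y ⟶ Spec K)

lemma baseHom_specMap {K R : CommRingCat.{u}} (φ : K ⟶ R) :
    baseHom (Spec.map φ) ⊤ = φ ≫ (Scheme.ΓSpecIso R).inv := by
  rw [Scheme.ΓSpecIso_inv_naturality, baseHom]
  exact congrArg _ ((congrArg _ ((Spec R).presheaf.map_id _)).trans (Category.comp_id _))

lemma isUnit_of_isNilpotent_sub {R : Type*} [CommRing R] {a b : R} (h : IsNilpotent (a - b))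
    (ha : IsUnit a) : IsUnit b := by
  have := h.neg.isUnit_add_left_of_commute ha (Commute.all _ _)
  rwa [neg_sub, add_sub_cancel] at this

/-- The pullback of functions from the spectrum of the ring of truncated polynomials. -/
def thickCoord (V : (thick d n σ).Opens) : TruncPoly d n K →+* Γ(thick d n σ, V) :=
  (baseHom (K := .of (TruncPoly d n K)) (thickSnd d n σ) V).hom

lemma thickCoord_res {V V' : (thick d n σ).Opens} (h : V' ≤ V) (q : TruncPoly d n K) :
    (thick d n σ).presheaf.map (homOfLE h).op (thickCoord d n σ V q) = thickCoord d n σ V' q :=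
  congr($(baseHom_res (K := .of (TruncPoly d n K)) (thickSnd d n σ) h) q)

lemma thickCoord_C (U : Y.Opens) (c : K) :
    thickCoord d n σ (thickFst d n σ ⁻¹ᵁ U) (TruncPoly.C d n c) =
      (thickFst d n σ).app U (baseHom σ U c) := by
  have h1 := baseHom_comp_appLE σ (thickFst d n σ) U (thickFst d n σ ⁻¹ᵁ U) le_rfl
  have h2 : baseHom (specTruncπ d n K) ⊤ =
      CommRingCat.ofHom (TruncPoly.C d n) ≫ (Scheme.ΓSpecIso (.of (TruncPoly d n K))).inv :=
    baseHom_specMap _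
  have h3 := baseHom_comp_appLE (specTruncπ d n K) (thickSnd d n σ) ⊤ (thickFst d n σ ⁻¹ᵁ U) le_top
  rw [← (isPullback_thick d n σ).w, ← h1, h2] at h3
  have h4 := congr(($h3).hom c)
  rw [Scheme.Hom.app_eq_appLE]
  exact h4

lemma span_thickCoord_pow (V : (thick d n σ).Opens) :
    Ideal.span (Set.range fun i => thickCoord d n σ V (TruncPoly.X n K i)) ^ (n + 1) = ⊥ := by
  have h := congrArg (Ideal.map (thickCoord d n σ V)) (TruncPoly.vars_pow (d := d) (n := n) (B := K))
  rw [Ideal.map_pow, TruncPoly.vars_eq, Ideal.map_span, ← Set.range_comp, Ideal.map_bot] at h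
  exact h

/-- Truncated polynomials as functions on the thickening. -/
def thickLift (U : Y.Opens) :
    TruncPoly d n Γ(Y, U) →+* Γ(thick d n σ, thickFst d n σ ⁻¹ᵁ U) :=
  TruncPoly.lift ((thickFst d n σ).app U).hom
    (fun i => thickCoord d n σ (thickFst d n σ ⁻¹ᵁ U) (TruncPoly.X n K i))
    (span_thickCoord_pow d n σ _)

lemma thickLift_C (U : Y.Opens) (b : Γ(Y, U)) :
    thickLift d n σ U (TruncPoly.C d n b) = (thickFst d n σ).app U b :=
  TruncPoly.lift_C _ _ _ b

lemma thickLift_X (U : Y.Opens) (i : Fin d) : thickLift d n σ U (TruncPoly.X n _ i) =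
    thickCoord d n σ (thickFst d n σ ⁻¹ᵁ U) (TruncPoly.X n K i) :=
  TruncPoly.lift_X _ _ _ i

lemma thickLift_map {U V : Y.Opens} (h : V ≤ U) (q : TruncPoly d n Γ(Y, U)) :
    thickLift d n σ V (TruncPoly.map d n (Y.presheaf.map (homOfLE h).op).hom q) =
      (thick d n σ).presheaf.map ((Opens.map (thickFst d n σ).base).map (homOfLE h)).op
        (thickLift d n σ U q) := by
  refine congr($(TruncPoly.hom_ext (f := (thickLift d n σ V).comp
    (TruncPoly.map d n (Y.presheaf.map (homOfLE h).op).hom)) (g := ((thick d n σ).presheaf.map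
    ((Opens.map (thickFst d n σ).base).map (homOfLE h)).op).hom.comp (thickLift d n σ U))
    (RingHom.ext fun b => ?_) fun i => ?_) q)
  · simp only [RingHom.comp_apply, TruncPoly.map, TruncPoly.lift_C, thickLift_C]
    exact congr(($((thickFst d n σ).naturality (homOfLE h).op)).hom b)
  · simp only [RingHom.comp_apply, TruncPoly.map, TruncPoly.lift_X, thickLift_X]
    exact (thickCoord_res d n σ _ _).symm

/-- This reduces invertibility on the thickening to that of the constant term, which is how
`thickToPs` is seen to be local on stalks. -/
lemma isNilpotent_thickLift_sub (U : Y.Opens) (s : MvPowerSeries (Fin d) Γ(Y, U)) :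
    IsNilpotent (thickLift d n σ U (TruncPoly.trunc n s) -
      (thickFst d n σ).app U (MvPowerSeries.constantCoeff s)) := by
  refine ⟨n + 1, ?_⟩
  rw [← thickLift_C, ← map_sub, ← TruncPoly.trunc_C, ← map_sub, ← map_pow]
  have h := Ideal.pow_mem_pow (trunc_mem_vars (n := n)
    (s := s - MvPowerSeries.C (MvPowerSeries.constantCoeff s)) (by simp)) (n + 1)
  rw [TruncPoly.vars_pow, Ideal.mem_bot] at h
  rw [h, map_zero]

/-- The morphism from the thickening to `Y[[t₁, …, t_d]]`. -/
def thickToPs : (thick d n σ).toLocallyRingedSpace ⟶ psLRS d Y.toLocallyRingedSpace :=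
  ⟨⟨(thickFst d n σ).base,
    { app := fun U => CommRingCat.ofHom ((thickLift d n σ U.unop).comp (TruncPoly.trunc n))
      naturality := fun U V h => by
        refine CommRingCat.hom_ext (RingHom.ext fun s => ?_)
        exact (congrArg (thickLift d n σ V.unop) (TruncPoly.trunc_map _ s)).trans
          (thickLift_map d n σ h.unop.le _) }⟩,
    fun x => isLocalHom_stalkMap_of_germ _ x fun U hx s h => by
      refine (isUnit_germ_psPresheaf_iff d Y.toLocallyRingedSpace U _ hx s).2 ?_
      refine isUnit_germ_of_isUnit_germ_app (thickFst d n σ).toLRSHom x U hx _ ?_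
      have h1 := (isNilpotent_thickLift_sub d n σ U s).map
        ((thick d n σ).presheaf.germ _ x hx).hom
      rw [map_sub] at h1
      exact isUnit_of_isNilpotent_sub h1 h⟩

lemma thickToPs_appLE (U : Y.Opens) (s : MvPowerSeries (Fin d) Γ(Y, U)) :
    appLE (thickToPs d n σ) U _ le_rfl s = thickLift d n σ U (TruncPoly.trunc n s) :=
  congr(($(appLE_self (thickToPs d n σ) U)).hom s)

lemma thickToPs_proj : thickToPs d n σ ≫ psLRSProj d _ = (thickFst d n σ).toLRSHom :=
  lrs_hom_ext _ _ _ fun U s => by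
    exact (congrArg (thickLift d n σ U.unop) (TruncPoly.trunc_C s)).trans
      (thickLift_C d n σ U.unop s)

/-- Over an affine `W` the thickening is a product of affine schemes. The pushout property supplies
an inverse, given by the constants on the factor `Γ(Y, W)` and by mapping coefficients on the other
factor. -/
lemma thickLift_bijective {W : Y.Opens} (hW : IsAffineOpen W) :
    Function.Bijective (thickLift d n σ W) := by
  have H := isPushout_appLE (isPullback_thick d n σ) hW (isAffineOpen_top (specTrunc d n K))
    (O := thickFst d n σ ⁻¹ᵁ W) (le_antisymm (le_inf le_rfl le_top) inf_le_left)
  let b : Γ(specTrunc d n K, ⊤) ⟶ .of (TruncPoly d n Γ(Y, W)) :=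
    (Scheme.ΓSpecIso (.of (TruncPoly d n K))).hom ≫
      CommRingCat.ofHom (TruncPoly.map d n (baseHom σ W).hom)
  have h2 : baseHom (specTruncπ d n K) ⊤ =
      CommRingCat.ofHom (TruncPoly.C d n) ≫ (Scheme.ΓSpecIso (.of (TruncPoly d n K))).inv :=
    baseHom_specMap _
  have hb : ∀ q, b ((Scheme.ΓSpecIso (.of (TruncPoly d n K))).inv q) =
      TruncPoly.map d n (baseHom σ W).hom q := fun q =>
    congrArg (TruncPoly.map d n (baseHom σ W).hom)
      congr(($((Scheme.ΓSpecIso (.of (TruncPoly d n K))).inv_hom_id)).hom q)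
  have hw : baseHom σ W ≫ CommRingCat.ofHom (TruncPoly.C d n) = baseHom (specTruncπ d n K) ⊤ ≫ b := by
    rw [h2]
    refine CommRingCat.hom_ext (RingHom.ext fun c => ?_)
    exact (TruncPoly.lift_C _ _ _ c).symm.trans (hb _).symm
  let c := H.desc (CommRingCat.ofHom (TruncPoly.C d n)) b hw
  have hc1 : ∀ s : Γ(Y, W), c ((thickFst d n σ).app W s) = TruncPoly.C d n s := fun s => by
    rw [Scheme.Hom.app_eq_appLE]
    exact congr(($(H.inl_desc (CommRingCat.ofHom (TruncPoly.C d n)) b hw)).hom s)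
  have hc2 : ∀ q, c (thickCoord d n σ (thickFst d n σ ⁻¹ᵁ W) q) =
      TruncPoly.map d n (baseHom σ W).hom q := fun q =>
    (congr(($(H.inr_desc (CommRingCat.ofHom (TruncPoly.C d n)) b hw)).hom
      ((Scheme.ΓSpecIso (.of (TruncPoly d n K))).inv q))).trans (hb q)
  have e1 : c.hom.comp (thickLift d n σ W) = RingHom.id _ := by
    refine TruncPoly.hom_ext (RingHom.ext fun s => ?_) fun i => ?_
    · rw [RingHom.comp_apply, RingHom.comp_apply, thickLift_C]
      exact hc1 s
    · rw [RingHom.comp_apply, thickLift_X]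
      exact (hc2 _).trans (TruncPoly.lift_X _ _ _ i)
  have e3 : (thickLift d n σ W).comp (TruncPoly.map d n (baseHom σ W).hom) =
      thickCoord d n σ (thickFst d n σ ⁻¹ᵁ W) := by
    refine TruncPoly.hom_ext (RingHom.ext fun s => ?_) fun i => ?_
    · simp only [RingHom.comp_apply, TruncPoly.map, TruncPoly.lift_C, thickLift_C]
      exact (thickCoord_C d n σ W s).symm
    · simp only [RingHom.comp_apply, TruncPoly.map, TruncPoly.lift_X, thickLift_X]
  have e2 : c ≫ CommRingCat.ofHom (thickLift d n σ W) = 𝟙 _ := by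
    refine H.hom_ext ?_ ?_
    · rw [← Category.assoc, H.inl_desc, Category.comp_id, ← Scheme.Hom.app_eq_appLE]
      exact CommRingCat.hom_ext (RingHom.ext fun s => thickLift_C d n σ W s)
    · rw [← Category.assoc, H.inr_desc, Category.comp_id]
      have e4 : CommRingCat.ofHom (TruncPoly.map d n (baseHom σ W).hom) ≫
          CommRingCat.ofHom (thickLift d n σ W) = (Scheme.ΓSpecIso (.of (TruncPoly d n K))).inv ≫
            (thickSnd d n σ).appLE ⊤ (thickFst d n σ ⁻¹ᵁ W) le_top := CommRingCat.hom_ext e3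
      exact (Category.assoc _ _ _).trans ((congrArg
        ((Scheme.ΓSpecIso (.of (TruncPoly d n K))).hom ≫ ·) e4).trans (Iso.hom_inv_id_assoc _ _))
  refine ⟨Function.LeftInverse.injective (g := c.hom) fun q => congr($e1 q),
    Function.RightInverse.surjective (g := c.hom) fun q => congr(($e2).hom q)⟩

lemma thickToPs_appLE_surjective {W : Y.Opens} (hW : IsAffineOpen W) :
    Function.Surjective (appLE (thickToPs d n σ) W _ le_rfl) := fun z => by
  obtain ⟨q, rfl⟩ := (thickLift_bijective d n σ hW).2 z
  obtain ⟨s, rfl⟩ := TruncPoly.trunc_surjective q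
  exact ⟨s, thickToPs_appLE d n σ W s⟩

lemma thickToPs_appLE_eq_zero_iff {W : Y.Opens} (hW : IsAffineOpen W)
    (s : MvPowerSeries (Fin d) Γ(Y, W)) : appLE (thickToPs d n σ) W _ le_rfl s = 0 ↔
      ∀ α : Fin d →₀ ℕ, α.degree ≤ n → s α = 0 := by
  rw [thickToPs_appLE]
  refine (map_eq_zero_iff _ (thickLift_bijective d n σ hW).1).trans ?_
  exact TruncPoly.trunc_eq_zero_iff

/-- Truncation to lower order. -/
def TruncPoly.factor {m n : ℕ} (h : m ≤ n) (B : Type u) [CommRing B] :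
    TruncPoly d n B →+* TruncPoly d m B :=
  TruncPoly.lift (TruncPoly.C d m) (TruncPoly.X m B) (by
    rw [← TruncPoly.vars_eq, eq_bot_iff, ← TruncPoly.vars_pow]
    exact Ideal.pow_le_pow_right (by omega))

lemma TruncPoly.factor_C {m n : ℕ} (h : m ≤ n) {B : Type u} [CommRing B] (b : B) :
    factor d h B (C d n b) = C d m b := TruncPoly.lift_C _ _ _ b

lemma TruncPoly.factor_X {m n : ℕ} (h : m ≤ n) {B : Type u} [CommRing B] (i : Fin d) :
    factor d h B (X n B i) = X m B i := TruncPoly.lift_X _ _ _ i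

lemma TruncPoly.factor_trunc {m n : ℕ} (h : m ≤ n) {B : Type u} [CommRing B]
    (s : MvPowerSeries (Fin d) B) : factor d h B (trunc n s) = trunc m s := by
  obtain ⟨p, hp⟩ := Ideal.Quotient.mk_surjective (trunc n s)
  rw [← trunc_coe, ← sub_eq_zero, ← map_sub, trunc_eq_zero_iff] at hp
  have h1 : trunc n (p : MvPowerSeries (Fin d) B) = trunc n s := by
    rw [← sub_eq_zero, ← map_sub, trunc_eq_zero_iff.2 hp]
  have h2 : trunc m (p : MvPowerSeries (Fin d) B) = trunc m s := by
    rw [← sub_eq_zero, ← map_sub, trunc_eq_zero_iff.2 fun α hα => hp α (hα.trans h)]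
  rw [← h1, ← h2, trunc_coe, trunc_coe]
  have h3 : (factor d h B).comp (Ideal.Quotient.mk _) = Ideal.Quotient.mk _ :=
    MvPolynomial.ringHom_ext (fun b => TruncPoly.factor_C d h b) fun i => TruncPoly.factor_X d h i
  exact congr($h3 p)

/-- The transition morphisms between the spectra of rings of truncated polynomials. -/
def specTruncMap {m n : ℕ} (h : m ≤ n) (K : CommRingCat.{u}) :
    specTrunc d m K ⟶ specTrunc d n K :=
  Spec.map (CommRingCat.ofHom (TruncPoly.factor d h K))

lemma specTruncMap_π {m n : ℕ} (h : m ≤ n) (K : CommRingCat.{u}) :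
    specTruncMap d h K ≫ specTruncπ d n K = specTruncπ d m K :=
  (Spec.map_comp _ _).symm.trans (congrArg Spec.map
    (CommRingCat.hom_ext (RingHom.ext (TruncPoly.factor_C d h))))

/-- The transition morphisms between the thickenings. -/
def thickMap {m n : ℕ} (h : m ≤ n) : thick d m σ ⟶ thick d n σ :=
  pullback.lift (thickFst d m σ) (thickSnd d m σ ≫ specTruncMap d h K) (by
    rw [(isPullback_thick d m σ).w, Category.assoc, specTruncMap_π])

lemma thickMap_fst {m n : ℕ} (h : m ≤ n) :
    thickMap d σ h ≫ thickFst d n σ = thickFst d m σ := pullback.lift_fst _ _ _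

lemma thickMap_snd {m n : ℕ} (h : m ≤ n) :
    thickMap d σ h ≫ thickSnd d n σ = thickSnd d m σ ≫ specTruncMap d h K := pullback.lift_snd _ _ _

lemma thickMap_coord {m n : ℕ} (h : m ≤ n) (V : (thick d n σ).Opens) (V' : (thick d m σ).Opens)
    (e : V' ≤ thickMap d σ h ⁻¹ᵁ V) (q : TruncPoly d n K) :
    (thickMap d σ h).appLE V V' e (thickCoord d n σ V q) =
      thickCoord d m σ V' (TruncPoly.factor d h K q) := by
  have h1 := baseHom_comp_appLE (K := .of (TruncPoly d n K)) (thickSnd d n σ) (thickMap d σ h) V V' e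
  have h2 := baseHom_comp_appLE (K := .of (TruncPoly d n K)) (specTruncMap d h K) (thickSnd d m σ) ⊤
    V' le_top
  have h3 : baseHom (K := .of (TruncPoly d n K)) (specTruncMap d h K) ⊤ =
      CommRingCat.ofHom (TruncPoly.factor d h K) ≫
        (Scheme.ΓSpecIso (.of (TruncPoly d m K))).inv := 
    baseHom_specMap _
  have h4 : baseHom (K := .of (TruncPoly d n K)) (thickMap d σ h ≫ thickSnd d n σ) V' =
      baseHom (K := .of (TruncPoly d n K)) (thickSnd d m σ ≫ specTruncMap d h K) V' :=
    congrArg (fun f => baseHom (K := .of (TruncPoly d n K)) f V') (thickMap_snd d σ h)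
  rw [h3] at h2
  exact congr(($(h1.trans (h4.trans h2.symm))).hom q)

lemma thickMap_lift {m n : ℕ} (h : m ≤ n) (U : Y.Opens) (V : (thick d m σ).Opens)
    (e : V ≤ thickMap d σ h ⁻¹ᵁ (thickFst d n σ ⁻¹ᵁ U)) (e' : V ≤ thickFst d m σ ⁻¹ᵁ U)
    (q : TruncPoly d n Γ(Y, U)) :
    (thickMap d σ h).appLE _ V e (thickLift d n σ U q) =
      (thick d m σ).presheaf.map (homOfLE e').op
        (thickLift d m σ U (TruncPoly.factor d h _ q)) := by
  refine congr($(TruncPoly.hom_ext (f := ((thickMap d σ h).appLE _ V e).hom.comp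
    (thickLift d n σ U)) (g := ((thick d m σ).presheaf.map (homOfLE e').op).hom.comp
    ((thickLift d m σ U).comp (TruncPoly.factor d h _))) (RingHom.ext fun b => ?_) fun i => ?_) q)
  · simp only [RingHom.comp_apply, TruncPoly.factor_C, thickLift_C]
    have h1 := Scheme.Hom.appLE_comp_appLE (thickMap d σ h) (thickFst d n σ) U _ V le_rfl e
    have h2 : (thickMap d σ h ≫ thickFst d n σ).appLE U V e = (thickFst d m σ).appLE U V e' := by
      congr 1
      exact thickMap_fst d σ h
    rw [h2, ← Scheme.Hom.app_eq_appLE] at h1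
    exact congr(($h1).hom b)
  · simp only [RingHom.comp_apply, TruncPoly.factor_X, thickLift_X]
    rw [thickMap_coord, thickCoord_res, TruncPoly.factor_X]

lemma thickMap_toPs {m n : ℕ} (h : m ≤ n) :
    (thickMap d σ h).toLRSHom ≫ thickToPs d n σ = thickToPs d m σ := by
  refine hom_ext_appLE (fun x => congr($(thickMap_fst d σ h) x)) fun U V e e' => ?_
  ext s
  have h1 := comp_appLE (thickMap d σ h).toLRSHom (thickToPs d n σ)
    (le_refl ((Opens.map (thickToPs d n σ).base).obj U)) e
  have h2 := appLE_map (thickToPs d m σ) (le_refl ((Opens.map (thickToPs d m σ).base).obj U)) e'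
  refine (congr(($h1).hom s)).symm.trans (Eq.trans ?_ congr(($h2).hom s))
  refine (congrArg ((thickMap d σ h).appLE (thickFst d n σ ⁻¹ᵁ U) V e) (thickToPs_appLE d n σ U s)).trans ?_
  refine (thickMap_lift d σ h U V e e' _).trans ?_
  refine congrArg ((thick d m σ).presheaf.map (homOfLE e').op) ?_
  exact (congrArg (thickLift d m σ U) (TruncPoly.factor_trunc d h s)).trans
    (thickToPs_appLE d m σ U s).symm

end ThickeningToPowerSeries

/-! ### Coordinates on smooth algebras -/

section Coordinates

variable {d : ℕ} {K A B P : Type u} [CommRing K] [CommRing A] [CommRing B] [CommRing P]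

/-- The elements `a i` generate the module of differentials of `A` over `K`: every `K`-derivation
on `A` takes its values in the submodule generated by the images of the `a i`. -/
def IsCoordinates (ρ : K →+* A) (a : Fin d → A) : Prop :=
  ∀ (M : Type u) [AddCommGroup M] [Module A M] (δ : A →+ M),
    (∀ x y, δ (x * y) = x • δ y + y • δ x) → (∀ c, δ (ρ c) = 0) →
    ∀ x, δ x ∈ Submodule.span A (Set.range fun i => δ (a i))

/-- For a standard smooth presentation the Kähler differentials are free on the generators outside
the image of `P.map`, and there are `d` of these. Every derivation factors through the Kähler
differentials. -/
lemma exists_isCoordinates (ρ : K →+* A) (h : ρ.IsStandardSmoothOfRelativeDimension d) :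
    ∃ a : Fin d → A, IsCoordinates ρ a := by
  algebraize [ρ]
  obtain ⟨ι, σ, _, _, P, hP⟩ := h.toAlgebra.out
  have hcard : Nat.card ((Set.range P.map)ᶜ : Set _) = d := by
    have := Fintype.ofFinite ι
    classical
    rw [← hP, Algebra.Presentation.dimension, Nat.card_coe_set_eq, Set.ncard_compl,
      ← Nat.card_coe_set_eq, Nat.card_range_of_injective P.map_inj]
  let e := (Finite.equivFinOfCardEq hcard).symm
  refine ⟨fun i => P.val (e i).1, fun M _ _ δ hδ hδ0 x => ?_⟩
  let _ : Module K M := Module.compHom M ρ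
  have : IsScalarTower K A M := ⟨fun c a m => by
    rw [Algebra.smul_def, mul_smul]; rfl⟩
  let D : Derivation K A M :=
    Derivation.mk' { δ with
      map_smul' := fun c y => by
        change δ _ = ρ c • δ y
        rw [Algebra.smul_def]
        change δ (ρ c * y) = _
        rw [hδ, hδ0, smul_zero, add_zero] } hδ
  have hD : ∀ y, D.liftKaehlerDifferential (KaehlerDifferential.D K A y) = δ y := fun y =>
    D.liftKaehlerDifferential_comp_D y
  have h1 : KaehlerDifferential.D K A x ∈ Submodule.span A (Set.range P.basisKaehler) := by
    rw [P.basisKaehler.span_eq]; trivial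
  have h2 := Submodule.mem_map_of_mem (f := D.liftKaehlerDifferential) h1
  rw [Submodule.map_span, hD, ← Set.range_comp] at h2
  refine Submodule.span_mono ?_ h2
  rintro _ ⟨k, rfl⟩
  exact ⟨e.symm k, by simp [hD]⟩

variable {ρ : K →+* A} {a : Fin d → A} {τ : K →+* B} {i : A →+* P} {j : B →+* P}

/-- Modulo `N`, which contains the square of the kernel, `i - j ∘ β` is a derivation. It vanishes on
scalars and on the `a l`, hence everywhere. Since `P` is generated by the images of `i` and `j`,
each `p` is congruent to `j (κ p)`, so `N` contains the kernel of `κ`. -/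
lemma IsCoordinates.ker_le (ha : IsCoordinates ρ a) (hij : i.comp ρ = j.comp τ)
    (hgen : ∀ p, p ∈ Subring.closure (Set.range i ∪ Set.range j))
    {β : A →+* B} {κ : P →+* B} (hi : κ.comp i = β) (hj : κ.comp j = RingHom.id B) :
    RingHom.ker κ ≤ Ideal.span (Set.range fun l => i (a l) - j (β (a l))) ⊔ RingHom.ker κ ^ 2 := by
  set N := Ideal.span (Set.range fun l => i (a l) - j (β (a l))) ⊔ RingHom.ker κ ^ 2
  have hker : ∀ x, i x - j (β x) ∈ RingHom.ker κ := fun x => by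
    rw [RingHom.mem_ker, map_sub, sub_eq_zero, ← hi]
    exact congr($(hj.symm) (κ (i x)))
  let _ : Module A (P ⧸ N) := Module.compHom _ i
  let δ : A →+ P ⧸ N :=
    ((Ideal.Quotient.mk N).comp i : A →+* P ⧸ N).toAddMonoidHom -
      ((Ideal.Quotient.mk N).comp (j.comp β)).toAddMonoidHom
  have hδ : ∀ x, δ x = Ideal.Quotient.mk N (i x - j (β x)) := fun x => (map_sub (Ideal.Quotient.mk N) _ _).symm
  have h1 : ∀ x y, δ (x * y) = x • δ y + y • δ x := fun x y => by
    rw [hδ, hδ, hδ]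
    change _ = Ideal.Quotient.mk N (i x * _) + Ideal.Quotient.mk N (i y * _)
    rw [← map_add, Ideal.Quotient.eq]
    have : i (x * y) - j (β (x * y)) - (i x * (i y - j (β y)) + i y * (i x - j (β x))) =
        -((i x - j (β x)) * (i y - j (β y))) := by
      simp only [map_mul]; ring
    rw [this]
    exact neg_mem (Ideal.mem_sup_right (by
      rw [pow_two]; exact Ideal.mul_mem_mul (hker x) (hker y)))
  have h2 : ∀ c, δ (ρ c) = 0 := fun c => by
    have e1 : i (ρ c) = j (τ c) := congr($hij c)
    have e2 : β (ρ c) = τ c := by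
      rw [← hi, RingHom.comp_apply, e1]
      exact congr($hj (τ c))
    rw [hδ, e1, e2, sub_self, map_zero]
  have h3 : ∀ x, δ x = 0 := fun x => by
    have h := ha _ δ h1 h2 x
    rw [show (fun i => δ (a i)) = fun _ => 0 from funext fun l => by
      rw [hδ, Ideal.Quotient.eq_zero_iff_mem]
      exact Ideal.mem_sup_left (Ideal.subset_span ⟨l, rfl⟩)] at h
    have h' : Submodule.span A (Set.range fun _ : Fin d => (0 : P ⧸ N)) ≤ ⊥ := by
      rw [Submodule.span_le]
      rintro _ ⟨_, rfl⟩
      exact zero_mem _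
    exact (Submodule.mem_bot A).1 (h' h)
  have h4 : ∀ p, p ∈ RingHom.eqLocus (Ideal.Quotient.mk N)
      ((Ideal.Quotient.mk N).comp (j.comp κ)) := fun p => by
    refine (Subring.closure_le.2 ?_) (hgen p)
    rintro _ (⟨x, rfl⟩ | ⟨b, rfl⟩)
    · have := h3 x
      rw [hδ, map_sub, sub_eq_zero] at this
      refine this.trans ?_
      rw [← hi]
      rfl
    · exact congrArg (fun z => Ideal.Quotient.mk N (j z)) congr($hj b).symm
  intro p hp
  have h5 : Ideal.Quotient.mk N p = Ideal.Quotient.mk N (j (κ p)) := h4 p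
  rw [RingHom.mem_ker.1 hp, map_zero, map_zero] at h5
  exact Ideal.Quotient.eq_zero_iff_mem.1 h5

open MvPowerSeries in
lemma coeff_single_one_mul (f g : MvPowerSeries (Fin d) B) (l : Fin d) :
    coeff (Finsupp.single l 1) (f * g) = constantCoeff f * coeff (Finsupp.single l 1) g +
      constantCoeff g * coeff (Finsupp.single l 1) f := by
  classical
  rw [coeff_mul, Finsupp.antidiagonal_single]
  simp [Finset.Nat.antidiagonal_succ, mul_comm]

open MvPowerSeries in
-- The vector of linear coefficients of `G` is a derivation along the constant term, so its values
-- on all of `P` lie in the span of those at the `i (a l)`. By `hsurj` that span contains the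
-- standard basis, which yields a left inverse of the Jacobian matrix.
lemma IsCoordinates.isUnit_det (ha : IsCoordinates ρ a)
    (hgen : ∀ p, p ∈ Subring.closure (Set.range i ∪ Set.range j))
    {G : P →+* MvPowerSeries (Fin d) B} (hj : ∀ b, G (j b) = C b)
    (hρ : ∀ c, G (i (ρ c)) = C (τ c))
    (hsurj : ∀ l, ∃ p, ∀ m, coeff (Finsupp.single m 1) (G p) = if l = m then 1 else 0) :
    IsUnit (Matrix.of fun l m => coeff (Finsupp.single m 1) (G (i (a l)))).det := by
  let lin : P →+ (Fin d → B) :=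
    { toFun := fun p m => coeff (Finsupp.single m 1) (G p)
      map_zero' := by ext; simp
      map_add' := fun x y => by ext; simp }
  let N : Submodule B (Fin d → B) := Submodule.span B (Set.range fun l => lin (i (a l)))
  let ev : P →+* B := constantCoeff.comp G
  have hmul : ∀ x y, lin (x * y) = ev x • lin y + ev y • lin x := fun x y => by
    ext m
    change coeff _ (G (x * y)) = _
    rw [map_mul, coeff_single_one_mul]
    rfl
  have hC : ∀ b m, coeff (Finsupp.single m 1) (C b : MvPowerSeries (Fin d) B) = 0 := fun b m => by
    classical
    rw [coeff_C, if_neg (by simp)]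
  -- Letting `A` act through the constant term turns the Leibniz rule `hmul` into the one required
  -- by `IsCoordinates`.
  let _ : Module A (Fin d → B) := Module.compHom _ (ev.comp i)
  have h1 : ∀ x, lin (i x) ∈ N := fun x => by
    have h := ha (Fin d → B) (lin.comp i.toAddMonoidHom)
      (fun x y => by
        change lin (i (x * y)) = _
        rw [map_mul, hmul]
        rfl)
      (fun c => by
        ext m
        change coeff _ (G (i (ρ c))) = 0
        rw [hρ, hC]) x
    refine Submodule.span_induction (p := fun z _ => z ∈ N) ?_ (zero_mem _)
      (fun _ _ _ _ => add_mem) (fun r _ _ hz => N.smul_mem (ev (i r)) hz) h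
    rintro _ ⟨l, rfl⟩
    exact Submodule.subset_span ⟨l, rfl⟩
  have h2 : ∀ p, lin p ∈ N := fun p => by
    refine Subring.closure_induction (p := fun p _ => lin p ∈ N) ?_ ?_ ?_
      (fun x y _ _ hx hy => ?_) (fun x _ hx => ?_) (fun x y _ _ hx hy => ?_) (hgen p)
    · rintro _ (⟨x, rfl⟩ | ⟨b, rfl⟩)
      · exact h1 x
      · convert zero_mem N
        ext m
        exact (congrArg _ (hj b)).trans (hC b m)
    · rw [map_zero]; exact zero_mem _
    · rw [← map_one i]; exact h1 1
    · rw [map_add]; exact add_mem hx hy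
    · rw [map_neg]; exact neg_mem hx
    · rw [hmul]; exact add_mem (N.smul_mem _ hy) (N.smul_mem _ hx)
  choose p hp using hsurj
  choose c hc using fun l => (Submodule.mem_span_range_iff_exists_fun B).1 (h2 (p l))
  refine IsUnit.of_mul_eq_one_right (Matrix.of c).det ?_
  rw [← Matrix.det_mul, ← Matrix.det_one (n := Fin d) (R := B)]
  congr 1
  ext l m
  rw [Matrix.mul_apply, Matrix.one_apply, ← hp l m]
  have := congrFun (hc l) m
  rw [Finset.sum_apply] at this
  exact this

end Coordinates

/-! ### Local coordinates on a smooth scheme over a field -/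

section Charts

variable {k : Type u} [Field k] {d : ℕ} {X : Scheme.{u}} (σ : X ⟶ Spec (.of k))

lemma exists_chart [SmoothOfRelativeDimension d σ] (x : X) :
    ∃ (V : X.Opens) (_ : x ∈ V) (_ : IsAffineOpen V) (a : Fin d → Γ(X, V)),
      IsCoordinates (baseHom σ V).hom a := by
  obtain ⟨U, hU, V, hV, hx, e, h⟩ :=
    SmoothOfRelativeDimension.exists_isStandardSmoothOfRelativeDimension (n := d) (f := σ) x
  -- The spectrum of a field has only one point.
  obtain rfl : U = ⊤ := by
    refine top_unique fun y _ => ?_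
    rw [Subsingleton.elim y (σ x)]
    exact e hx
  obtain ⟨a, ha⟩ := exists_isCoordinates _ h
  refine ⟨V, hx, hV, a, fun M _ _ δ h1 h2 => ha M δ h1 fun c => ?_⟩
  rw [appLE_top_eq]
  exact h2 _

end Charts

/-! ### Infinitesimal neighbourhoods of a closed immersion -/

section Neighbourhoods

lemma Scheme.Hom.ker_app_eq {T S : Scheme.{u}} (f : T ⟶ S) {U : S.Opens} {W : T.Opens}
    (h : W = f ⁻¹ᵁ U) : RingHom.ker (f.app U).hom = RingHom.ker (f.appLE U W h.le).hom := by
  subst h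
  rw [f.app_eq_appLE]

lemma Scheme.Hom.app_surjective_iff {T S : Scheme.{u}} (f : T ⟶ S) {U : S.Opens} {W : T.Opens}
    (h : W = f ⁻¹ᵁ U) : Function.Surjective (f.app U) ↔ Function.Surjective (f.appLE U W h.le) := by
  subst h
  rw [f.app_eq_appLE]

/-- Over opens disjoint from the image of `g` both sources are empty and both ideals are the unit
ideal, so it suffices to look at affine opens covering that image. -/
lemma isClosedImmersion_of_cover {T S Y : Scheme.{u}} (j : T ⟶ S) (g : Y ⟶ S) [IsClosedImmersion g]
    (hr : Set.range j ⊆ Set.range g) (n : ℕ) {ι : Type*} (U : ι → S.affineOpens)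
    (hU : ∀ y, ∃ i, g y ∈ (U i).1) (hj : ∀ i, IsAffineOpen (j ⁻¹ᵁ (U i).1))
    (hs : ∀ i, Function.Surjective (j.app (U i).1))
    (hk : ∀ i, RingHom.ker (j.app (U i).1).hom = RingHom.ker (g.app (U i).1).hom ^ (n + 1)) :
    IsClosedImmersion j ∧ j.ker = g.ker ^ (n + 1) := by
  let κ := {V : S.affineOpens // Disjoint (V.1 : Set S) (Set.range g)}
  let U' : ι ⊕ κ → S.affineOpens := Sum.elim U Subtype.val
  have hU' : ⨆ i, (U' i).1 = ⊤ := by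
    refine top_unique fun x _ => Opens.mem_iSup.2 ?_
    by_cases hx : x ∈ Set.range g
    · obtain ⟨y, rfl⟩ := hx
      obtain ⟨i, hi⟩ := hU y
      exact ⟨.inl i, hi⟩
    · obtain ⟨V, hV, hxV, hVU⟩ := Opens.isBasis_iff_nbhd.1 S.isBasis_affineOpens
        (show x ∈ (⟨(Set.range g)ᶜ, g.isClosedEmbedding.isClosed_range.isOpen_compl⟩ : S.Opens)
          from hx)
      exact ⟨.inr ⟨⟨V, hV⟩, Set.disjoint_left.2 fun y hy => hVU hy⟩, hxV⟩
  have hempty : ∀ (i : κ) {Z : Scheme.{u}} (f : Z ⟶ S) (_ : Set.range f ⊆ Set.range g),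
      f ⁻¹ᵁ i.1.1 = ⊥ := fun i Z f hf => by
    refine eq_bot_iff.2 fun x hx => ?_
    exact (Set.disjoint_left.1 i.2 hx (hf ⟨x, rfl⟩)).elim
  have hsub : ∀ (i : κ) {Z : Scheme.{u}} (f : Z ⟶ S) (_ : Set.range f ⊆ Set.range g),
      Subsingleton Γ(Z, f ⁻¹ᵁ i.1.1) := fun i Z f hf => by
    rw [hempty i f hf]
    exact CommRingCat.subsingleton_of_isTerminal Z.sheaf.isTerminalOfEmpty
  have hc : IsClosedImmersion j := by
    refine (@HasAffineProperty.iff_of_iSup_eq_top @IsClosedImmersion _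
      IsClosedImmersion.hasAffineProperty _ _ j _ U' hU').2 fun i => ?_
    have key : IsAffineOpen (j ⁻¹ᵁ (U' i).1) ∧ Function.Surjective (j.app (U' i).1) := by
      rcases i with i | i
      · exact ⟨hj i, hs i⟩
      · refine ⟨?_, fun x => ⟨0, @Subsingleton.elim _ (hsub i j hr) _ _⟩⟩
        change IsAffineOpen (j ⁻¹ᵁ i.1.1)
        rw [hempty i j hr]
        exact isAffineOpen_bot _
    refine ⟨key.1, (Scheme.Hom.app_surjective_iff (j ∣_ (U' i).1) (U := ⊤) (W := ⊤) rfl).2 ?_⟩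
    have h1 : Function.Surjective (j.appLE ((U' i).1.ι ''ᵁ ⊤) ((j ⁻¹ᵁ (U' i).1).ι ''ᵁ ⊤)
        (by simp)) := by
      refine (Scheme.Hom.app_surjective_iff j (by simp)).1 ?_
      have h : ∀ V : S.Opens, V = (U' i).1 → Function.Surjective (j.app V) := by
        rintro _ rfl
        exact key.2
      exact h _ (by simp)
    rw [morphismRestrict_appLE]
    exact h1
  refine ⟨hc, Scheme.IdealSheafData.ext_of_iSup_eq_top U' hU' fun i => ?_⟩
  change _ = g.ker.ideal (U' i) ^ (n + 1)
  rw [Scheme.Hom.ker_apply, Scheme.Hom.ker_apply]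
  rcases i with i | i
  · exact hk i
  · have h : ∀ {Z : Scheme.{u}} (f : Z ⟶ S) (_ : Set.range f ⊆ Set.range g),
        RingHom.ker (f.app i.1.1).hom = ⊤ := fun f hf =>
      top_unique fun x _ => @Subsingleton.elim _ (hsub i f hf) _ _
    refine (h j hr).trans ?_
    refine Eq.trans ?_ (congrArg (· ^ (n + 1)) (h g le_rfl).symm)
    exact (Ideal.top_pow _ _).symm

end Neighbourhoods

/-! ### Morphisms from power series to a scheme -/

section Points

open LRS TopLRS

variable {d : ℕ} {X Y : Scheme.{u}} {K : CommRingCat.{u}} {σ : X ⟶ Spec K} {τ : Y ⟶ Spec K}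
  (φ : psLRS d Y.toLocallyRingedSpace ⟶ X.toLocallyRingedSpace)

/-- The restriction of a morphism `Y[[t₁, …, t_d]] ⟶ X` to the zero section. -/
def zeroPoint : Y ⟶ X := ⟨psLRSZero d _ ≫ φ⟩

/-- The restriction of a morphism `Y[[t₁, …, t_d]] ⟶ X` to the infinitesimal thickening. -/
def thickPoint (τ : Y ⟶ Spec K) (n : ℕ) : thick d n τ ⟶ X := ⟨thickToPs d n τ ≫ φ⟩

variable {φ}

lemma zeroPoint_comp (hφ : φ ≫ σ.toLRSHom = psLRSProj d _ ≫ τ.toLRSHom) :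
    zeroPoint φ ≫ σ = τ := by
  apply Scheme.Hom.ext'
  refine (Category.assoc _ _ _).trans ?_
  rw [hφ, reassoc_of% psLRSZero_proj]

lemma thickPoint_comp (hφ : φ ≫ σ.toLRSHom = psLRSProj d _ ≫ τ.toLRSHom) (n : ℕ) :
    thickPoint φ τ n ≫ σ = thickFst d n τ ≫ τ := by
  apply Scheme.Hom.ext'
  refine (Category.assoc _ _ _).trans ?_
  rw [hφ, reassoc_of% thickToPs_proj]
  rfl

/-- The graph of the restriction to the zero section. -/
def zeroGraph (hφ : φ ≫ σ.toLRSHom = psLRSProj d _ ≫ τ.toLRSHom) : Y ⟶ pullback σ τ :=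
  pullback.lift (zeroPoint φ) (𝟙 Y) (by rw [zeroPoint_comp hφ, Category.id_comp])

/-- The graph of the restriction to the infinitesimal thickening. -/
def thickGraph (hφ : φ ≫ σ.toLRSHom = psLRSProj d _ ≫ τ.toLRSHom) (n : ℕ) :
    thick d n τ ⟶ pullback σ τ :=
  pullback.lift (thickPoint φ τ n) (thickFst d n τ) (thickPoint_comp hφ n)

lemma baseHom_comp_specMap {R : CommRingCat.{u}} (f : K ⟶ R) {Z : Scheme.{u}} (g : Z ⟶ Spec R)
    (V : Z.Opens) : baseHom (g ≫ Spec.map f) V = f ≫ baseHom g V := by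
  refine (baseHom_comp_appLE (Spec.map f) g ⊤ V le_top).symm.trans ?_
  refine (congrArg (· ≫ g.appLE ⊤ V le_top) (baseHom_specMap f)).trans ?_
  refine (Category.assoc _ _ _).trans (congrArg (f ≫ ·) ?_)
  exact (congrArg ((Scheme.ΓSpecIso R).inv ≫ ·) (appLE_top_eq g V le_top)).trans
    (Iso.inv_hom_id_assoc _ _)

lemma TruncPoly.const_X {n : ℕ} {B : Type u} [CommRing B] (i : Fin d) :
    const d n B (TruncPoly.X n B i) = 0 := by
  rw [const, lift_X]
  rfl

lemma thickZero_thickLift (n : ℕ) (U V : Y.Opens)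
    (e : V ≤ thickZero d n τ ⁻¹ᵁ thickFst d n τ ⁻¹ᵁ U) (h : V ≤ U) (q : TruncPoly d n Γ(Y, U)) :
    (thickZero d n τ).appLE (thickFst d n τ ⁻¹ᵁ U) V e (thickLift d n τ U q) =
      Y.presheaf.map (homOfLE h).op (TruncPoly.const d n _ q) := by
  refine congr($(TruncPoly.hom_ext (f := ((thickZero d n τ).appLE _ V e).hom.comp
    (thickLift d n τ U)) (g := (Y.presheaf.map (homOfLE h).op).hom.comp (TruncPoly.const d n _))
    (RingHom.ext fun b => ?_) fun i => ?_) q)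
  · simp only [RingHom.comp_apply, thickLift_C, TruncPoly.const_C]
    have h1 := Scheme.Hom.appLE_comp_appLE (thickZero d n τ) (thickFst d n τ) U _ V le_rfl e
    have h2 : ∀ (f : Y ⟶ Y) (e : V ≤ f ⁻¹ᵁ U), f = 𝟙 Y →
        f.appLE U V e = Y.presheaf.map (homOfLE h).op := by
      rintro _ e rfl
      exact Category.id_comp _
    rw [h2 _ _ (thickZero_fst d n τ), ← Scheme.Hom.app_eq_appLE] at h1
    exact congr(($h1).hom b)
  · simp only [RingHom.comp_apply, thickLift_X]
    refine Eq.trans (b := 0) ?_ ?_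
    · have h1 := baseHom_comp_appLE (K := .of (TruncPoly d n K)) (thickSnd d n τ) (thickZero d n τ)
        (thickFst d n τ ⁻¹ᵁ U) V e
      have h2 := (h1.trans (congrArg (fun g => baseHom (K := .of (TruncPoly d n K)) g V)
        (thickZero_snd d n τ))).trans (baseHom_comp_specMap _ τ V)
      refine congr(($h2).hom (TruncPoly.X n K i)).trans ?_
      refine (congrArg (baseHom τ V) ?_).trans (map_zero _)
      exact TruncPoly.const_X i
    · refine ((congrArg (Y.presheaf.map (homOfLE h).op).hom ?_).trans (map_zero _)).symm
      exact TruncPoly.const_X i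

lemma thickZero_thickToPs (n : ℕ) :
    (thickZero d n τ).toLRSHom ≫ thickToPs d n τ = psLRSZero d _ := by
  refine hom_ext_appLE (fun x => congr($(thickZero_fst d n τ) x)) fun U V e e' => ?_
  refine (comp_appLE (U := U) (V := (Opens.map (thickToPs d n τ).base).obj U) (thickZero d n τ).toLRSHom
    (thickToPs d n τ) le_rfl e).symm.trans ?_
  refine CommRingCat.hom_ext (RingHom.ext fun s => ?_)
  refine (congrArg (appLE (thickZero d n τ).toLRSHom ((Opens.map (thickToPs d n τ).base).obj U) V e) (thickToPs_appLE d n τ U s)).trans ?_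
  refine (thickZero_thickLift n U V e e' _).trans ?_
  exact congrArg (Y.presheaf.map (homOfLE e').op).hom (TruncPoly.const_trunc d n s)

lemma thickZero_thickGraph (hφ : φ ≫ σ.toLRSHom = psLRSProj d _ ≫ τ.toLRSHom) (n : ℕ) :
    thickZero d n τ ≫ thickGraph hφ n = zeroGraph hφ := by
  refine pullback.hom_ext ?_ ?_
  · rw [zeroGraph, thickGraph, Category.assoc, pullback.lift_fst, pullback.lift_fst]
    apply Scheme.Hom.ext'
    exact (Category.assoc _ _ _).symm.trans (congrArg (· ≫ φ) (thickZero_thickToPs n))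
  · rw [zeroGraph, thickGraph, Category.assoc, pullback.lift_snd, pullback.lift_snd, thickZero_fst]

lemma thickMap_thickGraph (hφ : φ ≫ σ.toLRSHom = psLRSProj d _ ≫ τ.toLRSHom) {m n : ℕ}
    (h : m ≤ n) : thickMap d τ h ≫ thickGraph hφ n = thickGraph hφ m := by
  refine pullback.hom_ext ?_ ?_
  · rw [thickGraph, thickGraph, Category.assoc, pullback.lift_fst, pullback.lift_fst]
    apply Scheme.Hom.ext'
    exact (Category.assoc _ _ _).symm.trans (congrArg (· ≫ φ) (thickMap_toPs d τ h))
  · rw [thickGraph, thickGraph, Category.assoc, pullback.lift_snd, pullback.lift_snd, thickMap_fst]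

/-- The sections on the product of an affine open subset `V` of `X` and an affine open subset `W`
of `Y`, pulled back along `(φ, p) : Y[[t₁, …, t_d]] ⟶ X × Y`. -/
lemma exists_pullback_ringHom (hφ : φ ≫ σ.toLRSHom = psLRSProj d _ ≫ τ.toLRSHom) {V : X.Opens}
    {W : Y.Opens} (hV : IsAffineOpen V) (hW : IsAffineOpen W)
    (e : W ≤ (Opens.map φ.base).obj V) (O : (pullback σ τ).Opens)
    (hO : O = pullback.fst σ τ ⁻¹ᵁ V ⊓ pullback.snd σ τ ⁻¹ᵁ W) :
    ∃ G : Γ(pullback σ τ, O) →+* MvPowerSeries (Fin d) Γ(Y, W),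
      (∀ b, G ((pullback.snd σ τ).appLE W O (hO ▸ inf_le_right) b) = MvPowerSeries.C b) ∧
      (∀ a, G ((pullback.fst σ τ).appLE V O (hO ▸ inf_le_left) a) = appLE φ V W e a) := by
  have H := isPushout_appLE (.of_hasPullback σ τ) hV hW hO
  have hw : baseHom σ V ≫ appLE φ V W e = baseHom τ W ≫
      CommRingCat.ofHom (MvPowerSeries.C (σ := Fin d) (R := Γ(Y, W))) := by
    have h1 := ((comp_appLE (U := ⊤) (V := V) φ σ.toLRSHom le_top e).trans
      (appLE_congr hφ _)).trans
      (comp_appLE (U := ⊤) (V := W) (psLRSProj d _) τ.toLRSHom le_top le_rfl).symm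
    have h2 : appLE σ.toLRSHom ⊤ V le_top = (Scheme.ΓSpecIso K).hom ≫ baseHom σ V :=
      appLE_top_eq σ V le_top
    have h3 : appLE τ.toLRSHom ⊤ W le_top = (Scheme.ΓSpecIso K).hom ≫ baseHom τ W :=
      appLE_top_eq τ W le_top
    have h4 := (Iso.cancel_iso_hom_left (Scheme.ΓSpecIso K) _ _).1
      (((Category.assoc _ _ _).symm.trans (congrArg (· ≫ appLE φ V W e) h2.symm)).trans
      (h1.trans ((congrArg (· ≫ appLE (psLRSProj d Y.toLocallyRingedSpace) W _ le_rfl) h3).trans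
        (Category.assoc _ _ _))))
    refine h4.trans (congrArg (baseHom τ W ≫ ·) ?_)
    exact appLE_self (psLRSProj d Y.toLocallyRingedSpace) W
  let c := H.desc (W := .of (MvPowerSeries (Fin d) Γ(Y, W))) (appLE φ V W e)
    (CommRingCat.ofHom MvPowerSeries.C) hw
  refine ⟨c.hom, fun b => ?_, fun a => ?_⟩
  · exact congr(($(H.inr_desc (appLE φ V W e) (CommRingCat.ofHom MvPowerSeries.C) hw)).hom b)
  · exact congr(($(H.inl_desc (appLE φ V W e) (CommRingCat.ofHom MvPowerSeries.C) hw)).hom a)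

end Points

/-! ### Thickenings and infinitesimal neighbourhoods of the graph -/

section Graphs

open LRS TopLRS

variable {d : ℕ} {X Y : Scheme.{u}} {K : CommRingCat.{u}} {σ : X ⟶ Spec K} {τ : Y ⟶ Spec K}
  {φ : psLRS d Y.toLocallyRingedSpace ⟶ X.toLocallyRingedSpace}

/-- The Jacobian determinant of `φ : Y[[t₁, …, t_d]] ⟶ X` along the zero section, with respect to
functions `a i` on `X`. -/
def coordDet (φ : psLRS d Y.toLocallyRingedSpace ⟶ X.toLocallyRingedSpace) {V : X.Opens}
    (a : Fin d → Γ(X, V)) (W : Y.Opens) (e : W ≤ (Opens.map φ.base).obj V) : Γ(Y, W) :=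
  (Matrix.of fun l m => MvPowerSeries.coeff (R := Γ(Y, W)) (Finsupp.single m 1)
    (appLE φ V W e (a l))).det

variable (hφ : φ ≫ σ.toLRSHom = psLRSProj d _ ≫ τ.toLRSHom)

lemma zeroGraph_fst : zeroGraph hφ ≫ pullback.fst σ τ = zeroPoint φ := pullback.lift_fst _ _ _

lemma zeroGraph_snd : zeroGraph hφ ≫ pullback.snd σ τ = 𝟙 Y := pullback.lift_snd _ _ _

lemma thickGraph_fst (n : ℕ) : thickGraph hφ n ≫ pullback.fst σ τ = thickPoint φ τ n :=
  pullback.lift_fst _ _ _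

lemma thickGraph_snd (n : ℕ) : thickGraph hφ n ≫ pullback.snd σ τ = thickFst d n τ :=
  pullback.lift_snd _ _ _

/-- The graph is a section of the projection to `Y`, which is separated because `σ` is. -/
lemma isClosedImmersion_zeroGraph [IsSeparated σ] : IsClosedImmersion (zeroGraph hφ) := by
  have h : IsClosedImmersion (zeroGraph hφ ≫ pullback.snd σ τ) := by
    rw [zeroGraph_snd]
    infer_instance
  exact MorphismProperty.of_postcomp @IsClosedImmersion (W' := @IsSeparated) _ (pullback.snd σ τ)
    inferInstance h

lemma zeroGraph_preimage {V : X.Opens} {W : Y.Opens} (e : W ≤ (Opens.map φ.base).obj V) :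
    W = zeroGraph hφ ⁻¹ᵁ (pullback.fst σ τ ⁻¹ᵁ V ⊓ pullback.snd σ τ ⁻¹ᵁ W) := by
  have h1 : ∀ y, pullback.fst σ τ (zeroGraph hφ y) = φ.base y := fun y =>
    congr($(zeroGraph_fst hφ) y)
  have h2 : ∀ y, pullback.snd σ τ (zeroGraph hφ y) = y := fun y => congr($(zeroGraph_snd hφ) y)
  refine le_antisymm ?_ ?_
  · exact fun y hy => ⟨Eq.subst (motive := fun z => z ∈ V) (h1 y).symm (e hy),
      Eq.subst (motive := fun z => z ∈ W) (h2 y).symm hy⟩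
  · exact fun y hy => Eq.subst (motive := fun z => z ∈ W) (h2 y) hy.2

lemma thickGraph_preimage (n : ℕ) {V : X.Opens} {W : Y.Opens}
    (e : W ≤ (Opens.map φ.base).obj V) :
    thickFst d n τ ⁻¹ᵁ W =
      thickGraph hφ n ⁻¹ᵁ (pullback.fst σ τ ⁻¹ᵁ V ⊓ pullback.snd σ τ ⁻¹ᵁ W) := by
  have h1 : ∀ y, pullback.fst σ τ (thickGraph hφ n y) = φ.base (thickFst d n τ y) := fun y =>
    congr($(thickGraph_fst hφ n) y)
  have h2 : ∀ y, pullback.snd σ τ (thickGraph hφ n y) = thickFst d n τ y := fun y =>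
    congr($(thickGraph_snd hφ n) y)
  refine le_antisymm ?_ ?_
  · exact fun y hy => ⟨Eq.subst (motive := fun z => z ∈ V) (h1 y).symm (e hy),
      Eq.subst (motive := fun z => z ∈ W) (h2 y).symm hy⟩
  · exact fun y hy => Eq.subst (motive := fun z => z ∈ W) (h2 y) hy.2

section
variable {V : X.Opens} {W : Y.Opens} (e : W ≤ (Opens.map φ.base).obj V)

/-- Both sides are ring homomorphisms on a tensor product and agree on the two factors. The geometry
of `thickGraph` is thereby reduced to the algebra of `trunc ∘ G`. -/
lemma thickGraph_appLE (hV : IsAffineOpen V) (hW : IsAffineOpen W)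
    {G : Γ(pullback σ τ, pullback.fst σ τ ⁻¹ᵁ V ⊓ pullback.snd σ τ ⁻¹ᵁ W) →+*
      MvPowerSeries (Fin d) Γ(Y, W)}
    (hG : ∀ b, G ((pullback.snd σ τ).appLE W _ inf_le_right b) = MvPowerSeries.C b)
    (hG' : ∀ a, G ((pullback.fst σ τ).appLE V _ inf_le_left a) = appLE φ V W e a) (n : ℕ) (p) :
    (thickGraph hφ n).appLE _ (thickFst d n τ ⁻¹ᵁ W) (thickGraph_preimage hφ n e).le p =
      thickLift d n τ W (TruncPoly.trunc n (G p)) := by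
  have H := isPushout_appLE (.of_hasPullback σ τ) hV hW rfl
  have h : (thickGraph hφ n).appLE _ (thickFst d n τ ⁻¹ᵁ W) (thickGraph_preimage hφ n e).le =
      CommRingCat.ofHom (((thickLift d n τ W).comp (TruncPoly.trunc n)).comp G) := by
    refine H.hom_ext ?_ ?_
    · rw [Scheme.Hom.appLE_comp_appLE]
      refine CommRingCat.hom_ext (RingHom.ext fun s => ?_)
      refine Eq.trans ?_ (congrArg (fun q => thickLift d n τ W (TruncPoly.trunc n q)) (hG' s)).symm
      refine Eq.trans ?_ (thickToPs_appLE d n τ W _)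
      have h1 := comp_appLE (U := V) (V := W) (thickToPs d n τ) φ e
        (le_refl (thickFst d n τ ⁻¹ᵁ W))
      refine Eq.trans ?_ congr(($h1).hom s).symm
      have h2 := congrArg Scheme.Hom.toLRSHom (thickGraph_fst hφ n)
      exact congr(($(appLE_congr h2 (U := V) (V := thickFst d n τ ⁻¹ᵁ W) _)).hom s)
    · rw [Scheme.Hom.appLE_comp_appLE]
      refine CommRingCat.hom_ext (RingHom.ext fun s => ?_)
      refine Eq.trans ?_ (congrArg (fun q => thickLift d n τ W (TruncPoly.trunc n q)) (hG s)).symm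
      rw [TruncPoly.trunc_C, thickLift_C, Scheme.Hom.app_eq_appLE]
      have h2 := congrArg Scheme.Hom.toLRSHom (thickGraph_snd hφ n)
      exact congr(($(appLE_congr h2 (U := W) (V := thickFst d n τ ⁻¹ᵁ W) _)).hom s)
  exact congr(($h).hom p)

/-- The graph factors through the thickening of order `0`, so the formula for `thickGraph` leaves
the constant term of `G`. -/
lemma zeroGraph_appLE (hV : IsAffineOpen V) (hW : IsAffineOpen W)
    {G : Γ(pullback σ τ, pullback.fst σ τ ⁻¹ᵁ V ⊓ pullback.snd σ τ ⁻¹ᵁ W) →+*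
      MvPowerSeries (Fin d) Γ(Y, W)}
    (hG : ∀ b, G ((pullback.snd σ τ).appLE W _ inf_le_right b) = MvPowerSeries.C b)
    (hG' : ∀ a, G ((pullback.fst σ τ).appLE V _ inf_le_left a) = appLE φ V W e a) (p) :
    (zeroGraph hφ).appLE _ W (zeroGraph_preimage hφ e).le p =
      MvPowerSeries.constantCoeff (G p) := by
  have h1 := Scheme.Hom.appLE_comp_appLE (thickZero d 0 τ) (thickGraph hφ 0)
    _ _ W (thickGraph_preimage hφ 0 e).le
    (fun y hy => Eq.subst (motive := fun z => z ∈ W)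
      (show y = thickFst d 0 τ (thickZero d 0 τ y) from congr($(thickZero_fst d 0 τ) y).symm) hy)
  have h2 : (thickZero d 0 τ ≫ thickGraph hφ 0).appLE
      (pullback.fst σ τ ⁻¹ᵁ V ⊓ pullback.snd σ τ ⁻¹ᵁ W) W
      ((zeroGraph_preimage hφ e).le.trans (by rw [thickZero_thickGraph])) =
      (zeroGraph hφ).appLE _ W (zeroGraph_preimage hφ e).le := by
    congr 1
    exact thickZero_thickGraph hφ 0
  rw [← h2]
  refine congr(($h1).hom p).symm.trans ?_
  refine (congrArg ((thickZero d 0 τ).appLE _ W _).hom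
    (thickGraph_appLE hφ e hV hW hG hG' 0 p)).trans ?_
  refine (thickZero_thickLift 0 W W _ le_rfl _).trans ?_
  rw [TruncPoly.const_trunc]
  exact congr(($(Y.presheaf.map_id (op W))).hom _)

/-- The algebraic lemmas `trunc_comp_surjective` and `ker_trunc_comp` are applied to functions
vanishing on the graph; `IsCoordinates.ker_le` provides the generation hypothesis modulo the square
of the ideal. -/
lemma appLE_eq_of_isCoordinates (hV : IsAffineOpen V) (hW : IsAffineOpen W) {a : Fin d → Γ(X, V)}
    (ha : IsCoordinates (baseHom σ V).hom a) (hdet : IsUnit (coordDet φ a W e)) (n : ℕ) :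
    Function.Surjective ((thickGraph hφ n).appLE _ _ (thickGraph_preimage hφ n e).le) ∧
    RingHom.ker ((thickGraph hφ n).appLE _ _ (thickGraph_preimage hφ n e).le).hom =
      RingHom.ker ((zeroGraph hφ).appLE _ W (zeroGraph_preimage hφ e).le).hom ^ (n + 1) := by
  have H := isPushout_appLE (.of_hasPullback σ τ) hV hW rfl
  obtain ⟨G, hG, hG'⟩ := exists_pullback_ringHom hφ hV hW e _ rfl
  set i := ((pullback.fst σ τ).appLE V (pullback.fst σ τ ⁻¹ᵁ V ⊓ pullback.snd σ τ ⁻¹ᵁ W)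
    inf_le_left).hom
  set j := ((pullback.snd σ τ).appLE W (pullback.fst σ τ ⁻¹ᵁ V ⊓ pullback.snd σ τ ⁻¹ᵁ W)
    inf_le_right).hom
  let κ := (MvPowerSeries.constantCoeff (σ := Fin d) (R := Γ(Y, W))).comp G
  -- Each `x l` is `a l` minus its value along the graph. Subtracting a constant series does not
  -- affect linear coefficients, so the Jacobian is unchanged.
  let x : Fin d → Γ(pullback σ τ, pullback.fst σ τ ⁻¹ᵁ V ⊓ pullback.snd σ τ ⁻¹ᵁ W) :=
    fun l => i (a l) - j (κ (i (a l)))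
  have hκj : κ.comp j = RingHom.id _ := RingHom.ext fun b => by
    change MvPowerSeries.constantCoeff (G (j b)) = b
    rw [hG, MvPowerSeries.constantCoeff_C]
  have hx : ∀ l, MvPowerSeries.constantCoeff (G (x l)) = 0 := fun l => by
    change κ (i (a l) - j (κ (i (a l)))) = 0
    rw [map_sub, sub_eq_zero]
    exact congr($hκj.symm (κ (i (a l))))
  have hI : RingHom.ker κ ≤ Ideal.span (Set.range x) ⊔ RingHom.ker κ ^ 2 :=
    ha.ker_le (τ := (baseHom τ W).hom) (i := i) (j := j)
      (congrArg CommRingCat.Hom.hom H.w) (mem_closure_of_isPushout H) (β := κ.comp i) rfl hκj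
  have hdet' : IsUnit (Matrix.of fun l m =>
      MvPowerSeries.coeff (Finsupp.single m 1) (G (x l))).det := by
    convert hdet using 1
    rw [coordDet]
    congr 2
    funext l m
    classical
    change MvPowerSeries.coeff _ (G (i (a l) - j (κ (i (a l))))) = _
    rw [map_sub, map_sub, hG, MvPowerSeries.coeff_C, if_neg (by simp), sub_zero, hG']
  have hker : RingHom.ker ((zeroGraph hφ).appLE _ W (zeroGraph_preimage hφ e).le).hom =
      RingHom.ker κ := by
    ext p
    rw [RingHom.mem_ker, RingHom.mem_ker]
    exact iff_of_eq (congrArg (· = 0) (zeroGraph_appLE hφ e hV hW hG hG' p))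
  have hthick : ((thickGraph hφ n).appLE _ _ (thickGraph_preimage hφ n e).le).hom =
      (thickLift d n τ W).comp ((TruncPoly.trunc n).comp G) :=
    RingHom.ext fun p => thickGraph_appLE hφ e hV hW hG hG' n p
  have hb := thickLift_bijective d n τ hW
  constructor
  · have := hb.2.comp (trunc_comp_surjective j G x hG hx hdet' n)
    intro y
    obtain ⟨p, hp⟩ := this y
    exact ⟨p, (thickGraph_appLE hφ e hV hW hG hG' n p).trans hp⟩
  · rw [hker, hthick, ← ker_trunc_comp j G x hG hx hdet' n hI]
    exact RingHom.ker_comp_of_injective _ hb.1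

end

end Graphs

/-! ### A criterion for local coordinate systems -/

section Criterion

open LRS TopLRS

variable {d : ℕ} {X Y : Scheme.{u}} {K : CommRingCat.{u}} {σ : X ⟶ Spec K} {τ : Y ⟶ Spec K}
  {φ : psLRS d Y.toLocallyRingedSpace ⟶ X.toLocallyRingedSpace}
  (hφ : φ ≫ σ.toLRSHom = psLRSProj d _ ≫ τ.toLRSHom)

/-- Locally on `Y`, the Jacobian determinant of `φ` with respect to some coordinates on `X` is
invertible. -/
def IsLocallyEtale (σ : X ⟶ Spec K)
    (φ : psLRS d Y.toLocallyRingedSpace ⟶ X.toLocallyRingedSpace) : Prop :=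
  ∀ y : Y, ∃ (V : X.Opens) (_ : IsAffineOpen V) (a : Fin d → Γ(X, V)) (W : Y.Opens)
    (_ : IsAffineOpen W) (e : W ≤ (Opens.map φ.base).obj V),
    y ∈ W ∧ IsCoordinates (baseHom σ V).hom a ∧ IsUnit (coordDet φ a W e)

lemma range_thickGraph (n : ℕ) : Set.range (thickGraph hφ n) ⊆ Set.range (zeroGraph hφ) := by
  rintro _ ⟨t, rfl⟩
  have h : thickZero d n τ (thickFst d n τ t) = t :=
    (isHomeomorph_thickFst d n τ).injective congr($(thickZero_fst d n τ) (thickFst d n τ t))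
  exact ⟨thickFst d n τ t, (congr($(thickZero_thickGraph hφ n) (thickFst d n τ t)).symm).trans
    (congrArg (thickGraph hφ n) h)⟩

lemma isAffineOpen_thickFst_preimage (n : ℕ) {W : Y.Opens} (hW : IsAffineOpen W) :
    IsAffineOpen (thickFst d n τ ⁻¹ᵁ W) :=
  isAffineOpen_inf_of_isPullback (isPullback_thick d n τ) hW (isAffineOpen_top (specTrunc d n K))
    (le_antisymm (le_inf le_rfl le_top) inf_le_left)

lemma isClosedImmersion_thickGraph [IsSeparated σ] (h : IsLocallyEtale σ φ) (n : ℕ) :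
    IsClosedImmersion (thickGraph hφ n) ∧
      (thickGraph hφ n).ker = (zeroGraph hφ).ker ^ (n + 1) := by
  choose V hV a W hW e hy ha hdet using h
  have := isClosedImmersion_zeroGraph hφ
  refine isClosedImmersion_of_cover _ _ (range_thickGraph hφ n) n
    (fun y => ⟨pullback.fst σ τ ⁻¹ᵁ V y ⊓ pullback.snd σ τ ⁻¹ᵁ W y,
      isAffineOpen_inf_of_isPullback (.of_hasPullback σ τ) (hV y) (hW y) rfl⟩)
    (fun y => ⟨y, (zeroGraph_preimage hφ (e y)).le (hy y)⟩) (fun y => ?_) (fun y => ?_) fun y => ?_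
  · refine (congrArg IsAffineOpen (thickGraph_preimage hφ n (e y))).mp ?_
    exact isAffineOpen_thickFst_preimage n (hW y)
  · exact (Scheme.Hom.app_surjective_iff _ (thickGraph_preimage hφ n (e y))).2
      (appLE_eq_of_isCoordinates hφ (e y) (hV y) (hW y) (ha y) (hdet y) n).1
  · refine (Scheme.Hom.ker_app_eq _ (thickGraph_preimage hφ n (e y))).trans ?_
    refine (appLE_eq_of_isCoordinates hφ (e y) (hV y) (hW y) (ha y) (hdet y) n).2.trans ?_
    exact congrArg (· ^ (n + 1)) (Scheme.Hom.ker_app_eq _ (zeroGraph_preimage hφ (e y))).symm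

/-- Closed immersions with the same ideal have isomorphic sources, so the thickenings of `Y` are the
infinitesimal neighbourhoods of the graph. -/
lemma exists_neighbourhood_iso [IsSeparated σ] (h : IsLocallyEtale σ φ) (n : ℕ) :
    ∃ l : ((zeroGraph hφ).ker ^ (n + 1)).subscheme ⟶ thick d n τ, IsIso l ∧
      l ≫ thickGraph hφ n = ((zeroGraph hφ).ker ^ (n + 1)).subschemeι := by
  obtain ⟨h1, h2⟩ := isClosedImmersion_thickGraph hφ h n
  have h3 := h2.trans ((zeroGraph hφ).ker ^ (n + 1)).ker_subschemeι.symm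
  exact ⟨_, IsClosedImmersion.isIso_lift _ _ h3, IsClosedImmersion.lift_fac _ _ h3.le⟩

lemma appLE_iso_bijective {T T' : Scheme.{u}} (l : T ⟶ T') [IsIso l] {M : LocallyRingedSpace.{u}}
    (f : T'.toLocallyRingedSpace ⟶ M) (U : Opens M.toTopCat) :
    ∃ g : Γ(T', (Opens.map f.base).obj U) →+*
        Γ(T, (Opens.map (l.toLRSHom ≫ f).base).obj U), Function.Bijective g ∧
      ∀ s, appLE (l.toLRSHom ≫ f) U _ le_rfl s = g (appLE f U _ le_rfl s) := by
  refine ⟨(l.app ((Opens.map f.base).obj U)).hom, ConcreteCategory.bijective_of_isIso _,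
    fun s => ?_⟩
  have h := comp_appLE (U := U) (V := (Opens.map f.base).obj U) l.toLRSHom f le_rfl le_rfl
  refine congr(($h).hom s).symm.trans ?_
  exact congr(($(appLE_self l.toLRSHom ((Opens.map f.base).obj U))).hom _)

lemma isTruncation_of_iso {Z : ℕ ⥤ Scheme.{u}} (l : ∀ n, Z.obj n ⟶ thick d n τ)
    (hl : ∀ n, IsIso (l n))
    (w : ∀ {m n : ℕ} (h : m ⟶ n), Z.map h ≫ l n = l m ≫ thickMap d τ (leOfHom h)) :
    IsTruncation (Z := Z) fun n => (l n).toLRSHom ≫ thickToPs d n τ where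
  w {m n} h := by
    have := congrArg Scheme.Hom.toLRSHom (w h)
    refine (Category.assoc _ _ _).symm.trans ((congrArg (· ≫ thickToPs d n τ) this).trans ?_)
    refine (Category.assoc (l m).toLRSHom (thickMap d τ (leOfHom h)).toLRSHom _).trans ?_
    rw [thickMap_toPs]
  isHomeomorph n := (isHomeomorph_thickFst d n τ).comp (l n).homeomorph.isHomeomorph
  surjective n W hW := by
    obtain ⟨g, hg, hg'⟩ := appLE_iso_bijective (l n) (thickToPs d n τ) W
    intro y
    obtain ⟨x, rfl⟩ := hg.2 y
    obtain ⟨s, rfl⟩ := thickToPs_appLE_surjective d n τ hW x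
    exact ⟨s, hg' s⟩
  eq_zero_iff n W hW s := by
    obtain ⟨g, hg, hg'⟩ := appLE_iso_bijective (l n) (thickToPs d n τ) W
    refine (iff_of_eq (congrArg (· = 0) (hg' s))).trans ?_
    rw [map_eq_zero_iff g hg.1]
    exact thickToPs_appLE_eq_zero_iff d n τ hW s

lemma completionι_spec (X : Scheme.{u}) (I : X.IdealSheafData) (n : ℕ) :
    colimit.ι (infinitesimalNeighbourhoods X I ⋙ Scheme.forgetToLocallyRingedSpace) n ≫
      (completionι X I).toLRSHom = (I ^ (n + 1)).subschemeι.toLRSHom :=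
  colimit.ι_desc _ _

/-- The completion is by definition the colimit of the neighbourhoods, and `Y[[t₁, …, t_d]]` is the
colimit of the isomorphic thickenings. The two projections are checked on each term of the colimit.
-/
lemma exists_isIso_of_isLocallyEtale [IsSeparated σ] (h : IsLocallyEtale σ φ) :
    ∃ ψ : powerSeries d (ofScheme Y) ⟶ completion (pullback σ τ) (zeroGraph hφ).ker, IsIso ψ ∧
      ψ.toLRSHom ≫ (completionι _ _).toLRSHom ≫ (pullback.fst σ τ).toLRSHom = φ ∧
      ψ.toLRSHom ≫ (completionι _ _).toLRSHom ≫ (pullback.snd σ τ).toLRSHom = psLRSProj d _ := by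
  choose l hl hl' using exists_neighbourhood_iso hφ h
  have hε := isTruncation_of_iso
    (Z := infinitesimalNeighbourhoods (pullback σ τ) (zeroGraph hφ).ker) l hl fun {m n} f => by
      have := (isClosedImmersion_thickGraph hφ h n).1
      -- Compatibility with the transition maps may be tested in the product, since `thickGraph` is
      -- a monomorphism.
      refine (cancel_mono (thickGraph hφ n)).1 ?_
      refine (Category.assoc _ _ _).trans (((congrArg (_ ≫ ·) (hl' n)).trans ?_).trans
        (Category.assoc _ _ _).symm)
      refine (Scheme.IdealSheafData.inclusion_subschemeι _).trans ?_
      exact ((congrArg (l m ≫ ·) (thickMap_thickGraph hφ (leOfHom f))).trans (hl' m)).symm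
  obtain ⟨ψ, hψ, hψ'⟩ := hε.exists_isIso
  obtain ⟨hc⟩ := hε.isColimit
  refine ⟨ψ, hψ, hc.hom_ext fun n => ?_, hc.hom_ext fun n => ?_⟩
  · refine (Category.assoc _ _ _).symm.trans ?_
    refine (congrArg (· ≫ _) (hψ' n)).trans ?_
    refine (Category.assoc _ _ _).symm.trans ?_
    refine (congrArg (· ≫ _) (completionι_spec _ _ n)).trans ?_
    have h1 := congrArg Scheme.Hom.toLRSHom (congrArg (· ≫ pullback.fst σ τ) (hl' n)).symm
    refine h1.trans ?_
    have h2 := congrArg Scheme.Hom.toLRSHom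
      ((Category.assoc _ _ _).trans (congrArg (l n ≫ ·) (thickGraph_fst hφ n)))
    refine h2.trans ?_
    exact (Category.assoc _ _ _).symm
  · refine (Category.assoc _ _ _).symm.trans ?_
    refine (congrArg (· ≫ _) (hψ' n)).trans ?_
    refine (Category.assoc _ _ _).symm.trans ?_
    refine (congrArg (· ≫ _) (completionι_spec _ _ n)).trans ?_
    have h1 := congrArg Scheme.Hom.toLRSHom (congrArg (· ≫ pullback.snd σ τ) (hl' n)).symm
    refine h1.trans ?_
    have h2 := congrArg Scheme.Hom.toLRSHom
      ((Category.assoc _ _ _).trans (congrArg (l n ≫ ·) (thickGraph_snd hφ n)))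
    refine h2.trans ?_
    refine (congrArg ((l n).toLRSHom ≫ ·) (thickToPs_proj d n τ)).symm.trans ?_
    exact (Category.assoc _ _ _).symm

end Criterion

/-! ### Density of functions in the completion -/

section Density

open LRS TopLRS

/-- Agreement on one term of the sequence implies agreement on all earlier ones. Hence the sets that
contain, around each of their points, a fibre of the pullback to some term form a topology, and it
refines the probe topology. -/
lemma exists_forall_mem_of_isOpen_probeTop {Z : ℕ ⥤ Scheme.{u}} {L : LocallyRingedSpace.{u}}
    (g : ∀ n, (Z.obj n).toLocallyRingedSpace ⟶ L)
    (w : ∀ {m n : ℕ} (h : m ⟶ n), (Z.map h).toLRSHom ≫ g n = g m) (U : Opens L.toTopCat)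
    {A : Set (L.presheaf.obj (op U))} (hA : @IsOpen _ (probeTop L Z.obj g U) A) {s}
    (hs : s ∈ A) : ∃ n, ∀ s', appLE (g n) U _ le_rfl s' = appLE (g n) U _ le_rfl s → s' ∈ A := by
  have mono : ∀ {m n : ℕ}, m ≤ n → ∀ s s', appLE (g n) U _ le_rfl s' = appLE (g n) U _ le_rfl s →
      appLE (g m) U _ le_rfl s' = appLE (g m) U _ le_rfl s := fun {m n} h s s' hss' => by
    have h1 := appLE_congr (w (homOfLE h)).symm (U := U) (V := (Opens.map (g m).base).obj U) le_rfl
    have h2 := comp_appLE (W := (Opens.map (g m).base).obj U) (Z.map (homOfLE h)).toLRSHom (g n)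
      (le_refl ((Opens.map (g n).base).obj U)) (by rw [← w (homOfLE h)]; exact le_rfl)
    rw [h1, ← h2]
    exact congrArg (appLE (Z.map (homOfLE h)).toLRSHom _ _ _).hom hss'
  let t : TopologicalSpace (L.presheaf.obj (op U)) :=
    { IsOpen := fun A => ∀ s ∈ A, ∃ n, ∀ s', appLE (g n) U _ le_rfl s' =
        appLE (g n) U _ le_rfl s → s' ∈ A
      isOpen_univ := fun s _ => ⟨0, fun _ _ => trivial⟩
      isOpen_inter := fun A B hA hB s hs => by
        obtain ⟨m, hm⟩ := hA s hs.1
        obtain ⟨n, hn⟩ := hB s hs.2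
        exact ⟨max m n, fun s' h => ⟨hm s' (mono (le_max_left _ _) _ _ h),
          hn s' (mono (le_max_right _ _) _ _ h)⟩⟩
      isOpen_sUnion := fun S hS s ⟨A, hA, hs⟩ => by
        obtain ⟨n, hn⟩ := hS A hA s hs
        exact ⟨n, fun s' h => ⟨A, hA, hn s' h⟩⟩ }
  have ht : t ≤ probeTop L Z.obj g U := by
    refine le_iInf fun n => le_iInf fun V => le_iInf fun _ => le_iInf fun h => ?_
    rintro _ ⟨B, -, rfl⟩ s hs
    refine ⟨n, fun s' hss' => ?_⟩
    have key : ∀ s, probe L Z.obj g n U V h s =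
        (Z.obj n).presheaf.map (homOfLE h).op (appLE (g n) U _ le_rfl s) := fun s =>
      congr(($(appLE_map (g n) le_rfl h)).hom s).symm
    rw [Set.mem_preimage, key, hss', ← key]
    exact hs
  exact ht A hA s hs

variable {d : ℕ} {Y : Scheme.{u}}

lemma isOpen_setOf_coeff_eq {W : Y.Opens} (hW : IsAffineOpen W) {ι : Type*} [Finite ι]
    (α : ι → Fin d →₀ ℕ) (c : ι → Γ(Y, W)) :
    @IsOpen _ ((powerSeries d (ofScheme Y)).sectionTop W)
      {s : MvPowerSeries (Fin d) Γ(Y, W) | ∀ i, s (α i) = c i} := by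
  rw [IsTruncation.powerSeries_sectionTop W hW]
  have h : {s : MvPowerSeries (Fin d) Γ(Y, W) | ∀ i, s (α i) = c i} =
      ⋂ i, {s | s (α i) = c i} := by
    ext; simp
  refine (congrArg (@IsOpen (MvPowerSeries (Fin d) Γ(Y, W)) (⨅ α : Fin d →₀ ℕ,
    (⊥ : TopologicalSpace Γ(Y, W)).induced fun s => s α)) h).mpr ?_
  let t : TopologicalSpace (MvPowerSeries (Fin d) Γ(Y, W)) := ⨅ α : Fin d →₀ ℕ,
    (⊥ : TopologicalSpace Γ(Y, W)).induced fun s => s α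
  refine isOpen_iInter_of_finite fun i => ?_
  have ht : t ≤ (⊥ : TopologicalSpace Γ(Y, W)).induced fun s => s (α i) := iInf_le _ (α i)
  exact ht _ ⟨{c i}, trivial, rfl⟩

/-- Density of functions in the completion. Prescribing finitely many coefficients is an open
condition, and continuity of `ψ` transports it to the completion. There it contains a whole fibre
over some infinitesimal neighbourhood, onto whose functions those of the affine `O` surject. -/
lemma exists_coeff_appLE_eq {S : Scheme.{u}} {I : S.IdealSheafData}
    (ψ : powerSeries d (ofScheme Y) ⟶ completion S I) [IsIso ψ] {O : S.Opens} (hO : IsAffineOpen O)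
    {W : Y.Opens} (hW : IsAffineOpen W)
    (h : W = (Opens.map (ψ.toLRSHom ≫ (completionι S I).toLRSHom).base).obj O)
    (f : MvPowerSeries (Fin d) Γ(Y, W)) {ι : Type*} [Finite ι] (α : ι → Fin d →₀ ℕ) :
    ∃ p : Γ(S, O), ∀ i, MvPowerSeries.coeff (R := Γ(Y, W)) (α i)
      (appLE (ψ.toLRSHom ≫ (completionι S I).toLRSHom) O W h.le p) =
        MvPowerSeries.coeff (α i) f := by
  subst h
  have hψ : IsIso ψ.toLRSHom :=
    ⟨(inv ψ).toLRSHom, congrArg TopLRS.Hom.toLRSHom (IsIso.hom_inv_id ψ),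
      congrArg TopLRS.Hom.toLRSHom (IsIso.inv_hom_id ψ)⟩
  set O' := (Opens.map (completionι S I).toLRSHom.base).obj O
  have hbij : Function.Bijective (appLE ψ.toLRSHom O' _ le_rfl) := by
    refine appLE_bijective ψ.toLRSHom O' (fun x _ => ⟨(inv ψ).toLRSHom.base x, ?_⟩) _ rfl
    exact congrArg (fun f : completion S I ⟶ completion S I => f.toLRSHom.base x) (IsIso.inv_hom_id ψ)
  obtain ⟨s, hs⟩ := hbij.2 f
  have hopen : @IsOpen _ ((completion S I).sectionTop O')
      {s | ∀ i, MvPowerSeries.coeff (α i) (appLE ψ.toLRSHom O' _ le_rfl s) =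
        MvPowerSeries.coeff (α i) f} := by
    have h1 := isOpen_setOf_coeff_eq hW α fun i => MvPowerSeries.coeff (α i) f
    have h2 := ((@continuous_def _ _ (_) (_) _).1 (ψ.continuous O')) _ h1
    rw [appLE_self]
    exact h2
  obtain ⟨n, hn⟩ := exists_forall_mem_of_isOpen_probeTop
    (Z := infinitesimalNeighbourhoods S I) (colimit.ι (infinitesimalNeighbourhoods S I ⋙
      Scheme.forgetToLocallyRingedSpace)) (fun h => colimit.w (infinitesimalNeighbourhoods S I ⋙
      Scheme.forgetToLocallyRingedSpace) h) O' hopen (s := s) fun i => by rw [hs]; rfl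
  have hspec := completionι_spec S I n
  have hpre : (Opens.map (colimit.ι (infinitesimalNeighbourhoods S I ⋙
      Scheme.forgetToLocallyRingedSpace) n).base).obj O' = (I ^ (n + 1)).subschemeι ⁻¹ᵁ O :=
    congrArg (fun f => (Opens.map f.base).obj O) hspec
  have hsurj := (Scheme.Hom.app_surjective_iff (I ^ (n + 1)).subschemeι hpre).1
    ((I ^ (n + 1)).subschemeι_app_surjective ⟨O, hO⟩)
  obtain ⟨p, hp⟩ := hsurj (appLE (colimit.ι (infinitesimalNeighbourhoods S I ⋙
      Scheme.forgetToLocallyRingedSpace) n) O' _ le_rfl s)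
  refine ⟨p, fun i => ?_⟩
  have h1 := hn (appLE (completionι S I).toLRSHom O _ le_rfl p) (by
    refine Eq.trans ?_ hp
    have h2 := (comp_appLE (U := O) (colimit.ι (infinitesimalNeighbourhoods S I ⋙
      Scheme.forgetToLocallyRingedSpace) n) (completionι S I).toLRSHom le_rfl le_rfl).trans
      (appLE_congr hspec _)
    exact congr(($h2).hom p)) i
  refine Eq.trans ?_ h1
  have h3 := comp_appLE (U := O) ψ.toLRSHom (completionι S I).toLRSHom le_rfl le_rfl
  exact congrArg (MvPowerSeries.coeff (α i)) congr(($h3).hom p).symm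

end Density

/-! ### Invertibility of the Jacobian of a local coordinate system -/

section Necessity

open LRS TopLRS

variable {d : ℕ} {X Y : Scheme.{u}} {K : CommRingCat.{u}} {σ : X ⟶ Spec K} {τ : Y ⟶ Spec K}
  {φ : psLRS d Y.toLocallyRingedSpace ⟶ X.toLocallyRingedSpace}

/-- Density supplies functions on `O` whose linear terms are the individual variables, as
`IsCoordinates.isUnit_det` requires. The ideal `I` may be arbitrary, because only the isomorphism
and the two projections enter. -/
lemma isUnit_coordDet_of_isIso {I : (pullback σ τ).IdealSheafData}
    (ψ : powerSeries d (ofScheme Y) ⟶ completion (pullback σ τ) I) [IsIso ψ]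
    (h1 : ψ.toLRSHom ≫ (completionι _ _).toLRSHom ≫ (pullback.fst σ τ).toLRSHom = φ)
    (h2 : ψ.toLRSHom ≫ (completionι _ _).toLRSHom ≫ (pullback.snd σ τ).toLRSHom = psLRSProj d _)
    {V : X.Opens} (hV : IsAffineOpen V) {a : Fin d → Γ(X, V)}
    (ha : IsCoordinates (baseHom σ V).hom a) {W : Y.Opens} (hW : IsAffineOpen W)
    (e : W ≤ (Opens.map φ.base).obj V) : IsUnit (coordDet φ a W e) := by
  set O := pullback.fst σ τ ⁻¹ᵁ V ⊓ pullback.snd σ τ ⁻¹ᵁ W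
  have hO : IsAffineOpen O := isAffineOpen_inf_of_isPullback (.of_hasPullback σ τ) hV hW rfl
  have H := isPushout_appLE (.of_hasPullback σ τ) hV hW (O := O) rfl
  set Ψ := ψ.toLRSHom ≫ (completionι _ _).toLRSHom
  have h1' : Ψ ≫ (pullback.fst σ τ).toLRSHom = φ := (Category.assoc _ _ _).trans h1
  have h2' : Ψ ≫ (pullback.snd σ τ).toLRSHom = psLRSProj d _ := (Category.assoc _ _ _).trans h2
  have b1 : ∀ y, pullback.fst σ τ (Ψ.base y) = φ.base y := fun y =>
    congrArg (fun f : psLRS d Y.toLocallyRingedSpace ⟶ X.toLocallyRingedSpace => f.base y) h1'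
  have b2 : ∀ y, pullback.snd σ τ (Ψ.base y) = y := fun y =>
    congrArg (fun f : psLRS d Y.toLocallyRingedSpace ⟶ Y.toLocallyRingedSpace => f.base y) h2'
  have hWO : W = (Opens.map Ψ.base).obj O := by
    refine le_antisymm ?_ ?_
    · exact fun y hy => ⟨Eq.subst (motive := fun z => z ∈ V) (b1 y).symm (e hy),
        Eq.subst (motive := fun z => z ∈ W) (b2 y).symm hy⟩
    · exact fun y hy => Eq.subst (motive := fun z => z ∈ W) (b2 y) hy.2
  let G : Γ(pullback σ τ, O) →+* MvPowerSeries (Fin d) Γ(Y, W) := (appLE Ψ O W hWO.le).hom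
  have hG : ∀ b, G ((pullback.snd σ τ).appLE W O inf_le_right b) = MvPowerSeries.C b := fun b => by
    have h := (comp_appLE (U := W) (V := O) Ψ (pullback.snd σ τ).toLRSHom inf_le_right
      hWO.le).trans (appLE_congr h2' _)
    refine congr(($h).hom b).trans ?_
    exact congr(($(appLE_self (psLRSProj d Y.toLocallyRingedSpace) W)).hom b)
  have hG' : ∀ s, G ((pullback.fst σ τ).appLE V O inf_le_left s) = appLE φ V W e s := fun s => by
    have h := (comp_appLE (U := V) (V := O) Ψ (pullback.fst σ τ).toLRSHom inf_le_left
      hWO.le).trans (appLE_congr h1' _)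
    exact congr(($h).hom s)
  have hdet := ha.isUnit_det (τ := (baseHom τ W).hom) (mem_closure_of_isPushout H) (G := G) hG
    (fun c => by
      refine Eq.trans (congrArg G ?_) (hG _)
      exact congr(($(H.w)).hom c))
    fun l => by
      obtain ⟨p, hp⟩ := exists_coeff_appLE_eq ψ hO hW hWO (MvPowerSeries.X l)
        (fun m : Fin d => Finsupp.single m 1)
      refine ⟨p, fun m => (hp m).trans ?_⟩
      classical
      rw [MvPowerSeries.coeff_X]
      congr 1
      rw [(Finsupp.single_left_injective one_ne_zero).eq_iff]
      exact propext eq_comm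
  refine (congrArg IsUnit ?_).mp hdet
  rw [coordDet]
  congr 2
  funext l m
  exact congrArg (MvPowerSeries.coeff (Finsupp.single m 1)) (hG' (a l))

end Necessity

/-! ### Local coordinate systems and the Jacobian determinant -/

section JacobianDeterminant

open LRS TopLRS

section
variable {d : ℕ} {X Y Y' : Scheme.{u}}
  (φ : psLRS d Y.toLocallyRingedSpace ⟶ X.toLocallyRingedSpace)

/-- Base change acts on the coefficients through a ring homomorphism, and determinants commute with
it. -/
lemma coordDet_map (f : Y' ⟶ Y) {V : X.Opens} (a : Fin d → Γ(X, V)) (W : Y.Opens)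
    (e : W ≤ (Opens.map φ.base).obj V) (W' : Y'.Opens) (e' : W' ≤ f ⁻¹ᵁ W) :
    coordDet (psLRSMap d f.toLRSHom ≫ φ) a W' (fun _ hy => e (e' hy)) =
      f.appLE W W' e' (coordDet φ a W e) := by
  refine Eq.trans ?_ (RingHom.map_det (f.appLE W W' e').hom _).symm
  refine congrArg Matrix.det (Matrix.ext fun l m => ?_)
  have h := comp_appLE (U := V) (V := W) (W := W') (psLRSMap d f.toLRSHom) φ e e'
  refine (congrArg (MvPowerSeries.coeff (R := Γ(Y', W')) (Finsupp.single m 1))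
    congr(($h).hom (a l)).symm).trans ?_
  rfl

end

variable {k : Type u} [Field k] {d : ℕ} {X Y : Over (Spec (.of k))}

lemma isLocalCoordinateSystem_of_isLocallyEtale [IsSeparated X.hom]
    {φ : (powerSeriesOver d).obj (schemeOver.obj Y) ⟶ schemeOver.obj X}
    (h : IsLocallyEtale X.hom φ.left.toLRSHom) : IsLocalCoordinateSystem φ := by
  have hφ : φ.left.toLRSHom ≫ X.hom.toLRSHom = psLRSProj d _ ≫ Y.hom.toLRSHom :=
    congrArg TopLRS.Hom.toLRSHom (Over.w φ)
  obtain ⟨ψ, h1, h2, h3⟩ := exists_isIso_of_isLocallyEtale hφ h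
  exact ⟨ψ, hom_ext h2, hom_ext h3, h1⟩

lemma IsLocalCoordinateSystem.isUnit_coordDet
    {φ : (powerSeriesOver d).obj (schemeOver.obj Y) ⟶ schemeOver.obj X}
    (h : IsLocalCoordinateSystem φ) {V : X.left.Opens} (hV : IsAffineOpen V)
    {a : Fin d → Γ(X.left, V)} (ha : IsCoordinates (baseHom X.hom V).hom a) {W : Y.left.Opens}
    (hW : IsAffineOpen W) (e : W ≤ (Opens.map φ.left.toLRSHom.base).obj V) :
    IsUnit (coordDet φ.left.toLRSHom a W e) := by
  obtain ⟨ψ, h1, h2, h3⟩ := h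
  have h3' : IsIso (Y := completion (pullback X.hom Y.hom) (graph (phiZero φ)).ker) ψ := h3
  exact isUnit_coordDet_of_isIso ψ (congrArg TopLRS.Hom.toLRSHom h1)
    (congrArg TopLRS.Hom.toLRSHom h2) hV ha hW e

end JacobianDeterminant

/-! ### The scheme of local coordinate systems -/

section CoordinateSystems

open LRS TopLRS

variable {k : Type u} [Field k] (d : ℕ) (X : Over (Spec (.of k)))

lemma arcπ_preimage_le (V : X.left.Opens) :
    arcπ d X.hom ⁻¹ᵁ V ≤ (Opens.map (arcUniv d X.hom).base).obj V := fun y hy => by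
  have h : (arcUniv d X.hom).base y = arcπ d X.hom y :=
    congrArg (fun f : (arc d X.hom).toLocallyRingedSpace ⟶ X.left.toLocallyRingedSpace =>
      f.base y) (zero_arcUniv d X.hom)
  exact Eq.subst (motive := fun z => z ∈ V) h.symm hy

/-- The Jacobian determinant of the universal morphism `X ^ d [[t₁, …, t_d]] ⟶ X`. -/
def arcDet {V : X.left.Opens} (a : Fin d → Γ(X.left, V)) :
    Γ(arc d X.hom, arcπ d X.hom ⁻¹ᵁ V) :=
  coordDet (arcUniv d X.hom) a _ (arcπ_preimage_le d X V)

/-- The open subscheme of `X ^ d` which parametrizes the local coordinate systems. -/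
def coordLocus : (arc d X.hom).Opens :=
  ⨆ (V : X.left.affineOpens) (a : Fin d → Γ(X.left, V.1))
    (_ : IsCoordinates (baseHom X.hom V.1).hom a), (arc d X.hom).basicOpen (arcDet d X a)

variable {d X}

lemma mem_coordLocus {x : arc d X.hom} : x ∈ coordLocus d X ↔ ∃ (V : X.left.affineOpens)
    (a : Fin d → Γ(X.left, V.1)), IsCoordinates (baseHom X.hom V.1).hom a ∧
      x ∈ (arc d X.hom).basicOpen (arcDet d X a) := by
  simp [coordLocus]

variable {Y : Over (Spec (.of k))}

/-- The Jacobian determinant of the pulled back morphism is the pullback of a universal one, a unit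
on a neighbourhood `W` mapping into its basic open set. -/
lemma isLocallyEtale_map_arcUniv {Y : Scheme.{u}} (f : Y ⟶ arc d X.hom)
    (hf : ∀ y, f y ∈ coordLocus d X) :
    IsLocallyEtale X.hom (psLRSMap d f.toLRSHom ≫ arcUniv d X.hom) := by
  intro y
  obtain ⟨V, a, ha, hy⟩ := mem_coordLocus.1 (hf y)
  obtain ⟨W, hW, hyW, hWV⟩ := Opens.isBasis_iff_nbhd.1 Y.isBasis_affineOpens
    (show y ∈ f ⁻¹ᵁ (arc d X.hom).basicOpen (arcDet d X a) from hy)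
  have hle : W ≤ f ⁻¹ᵁ (arcπ d X.hom ⁻¹ᵁ V.1) := fun z hz =>
    (arc d X.hom).basicOpen_le (arcDet d X a) (hWV hz)
  refine ⟨V.1, V.2, a, W, hW, fun z hz => arcπ_preimage_le d X V.1 (hle hz), hyW, ha, ?_⟩
  rw [coordDet_map (arcUniv d X.hom) f a _ (arcπ_preimage_le d X V.1) W hle]
  have h1 := (arc d X.hom).toRingedSpace.isUnit_res_basicOpen (arcDet d X a)
  have h2 := h1.map (f.appLE _ W hWV).hom
  refine (congrArg IsUnit ?_).mp h2
  exact congr(($(Scheme.Hom.map_appLE f hWV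
    (homOfLE ((arc d X.hom).basicOpen_le (arcDet d X a))).op)).hom (arcDet d X a))

/-- It matters that this holds for every chart and every choice of coordinates: the locus over a
chart is then one basic open set, independent of the coordinates. -/
lemma mem_basicOpen_of_isLocalCoordinateSystem (f : Y ⟶ arcOver d X)
    (h : IsLocalCoordinateSystem (arcPoint d X (schemeOver.map f))) {V : X.left.Opens}
    (hV : IsAffineOpen V) {a : Fin d → Γ(X.left, V)}
    (ha : IsCoordinates (baseHom X.hom V).hom a) (y : Y.left)
    (hy : arcπ d X.hom (f.left y) ∈ V) :
    f.left y ∈ (arc d X.hom).basicOpen (arcDet d X a) := by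
  obtain ⟨W, hW, hyW, hWV⟩ := Opens.isBasis_iff_nbhd.1 Y.left.isBasis_affineOpens
    (show y ∈ f.left ⁻¹ᵁ arcπ d X.hom ⁻¹ᵁ V from hy)
  have h1 := h.isUnit_coordDet hV ha hW (fun z hz => arcπ_preimage_le d X V (hWV hz))
  have h2 := coordDet_map (arcUniv d X.hom) f.left a _ (arcπ_preimage_le d X V) W hWV
  have h3 : IsUnit (f.left.appLE _ W hWV (arcDet d X a)) := (congrArg IsUnit h2).mp h1
  have h4 := Scheme.basicOpen_of_isUnit _ h3
  have h5 := Scheme.basicOpen_appLE f.left _ _ hWV (arcDet d X a)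
  exact ((h5.symm.trans h4).ge hyW).2

lemma isLocalCoordinateSystem_arcPoint_iff [IsSeparated X.hom] [SmoothOfRelativeDimension d X.hom]
    (f : Y ⟶ arcOver d X) : IsLocalCoordinateSystem (arcPoint d X (schemeOver.map f)) ↔
      ∀ y, f.left y ∈ coordLocus d X := by
  refine ⟨fun h y => ?_, fun h => ?_⟩
  · obtain ⟨V, hyV, hV, a, ha⟩ := exists_chart (d := d) X.hom (arcπ d X.hom (f.left y))
    exact mem_coordLocus.2 ⟨⟨V, hV⟩, a, ha,
      mem_basicOpen_of_isLocalCoordinateSystem f h hV ha y hyV⟩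
  · exact isLocalCoordinateSystem_of_isLocallyEtale (isLocallyEtale_map_arcUniv f.left h)

variable (d X) in
/-- The scheme of local coordinate systems on `X`. -/
def coordOver : Over (Spec (.of k)) := Over.mk ((coordLocus d X).ι ≫ (arcOver d X).hom)

variable (d X) in
/-- The open immersion of the scheme of local coordinate systems in `X ^ d`. -/
def coordι : coordOver d X ⟶ arcOver d X := Over.homMk (coordLocus d X).ι

lemma coordι_mem (x : (coordOver d X).left) : (coordι d X).left x ∈ coordLocus d X := x.2

/-- The inclusion `coordι` itself corresponds to a local coordinate system. Over a chart `V` the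
locus is therefore the basic open set of one determinant in the affine scheme `arcπ ⁻¹ᵁ V`. -/
lemma isAffineHom_coordι_arcπ [IsSeparated X.hom] [SmoothOfRelativeDimension d X.hom] :
    IsAffineHom ((coordι d X).left ≫ arcπ d X.hom) := by
  refine isAffineHom_of_forall_exists_isAffineOpen _ fun x => ?_
  obtain ⟨V, hxV, hV, a, ha⟩ := exists_chart (d := d) X.hom x
  refine ⟨V, hxV, hV, ?_⟩
  have h1 : IsAffineOpen ((arc d X.hom).basicOpen (arcDet d X a)) :=
    (hV.preimage (arcπ d X.hom)).basicOpen _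
  have h2 : (arc d X.hom).basicOpen (arcDet d X a) ≤ coordLocus d X := fun y hy =>
    mem_coordLocus.2 ⟨⟨V, hV⟩, a, ha, hy⟩
  have h3 : ((coordι d X).left ≫ arcπ d X.hom) ⁻¹ᵁ V =
      (coordLocus d X).ι ⁻¹ᵁ (arc d X.hom).basicOpen (arcDet d X a) := by
    refine le_antisymm ?_ ?_
    · exact fun y hy => mem_basicOpen_of_isLocalCoordinateSystem (coordι d X)
        ((isLocalCoordinateSystem_arcPoint_iff _).2 coordι_mem) hV ha y hy
    · exact fun y hy => (arc d X.hom).basicOpen_le (arcDet d X a) hy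
  rw [h3]
  exact h1.preimage_of_isOpenImmersion (coordLocus d X).ι (h2.trans (Scheme.Opens.opensRange_ι
    (coordLocus d X)).ge)

lemma exists_eq_arcPoint (φ : (powerSeriesOver d).obj (schemeOver.obj Y) ⟶ schemeOver.obj X) :
    ∃ f : Y ⟶ arcOver d X, arcPoint d X (schemeOver.map f) = φ := by
  obtain ⟨g, rfl⟩ := (arcPoint_bijective d X (schemeOver.obj Y)).2 φ
  refine ⟨Over.homMk (schemeFunctorFullyFaithful.preimage g.left) ?_, ?_⟩
  · exact schemeFunctorFullyFaithful.map_injective (Over.w g)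
  · exact congrArg (arcPoint d X) (Over.OverMorphism.ext rfl)

lemma arcPoint_map_injective {f g : Y ⟶ arcOver d X}
    (h : arcPoint d X (schemeOver.map f) = arcPoint d X (schemeOver.map g)) : f = g := by
  have h1 := (arcPoint_bijective d X (schemeOver.obj Y)).1 h
  exact Over.OverMorphism.ext (schemeFunctorFullyFaithful.map_injective
    (congrArg CommaMorphism.left h1))

variable (d X) in
/-- The functor of local coordinate systems. -/
def coordFunctor [IsSeparated X.hom] [SmoothOfRelativeDimension d X.hom] :
    Subfunctor (schToFSch.op ⋙ Phi d X) where
  obj Y := {φ | IsLocalCoordinateSystem (X := X) (Y := Y.unop) (d := d) φ}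
  map {Y Y'} i φ hφ := by
    -- Stability under pullback is not evident from the definition by completions. It follows
    -- because the property depends only on where the classifying morphism `f` sends points.
    obtain ⟨f, rfl⟩ := exists_eq_arcPoint φ
    have h1 := (isLocalCoordinateSystem_arcPoint_iff f).1 hφ
    have h2 : (schToFSch.op ⋙ Phi d X).map i (arcPoint d X (schemeOver.map f)) =
        arcPoint d X (schemeOver.map (i.unop ≫ f)) := by
      rw [Functor.map_comp]
      exact (arcPoint_comp d X (schemeOver.map i.unop) (schemeOver.map f)).symm
    exact Eq.subst (motive := fun φ => IsLocalCoordinateSystem φ) h2.symm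
      ((isLocalCoordinateSystem_arcPoint_iff _).2 fun y => h1 (i.unop.left y))

variable (d X) in
/-- The local coordinate system corresponding to a morphism to the scheme of local coordinate
systems. -/
def coordPoint [IsSeparated X.hom] [SmoothOfRelativeDimension d X.hom] (f : Y ⟶ coordOver d X) :
    (coordFunctor d X).toFunctor.obj (op Y) :=
  ⟨arcPoint d X (schemeOver.map (f ≫ coordι d X)),
    (isLocalCoordinateSystem_arcPoint_iff _).2 fun y => coordι_mem (f.left y)⟩

lemma coordPoint_bijective [IsSeparated X.hom] [SmoothOfRelativeDimension d X.hom] :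
    Function.Bijective (coordPoint d X (Y := Y)) := by
  refine ⟨fun f g h => ?_, fun ⟨φ, hφ⟩ => ?_⟩
  · have h1 := congrArg CommaMorphism.left (arcPoint_map_injective (congrArg Subtype.val h))
    exact Over.OverMorphism.ext ((cancel_mono (coordLocus d X).ι).1 h1)
  · obtain ⟨f, rfl⟩ := exists_eq_arcPoint φ
    have h1 := (isLocalCoordinateSystem_arcPoint_iff f).1 hφ
    have h2 : Set.range f.left ⊆ Set.range (coordLocus d X).ι := by
      rintro _ ⟨y, rfl⟩
      exact (Scheme.Opens.range_ι (coordLocus d X)).ge (h1 y)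
    let g := IsOpenImmersion.lift (coordLocus d X).ι f.left h2
    have hg : g ≫ (coordLocus d X).ι = f.left := IsOpenImmersion.lift_fac _ _ _
    refine ⟨Over.homMk g ?_, Subtype.ext (congrArg (fun f => arcPoint d X (schemeOver.map f)) ?_)⟩
    · exact (Category.assoc _ _ _).symm.trans ((congrArg (· ≫ _) hg).trans (Over.w f))
    · exact Over.OverMorphism.ext hg

variable (d X) in
/-- The scheme of local coordinate systems represents the functor of local coordinate systems. -/
def coordRepresentableBy [IsSeparated X.hom] [SmoothOfRelativeDimension d X.hom] :
    (coordFunctor d X).toFunctor.RepresentableBy (coordOver d X) where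
  homEquiv := Equiv.ofBijective _ coordPoint_bijective
  homEquiv_comp f g := Subtype.ext <| by
    change arcPoint d X (schemeOver.map ((f ≫ g) ≫ coordι d X)) = _
    rw [Category.assoc, Functor.map_comp]
    exact arcPoint_comp d X (schemeOver.map f) (schemeOver.map (g ≫ coordι d X))

end CoordinateSystems

end FormalGeometry

end

/-! ### Assembly of the theorem -/

theorem theorem6p1p4 (k : Type u) [Field k] [IsAlgClosed k] [CharZero k] (d : ℕ)
    (X : Over (Spec (.of k))) [IsSeparated X.hom] [SmoothOfRelativeDimension d X.hom] :
    ∃ (Xd : Over (Spec (.of k)))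
      (univ : (FormalGeometry.Phi d X).RepresentableBy (FormalGeometry.schToFSch.obj Xd))
      (Phi₀ : Subfunctor (FormalGeometry.schToFSch.op ⋙ FormalGeometry.Phi d X))
      (U : Xd.left.Opens)
      (rep : Phi₀.toFunctor.RepresentableBy (Over.mk (U.ι ≫ Xd.hom))),
      (∀ (Y : Over (Spec (.of k)))
        (φ : (FormalGeometry.powerSeriesOver d).obj (FormalGeometry.schemeOver.obj Y) ⟶
          FormalGeometry.schemeOver.obj X),
        φ ∈ Phi₀.obj (op Y) ↔ FormalGeometry.IsLocalCoordinateSystem φ) ∧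
      (rep.homEquiv (𝟙 _)).1 = univ.homEquiv
        (FormalGeometry.schToFSch.map (Over.homMk U.ι : Over.mk (U.ι ≫ Xd.hom) ⟶ Xd)) ∧
      IsAffineHom (FormalGeometry.phiZero (univ.homEquiv (𝟙 _))).left ∧
      IsAffineHom (FormalGeometry.phiZero (rep.homEquiv (𝟙 _)).1).left := by
  refine ⟨FormalGeometry.arcOver d X, FormalGeometry.arcRepresentableBy d X,
    FormalGeometry.coordFunctor d X, FormalGeometry.coordLocus d X,
    FormalGeometry.coordRepresentableBy d X, fun Y φ => Iff.rfl, ?_, ?_, ?_⟩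
  · exact congrArg (fun f => FormalGeometry.arcPoint d X (FormalGeometry.schemeOver.map f))
      (Category.id_comp (FormalGeometry.coordι d X))
  · have h : (FormalGeometry.phiZero (FormalGeometry.arcPoint d X
        (FormalGeometry.schemeOver.map (𝟙 (FormalGeometry.arcOver d X))))).left =
        FormalGeometry.arcπ d X.hom :=
      (FormalGeometry.phiZero_arcPoint d X (𝟙 _)).trans (Category.id_comp _)
    have h1 : IsAffineHom (FormalGeometry.arcπ d X.hom) := inferInstance
    have h2 : IsAffineHom (FormalGeometry.phiZero (FormalGeometry.arcPoint d X
        (FormalGeometry.schemeOver.map (𝟙 (FormalGeometry.arcOver d X))))).left :=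
      (congrArg IsAffineHom h).mpr h1
    rw [FormalGeometry.schemeOver.map_id] at h2
    exact h2
  -- For the universal local coordinate system, φ₀ is the open immersion into `arc` followed by
  -- `arcπ`.
  · have h := FormalGeometry.phiZero_arcPoint d X
      (𝟙 (FormalGeometry.coordOver d X) ≫ FormalGeometry.coordι d X)
    refine (congrArg IsAffineHom h).mpr ?_
    rw [Category.id_comp]
    exact FormalGeometry.isAffineHom_coordι_arcπ
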